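/- Let $\mathcal G=(\mathrm V,\mathrm E)$ be a connected metric graph: each edge $e$ is identified with $I_e=[0,\ell_e]$, $0<\ell_e<\infty$, whose two endpoints are attached to vertices, or with $I_e=[0,\infty)$, attached to a vertex at $0$ only (loops and multiple edges are allowed); $\operatorname{dist}$ is the shortest distance along the edges. Assume that $\mathcal G$ is locally finite: $\mathrm E$ is at most countable and every bounded subset of $\mathcal G$ meets only finitely many edges. Let $A=(A_e)$, $A_e\in C^1(I_e,\mathbb R)$, and $V=(V_e)$, $V_e\in C(I_e,[1,\infty))$, for every $e\in\mathrm E$. Let $L^2(\mathcal G,\mathbb C)=\bigoplus_{e}L^2(I_e,\mathbb C)$ with $(u,v)_2=\int_{\mathcal G}u\bar v\,dx$, let $D_Au=\frac1i u'-Au$ on each edge (weak derivative), let $$H^1_A(\mathcal G,\mathbb C)=\Big\{u\in C(\mathcal G,\mathbb C): D_Au\in L^2(\mathcal G,\mathbb C),\ \int_{\mathcal G}V|u|^2\,dx<\infty\Big\},\qquad Q(u,v)=\int_{\mathcal G}\big(D_Au\,\overline{D_Av}+Vu\bar v\big)\,dx,$$ and let $\widetilde H^2_c(\mathcal G,\mathbb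 C)$ be the set of all $u\in C(\mathcal G,\mathbb C)$ of bounded support such that $u_e'\in C(I_e,\mathbb C)$ for every edge $e$, $u''\in L^2(\mathcal G,\mathbb C)$, and $$\sum_{e\succ v}\Big(\tfrac1i u_e'(v)-A_e^{\pm}(v)u_e(v)\Big)=0\qquad\text{for every } v\in\mathrm V.$$ Here the sum runs over the edge ends at $v$ (a loop counts twice), and $u_e'(v)$, $A_e^\pm(v)$ stand for $u_e'(0)$, $A_e(0)$ at the end $0$ of $e$ and for $-u_e'(\ell_e)$, $-A_e(\ell_e)$ at the end $\ell_e$. Then: 1. The functions of $\widetilde H^2_c(\mathcal G,\mathbb C)$ belong to $L^2(\mathcal G,\mathbb C)$, and $S:=D_A^2+V$ with $\operatorname{dom}(S)=\widetilde H^2_c(\mathcal G,\mathbb C)$ is a well-defined, densely defined, symmetric, non-negative linear operator in $L^2(\mathcal G,\mathbb C)$. 2. There is a unique self-adjoint operator $T$ in $L^2(\mathcal G,\mathbb C)$ with $\operatorname{dom}(T)\subset H^1_A(\mathcal G,\mathbb C)$ and $Q(u,v)=(Tu,v)_2$ for all $u\in\operatorname{dom}(T)$ and $v\in H^1_A(\mathcal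 G,\mathbb C)$. 3. $T$ is the Friedrichs extension of $S$, that is, the self-adjoint extension of $S$ associated with the closure $\overline{Q_0}$ of the form $Q_0(u,w)=(Su,w)_2$ on $\operatorname{dom}(S)$: $S\subset T$, $\operatorname{dom}(T)\subset\operatorname{dom}(\overline{Q_0})$, and $\overline{Q_0}(u,v)=(Tu,v)_2$ for all $u\in\operatorname{dom}(T)$ and $v\in\operatorname{dom}(\overline{Q_0})$. -/

import Mathlib

open MeasureTheory Filter Topology Set
open scoped ENNReal ContDiff ComplexConjugate InnerProductSpace

/-- A metric graph with vertices `𝒱` and edges `ℰ` (loops and multiple edges are allowed).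
An edge `e` of finite length is identified with `[0, length e]`, its end `0` being attached to the
vertex `source e` and its end `length e` to the vertex `target e`; an edge of infinite length is
identified with the half-line `[0, ∞)`, which is attached at `0` only. -/
structure MetricGraph (𝒱 ℰ : Type*) where
  length : ℰ → ℝ≥0∞
  length_pos : ∀ e, 0 < length e
  source : ℰ → 𝒱
  target : ∀ e, length e ≠ ⊤ → 𝒱

namespace MetricGraph

variable {𝒱 ℰ : Type*} (G : MetricGraph 𝒱 ℰ)

/-- The closed interval `I_e`, that is `[0, ℓ_e]` or `[0, ∞)`. -/
def I (e : ℰ) : Set ℝ := {x | 0 ≤ x ∧ ENNReal.ofReal x ≤ G.length e}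

/-- The interior of `I_e`, that is `(0, ℓ_e)` or `(0, ∞)`. -/
def openI (e : ℰ) : Set ℝ := {x | 0 < x ∧ ENNReal.ofReal x < G.length e}

/-! ### The graph as a metric space -/

/-- The points of the graph: its vertices and the interior points of its edges. -/
inductive Point : Type _
  | vertex (v : 𝒱) : Point
  | inner (e : ℰ) (x : ℝ) (hx : x ∈ G.openI e) : Point

open Classical in
/-- The point of the graph with coordinate `x ∈ I_e` on the edge `e`. -/
noncomputable def pt (e : ℰ) (x : ℝ) : G.Point :=
  if h0 : 0 < x then
    if h1 : ENNReal.ofReal x < G.length e then .inner e x ⟨h0, h1⟩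
    else .vertex (G.target e (ne_top_of_le_ne_top ENNReal.ofReal_ne_top (not_lt.mp h1)))
  else .vertex (G.source e)

/-- `G.Path p q r`: the point `q` is reached from the point `p` by finitely many successive moves
along edges, of total length `r`. -/
inductive Path : G.Point → G.Point → ℝ → Prop
  | nil (p : G.Point) : Path p p 0
  | snoc {p : G.Point} {e : ℰ} {x y r : ℝ} (hx : x ∈ G.I e) (hy : y ∈ G.I e)
      (h : Path p (G.pt e x) r) : Path p (G.pt e y) (r + |y - x|)

/-- The shortest distance along the edges (infinite if there is no path). -/
noncomputable def dist (p q : G.Point) : ℝ≥0∞ :=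
  ⨅ (r : ℝ) (_ : G.Path p q r), ENNReal.ofReal r

/-- A set of points of finite diameter. -/
def IsBddSet (B : Set G.Point) : Prop :=
  ∃ R : ℝ, ∀ p ∈ B, ∀ q ∈ B, G.dist p q ≤ ENNReal.ofReal R

/-- The graph is non-empty and any two of its points are joined by a path. -/
def Connected : Prop := Nonempty 𝒱 ∧ ∀ p q : G.Point, ∃ r : ℝ, G.Path p q r

/-- The edge `e` as a (closed) subset of the graph. -/
def edgeSet (e : ℰ) : Set G.Point := G.pt e '' G.I e

/-- There are at most countably many edges, and every bounded set meets only finitely many. -/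
def LocallyFinite : Prop :=
  Countable ℰ ∧ ∀ B : Set G.Point, G.IsBddSet B → {e | (G.edgeSet e ∩ B).Nonempty}.Finite

/-! ### Ends of edges

For a loop at `v`, both of its ends are at `v`. -/

/-- The ends of the edges; a half-line has only one. -/
inductive EdgeEnd : Type _
  | source (e : ℰ) : EdgeEnd
  | target (e : ℰ) (h : G.length e ≠ ⊤) : EdgeEnd

variable {G}

/-- The edge that an end belongs to. -/
def EdgeEnd.edge : G.EdgeEnd → ℰ
  | .source e => e
  | .target e _ => e

/-- The vertex at which an end is attached. -/
def EdgeEnd.vertex : G.EdgeEnd → 𝒱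
  | .source e => G.source e
  | .target e h => G.target e h

/-- The coordinate of an end on its edge: `0` or `ℓ_e`. -/
noncomputable def EdgeEnd.pos : G.EdgeEnd → ℝ
  | .source _ => 0
  | .target e _ => (G.length e).toReal

/-- `1` at the end `0` and `-1` at the end `ℓ_e`: the direction that points into the edge. -/
def EdgeEnd.sign : G.EdgeEnd → ℝ
  | .source _ => 1
  | .target _ _ => -1

variable (G)

/-! ### Functions on the graph

A function on the graph is given by a family `u e : ℝ → ℂ`, of which only the values on `I_e`
matter. -/

/-- Continuity on the graph: continuity on each closed edge, with one common value at a vertex on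
all the edge ends attached to it. -/
def IsCont (u : ℰ → ℝ → ℂ) : Prop :=
  (∀ e, ContinuousOn (u e) (G.I e)) ∧
    ∀ a b : G.EdgeEnd, a.vertex = b.vertex → u a.edge a.pos = u b.edge b.pos

/-- The support of `u` is bounded. (The support is the closure of the set below; taking the closure
does not affect boundedness.) -/
def HasBddSupport (u : ℰ → ℝ → ℂ) : Prop :=
  G.IsBddSet {p | ∃ e, ∃ x ∈ G.I e, G.pt e x = p ∧ u e x ≠ 0}

/-- `u_e ∈ L²(I_e)` for all `e`, and the squared norms are summable. -/
def MemL2 (u : ℰ → ℝ → ℂ) : Prop :=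
  (∀ e, MemLp (u e) 2 (volume.restrict (G.I e))) ∧
    Summable fun e => ∫ x in G.I e, ‖u e x‖ ^ 2

/-- The complex Hilbert space `L²(𝒢, ℂ) = ⨁ L²(I_e, ℂ)` (Hilbert sum). Its inner product
`⟪f, g⟫_ℂ`, linear in the second variable, is `∑ ∫ conj f_e * g_e`. -/
abbrev L2 : Type _ := lp (fun e : ℰ => Lp ℂ 2 (volume.restrict (G.I e))) 2

/-- The family of functions `u` represents the element `f` of `L²(𝒢, ℂ)`. -/
def Represents (u : ℰ → ℝ → ℂ) (f : G.L2) : Prop :=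
  ∀ e, (f e : ℝ → ℂ) =ᵐ[volume.restrict (G.I e)] u e

/-- `w` is the weak derivative of `u` on the open interval `J`. -/
def HasWeakDeriv (J : Set ℝ) (u w : ℝ → ℂ) : Prop :=
  LocallyIntegrableOn u J ∧ LocallyIntegrableOn w J ∧
    ∀ φ : ℝ → ℝ, ContDiff ℝ ∞ φ → HasCompactSupport φ → tsupport φ ⊆ J →
      ∫ x in J, deriv φ x • u x = -∫ x in J, φ x • w x

open Classical in
/-- The weak derivative on `J` (determined almost everywhere), if there is one. -/
noncomputable def weakDeriv (J : Set ℝ) (u : ℝ → ℂ) : ℝ → ℂ :=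
  if h : ∃ w, HasWeakDeriv J u w then h.choose else 0

/-- The magnetic derivative `D_A u = (1/i) u' - A u`, on each edge, with the weak derivative. -/
noncomputable def magD (A : ℰ → ℝ → ℝ) (u : ℰ → ℝ → ℂ) : ℰ → ℝ → ℂ := fun e x =>
  1 / Complex.I * weakDeriv (G.openI e) (u e) x - A e x * u e x

/-- The magnetic Sobolev space `H¹_A(𝒢, ℂ)`: continuous `u` with `D_A u ∈ L²` and
`∫ V |u|² < ∞`. -/
def MemH1A (A V : ℰ → ℝ → ℝ) (u : ℰ → ℝ → ℂ) : Prop :=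
  G.IsCont u ∧
  (∀ e, ∃ w, HasWeakDeriv (G.openI e) (u e) w) ∧
  G.MemL2 (G.magD A u) ∧
  (∀ e, IntegrableOn (fun x => V e x * ‖u e x‖ ^ 2) (G.I e)) ∧
  Summable fun e => ∫ x in G.I e, V e x * ‖u e x‖ ^ 2

/-- The form `Q(u, v) = ∫ D_A u conj (D_A v) + V u conj v`. -/
noncomputable def formQ (A V : ℰ → ℝ → ℝ) (u v : ℰ → ℝ → ℂ) : ℂ :=
  ∑' e, ∫ x in G.I e,
    (G.magD A u e x * conj (G.magD A v e x) + V e x * (u e x * conj (v e x)))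

/-- `T` is a self-adjoint operator associated with the form `Q` on `H¹_A`: its domain is contained
in `H¹_A`, and `Q(u, v) = (T u, v)₂` for all `u ∈ dom T` and all `v ∈ H¹_A`. -/
def IsFormOperator (A V : ℰ → ℝ → ℝ) (T : G.L2 →ₗ.[ℂ] G.L2) : Prop :=
  IsSelfAdjoint T ∧ ∀ f : T.domain, ∃ u, G.MemH1A A V u ∧ G.Represents u (f : G.L2) ∧
    ∀ (g : G.L2) (v : ℰ → ℝ → ℂ), G.MemH1A A V v → G.Represents v g →
      G.formQ A V u v = ⟪g, T f⟫_ℂ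

/-- The magnetic Kirchhoff condition at every vertex: the sum, over the edge ends at the vertex, of
`(1/i) u' - A u`, where `u'` and `A` are taken in the direction pointing into the edge. -/
def Kirchhoff (A : ℰ → ℝ → ℝ) (u : ℰ → ℝ → ℂ) : Prop :=
  ∀ v : 𝒱, ∑ᶠ a : {a : G.EdgeEnd // a.vertex = v},
    (1 / Complex.I * (a.1.sign * derivWithin (u a.1.edge) (G.I a.1.edge) a.1.pos)
      - (a.1.sign * A a.1.edge a.1.pos : ℝ) * u a.1.edge a.1.pos) = 0

/-- The space `H̃²_c(𝒢, ℂ)`: continuous `u` of bounded support, with `u_e'` continuous on the closed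
edge `I_e` for all `e`, with weak second derivative in `L²(𝒢, ℂ)`, and satisfying the magnetic
Kirchhoff conditions. -/
def MemH2c (A : ℰ → ℝ → ℝ) (u : ℰ → ℝ → ℂ) : Prop :=
  G.IsCont u ∧ G.HasBddSupport u ∧
  (∀ e, ContDiffOn ℝ 1 (u e) (G.I e)) ∧
  (∃ w : ℰ → ℝ → ℂ,
    (∀ e, HasWeakDeriv (G.openI e) (derivWithin (u e) (G.I e)) (w e)) ∧ G.MemL2 w) ∧
  G.Kirchhoff A u

/-- `S` is the operator `D_A² + V` in `L²(𝒢, ℂ)` with domain `H̃²_c(𝒢, ℂ)`. (This determines the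
domain and the values of `S`.) -/
def IsMagneticSchrodinger (A V : ℰ → ℝ → ℝ) (S : G.L2 →ₗ.[ℂ] G.L2) : Prop :=
  (∀ f : G.L2, f ∈ S.domain ↔ ∃ u, G.MemH2c A u ∧ G.Represents u f) ∧
  ∀ (f : S.domain) (u : ℰ → ℝ → ℂ), G.MemH2c A u → G.Represents u (f : G.L2) →
    G.Represents (fun e x => G.magD A (G.magD A u) e x + V e x * u e x) (S f)

/-- Every function in `H̃²_c` defines an element of `L²(𝒢, ℂ)`. -/
def H2cSubsetL2 (A : ℰ → ℝ → ℝ) : Prop :=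
  ∀ u : ℰ → ℝ → ℂ, G.MemH2c A u → ∃ f : G.L2, G.Represents u f

end MetricGraph

section Friedrichs

variable {H : Type*} [NormedAddCommGroup H] [InnerProductSpace ℂ H]

/-- The sequence `s` in `dom S` converges to `u` in `H` and is a Cauchy sequence for the form
`(S x, y)`, so that `u` belongs to the domain of the closure of this form. -/
def FormConverges (S : H →ₗ.[ℂ] H) (s : ℕ → S.domain) (u : H) : Prop :=
  Tendsto (fun n => (s n : H)) atTop (𝓝 u) ∧
  ∀ ε > 0, ∃ N, ∀ m ≥ N, ∀ n ≥ N,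
    (⟪((s m - s n : S.domain) : H), S (s m - s n)⟫_ℂ).re < ε

/-- `T` is the Friedrichs extension of the densely defined symmetric non-negative operator `S`: the
self-adjoint extension of `S` associated with the closure `q` of the form `(S x, y)`, `x, y ∈ dom S`.
That is, `dom T` is contained in the domain of `q`, and `q(u, v) = (T u, v)` for all `u ∈ dom T` and
all `v` in the domain of `q`, where `q(u, v)` is the limit of `(S uₙ, vₙ)` along sequences in `dom S`
that converge to `u` and `v` in the above sense. -/
structure IsFriedrichsExtension [CompleteSpace H] (S T : H →ₗ.[ℂ] H) : Prop where
  dense : Dense (S.domain : Set H)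
  symmetric : ∀ x y : S.domain, ⟪S x, (y : H)⟫_ℂ = ⟪(x : H), S y⟫_ℂ
  nonneg : ∀ x : S.domain, 0 ≤ (⟪(x : H), S x⟫_ℂ).re
  selfAdjoint : IsSelfAdjoint T
  le : S ≤ T
  domain_le : ∀ u : T.domain, ∃ s : ℕ → S.domain, FormConverges S s (u : H)
  form_eq : ∀ (u : T.domain) (v : H) (s t : ℕ → S.domain),
    FormConverges S s (u : H) → FormConverges S t v →
      Tendsto (fun n => ⟪(t n : H), S (s n)⟫_ℂ) atTop (𝓝 ⟪v, T u⟫_ℂ)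

end Friedrichs

/-! The space H¹_A with the inner product Q is a Hilbert space Y, and the inclusion J : Y → L² is
bounded and injective with dense range. For such a J the operator T = (J J†)⁻¹ is self-adjoint, and
the defining property of J† says that the Y-inner product of y with J†(T f) is the L²-inner product
of J y with T f, which is the identity Q(u, v) = (T u, v). Any other self-adjoint operator with this
property is contained in T, hence equal to T, because self-adjoint operators have no proper
self-adjoint extensions.

Let S be a restriction of T to a domain whose preimage under J is dense in Y. The form of S is the
inner product of Y, so form-Cauchy sequences are exactly Cauchy sequences of Y, the closure of the
form is Q on all of Y, and T is the Friedrichs extension of S. This is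
`isFriedrichsExtension_formOperator`, and it leaves three facts about the graph.

Completeness of Y (`isClosed_energySpace`): Y is realized as the triples (D_A u, √(V - 1) u, u),
whose squared norms add up to Q(u, u). It is closed because evaluation at a point is bounded, so
that continuity at the vertices survives limits.

S ⊂ T (`inner_eq_inner_of_kirchhoff`): integration by parts on each edge leaves terms at the edge
ends. Regrouped by vertex, they vanish by the Kirchhoff condition for u and the continuity of the
test function.

Density of H̃²_c in Y: an element is first cut off with Lipschitz functions of the distance to a
vertex (`exists_compactSupp_tendsto`). On each of the finitely many remaining edges a gauge
transformation then removes A, and the derivative is replaced by a test function with the same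
integral (`exists_edge_approx_of_pos`). This keeps the values at the edge ends and makes D_A vanish
there, so both vertex conditions hold.

Throughout, weak derivatives on open edges are turned into integral identities on closed edges
(`HasWeakDeriv.isPrimitiveOn`, `IsPrimitiveOn.of_subset_closure`), which give access to the end
values. -/

/-! ### Operators associated with a Hilbert space that is densely embedded in another one -/

section FormOperator

variable {H Y : Type*} [NormedAddCommGroup H] [InnerProductSpace ℂ H] [CompleteSpace H]
  [NormedAddCommGroup Y] [InnerProductSpace ℂ Y] [CompleteSpace Y]

/-- The operator in `H` associated with the inner product of `Y`, regarded as a form in `H` by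
means of `J : Y → H`. It is the inverse of `J J†`. -/
noncomputable def formOperator (J : Y →L[ℂ] H) : H →ₗ.[ℂ] H :=
  ((J ∘L ContinuousLinearMap.adjoint J : H →L[ℂ] H).toLinearMap.toPMap ⊤).inverse

variable {J : Y →L[ℂ] H}

/-- Pairing J J†g with g gives ‖J†g‖² = 0, and the kernel of J† is orthogonal to the dense range of
J. -/
lemma adjoint_injective_of_denseRange (hJ : DenseRange J) {g : H}
    (hg : J (ContinuousLinearMap.adjoint J g) = 0) : g = 0 := by
  have h1 : ContinuousLinearMap.adjoint J g = 0 := by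
    rw [← inner_self_eq_zero (𝕜 := ℂ), ContinuousLinearMap.adjoint_inner_left, hg, inner_zero_right]
  refine hJ.eq_zero_of_inner_right (𝕜 := ℂ) fun y => ?_
  rw [← ContinuousLinearMap.adjoint_inner_right, h1, inner_zero_right]

lemma formOperator_ker (hJ : DenseRange J) :
    LinearMap.ker
      ((J ∘L ContinuousLinearMap.adjoint J : H →L[ℂ] H).toLinearMap.toPMap ⊤).toFun = ⊥ := by
  rw [LinearMap.ker_eq_bot']
  rintro ⟨g, hg⟩ h
  exact Subtype.ext (adjoint_injective_of_denseRange hJ h)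

lemma exists_formOperator_eq (hJ : DenseRange J) {f g : H}
    (h : J (ContinuousLinearMap.adjoint J g) = f) :
    ∃ hf : f ∈ (formOperator J).domain, formOperator J ⟨f, hf⟩ = g := by
  have hf : f ∈ (formOperator J).domain := by
    rw [formOperator, LinearPMap.inverse_domain]
    exact ⟨⟨g, trivial⟩, h⟩
  exact ⟨hf, LinearPMap.inverse_apply_eq (formOperator_ker hJ) (x := ⟨g, trivial⟩) h⟩

lemma apply_adjoint_formOperator (hJ : DenseRange J) (f : (formOperator J).domain) :
    J (ContinuousLinearMap.adjoint J (formOperator J f)) = f := by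
  obtain ⟨f, hf⟩ := f
  have h := hf
  rw [formOperator, LinearPMap.inverse_domain] at h
  obtain ⟨⟨g, _⟩, hg⟩ := h
  obtain ⟨_, h2⟩ := exists_formOperator_eq hJ (f := f) (g := g) hg
  rw [h2]
  exact hg

lemma inner_apply_adjoint (g h : H) :
    ⟪J (ContinuousLinearMap.adjoint J g), h⟫_ℂ = ⟪g, J (ContinuousLinearMap.adjoint J h)⟫_ℂ := by
  rw [← ContinuousLinearMap.adjoint_inner_right, ContinuousLinearMap.adjoint_inner_left]

/-- The domain is the range of the symmetric operator J J†, so its orthogonal complement is the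
kernel of J J†. -/
lemma dense_domain_formOperator (hJ : DenseRange J) :
    Dense ((formOperator J).domain : Set H) := by
  rw [Submodule.dense_iff_topologicalClosure_eq_top,
    Submodule.topologicalClosure_eq_top_iff, Submodule.eq_bot_iff]
  intro x hx
  rw [Submodule.mem_orthogonal] at hx
  refine adjoint_injective_of_denseRange hJ (ext_inner_left ℂ fun g => ?_)
  rw [← inner_apply_adjoint, inner_zero_right]
  exact hx _ (exists_formOperator_eq hJ rfl).1

/-- Write T for the operator. Testing y ∈ dom T* against the vectors J J†g, on which T takes the
value g, yields J J†(T*y) = y. Hence y lies in the range of J J†, which is dom T. -/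
lemma isSelfAdjoint_formOperator (hJ : DenseRange J) : IsSelfAdjoint (formOperator J) := by
  have hd := dense_domain_formOperator hJ
  rw [LinearPMap.isSelfAdjoint_def]
  refine le_antisymm ?_ ?_
  · refine LinearPMap.le_of_eqLocus_ge fun y hy => ?_
    have key : J (ContinuousLinearMap.adjoint J ((formOperator J).adjoint ⟨y, hy⟩)) = y := by
      refine ext_inner_right ℂ fun g => ?_
      obtain ⟨hf, hg⟩ := exists_formOperator_eq hJ (g := g) rfl
      have := LinearPMap.adjoint_isFormalAdjoint hd ⟨y, hy⟩ ⟨_, hf⟩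
      rw [hg] at this
      rw [inner_apply_adjoint]
      exact this
    obtain ⟨hf, hg⟩ := exists_formOperator_eq hJ key
    exact ⟨hy, hf, hg.symm⟩
  · refine LinearPMap.IsFormalAdjoint.le_adjoint hd fun x y => ?_
    rw [← apply_adjoint_formOperator hJ y, ← inner_apply_adjoint,
      apply_adjoint_formOperator hJ x]

/-- Taking adjoints reverses inclusions: S ≤ T gives T = T* ≤ S* = S. -/
lemma LinearPMap.eq_of_le_of_isSelfAdjoint {S T : H →ₗ.[ℂ] H} (hS : IsSelfAdjoint S)
    (hT : IsSelfAdjoint T) (h : S ≤ T) : S = T := by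
  refine le_antisymm h ⟨fun y hy => ?_, fun x y hxy => (h.2 hxy.symm).symm⟩
  rw [← LinearPMap.isSelfAdjoint_def.mp hS]
  refine LinearPMap.mem_adjoint_domain_of_exists _ ⟨T ⟨y, hy⟩, fun x => ?_⟩
  have h1 := LinearPMap.adjoint_isFormalAdjoint hT.dense_domain
  rw [LinearPMap.isSelfAdjoint_def.mp hT] at h1
  rw [h.2 (x := x) (y := ⟨x, h.1 x.2⟩) rfl]
  exact h1 ⟨y, hy⟩ ⟨x, h.1 x.2⟩

/-- A restriction of the operator associated with a form to a subspace that is dense with respect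
to the form has this operator as its Friedrichs extension. -/
theorem isFriedrichsExtension_formOperator (hJ : DenseRange J) (hinj : Function.Injective J)
    {S : H →ₗ.[ℂ] H} (hS : S ≤ formOperator J)
    (hdense : Dense {y : Y | J y ∈ S.domain}) :
    IsFriedrichsExtension S (formOperator J) := by
  -- `J† (S x)` is the preimage of `x` in `Y`; through it the form of `S` becomes the inner product
  -- of `Y`.
  have hex : ∀ x : S.domain, J (ContinuousLinearMap.adjoint J (S x)) = x := fun x => by
    rw [hS.2 (x := x) (y := ⟨x, hS.1 x.2⟩) rfl]
    exact apply_adjoint_formOperator hJ _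
  have hinner : ∀ x y : S.domain, ⟪(x : H), S y⟫_ℂ =
      ⟪ContinuousLinearMap.adjoint J (S x), ContinuousLinearMap.adjoint J (S y)⟫_ℂ := fun x y => by
    rw [ContinuousLinearMap.adjoint_inner_right, hex]
  have hre : ∀ x : S.domain, (⟪(x : H), S x⟫_ℂ).re =
      ‖ContinuousLinearMap.adjoint J (S x)‖ ^ 2 := fun x => by
    rw [hinner]
    exact inner_self_eq_norm_sq (𝕜 := ℂ) _
  -- Form convergence in `H` amounts to convergence of the preimages in the complete space `Y`.
  have hlim : ∀ (s : ℕ → S.domain) (u : H), FormConverges S s u →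
      ∃ y, J y = u ∧ Tendsto (fun n => ContinuousLinearMap.adjoint J (S (s n))) atTop (𝓝 y) := by
    intro s u hs
    have hc : CauchySeq fun n => ContinuousLinearMap.adjoint J (S (s n)) := by
      rw [Metric.cauchySeq_iff]
      intro ε hε
      obtain ⟨N, hN⟩ := hs.2 (ε ^ 2) (by positivity)
      refine ⟨N, fun m hm n hn => ?_⟩
      have := hN m hm n hn
      rw [hre, LinearPMap.map_sub, map_sub] at this
      rw [dist_eq_norm]
      exact lt_of_pow_lt_pow_left₀ 2 hε.le this
    obtain ⟨y, hy⟩ := cauchySeq_tendsto_of_complete hc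
    refine ⟨y, tendsto_nhds_unique ((J.continuous.tendsto y).comp hy) ?_, hy⟩
    refine hs.1.congr fun n => ?_
    simp [hex]
  refine ⟨?_, fun x y => ?_, fun x => ?_, isSelfAdjoint_formOperator hJ, hS, fun u => ?_, ?_⟩
  · refine (hJ.dense_image J.continuous hdense).mono ?_
    rintro _ ⟨y, hy, rfl⟩
    exact hy
  · rw [← inner_conj_symm, hinner, hinner, inner_conj_symm]
  · rw [hre]; positivity
  · obtain ⟨t, ht, htl⟩ := mem_closure_iff_seq_limit.mp
      (hdense (ContinuousLinearMap.adjoint J (formOperator J u)))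
    have hts : ∀ n, ContinuousLinearMap.adjoint J (S ⟨J (t n), ht n⟩) = t n := fun n =>
      hinj (hex _)
    refine ⟨fun n => ⟨J (t n), ht n⟩, ?_, fun ε hε => ?_⟩
    · have := (J.continuous.tendsto _).comp htl
      rwa [apply_adjoint_formOperator hJ u] at this
    · obtain ⟨N, hN⟩ := Metric.cauchySeq_iff.mp htl.cauchySeq (√ε) (Real.sqrt_pos.mpr hε)
      refine ⟨N, fun m hm n hn => ?_⟩
      have := hN m hm n hn
      rw [dist_eq_norm] at this
      rw [hre, LinearPMap.map_sub, map_sub, hts, hts]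
      exact (Real.lt_sqrt (norm_nonneg _)).mp this
  · intro u v s t hs ht
    obtain ⟨y, hy, hys⟩ := hlim s u hs
    obtain ⟨z, hz, hzt⟩ := hlim t v ht
    -- Closability enters here: as `J` is injective, the limit in `Y` is determined by the limit in
    -- `H`.
    have hyu : y = ContinuousLinearMap.adjoint J (formOperator J u) := by
      apply hinj
      rw [hy, apply_adjoint_formOperator hJ u]
    have := hzt.inner (𝕜 := ℂ) hys
    rw [hyu, ContinuousLinearMap.adjoint_inner_right, hz] at this
    exact this.congr fun n => (hinner _ _).symm

end FormOperator

/-! ### Primitives of locally integrable functions on an interval -/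

section Primitive

/-- The real and imaginary parts of the integral are absolutely continuous, and the property depends
only on the values on the interval. -/
lemma absolutelyContinuousOnInterval_integral_complex {F : ℝ → ℂ} {a b : ℝ}
    (hF : IntervalIntegrable F volume a b) :
    AbsolutelyContinuousOnInterval (fun x => ∫ t in a..x, F t) a b := by
  have hconst : ∀ c : ℂ, AbsolutelyContinuousOnInterval (fun _ : ℝ => c) a b := fun c =>
    ((LipschitzWith.const c).lipschitzOnWith (s := uIcc a b)).absolutelyContinuousOnInterval
  have hre : IntervalIntegrable (fun x => (F x).re) volume a b := ⟨hF.1.re, hF.2.re⟩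
  have him : IntervalIntegrable (fun x => (F x).im) volume a b := ⟨hF.1.im, hF.2.im⟩
  have h := ((hre.absolutelyContinuousOnInterval_intervalIntegral (c := a) (by simp)).smul
    (hconst 1)).add ((him.absolutelyContinuousOnInterval_intervalIntegral (c := a) (by simp)).smul
    (hconst Complex.I))
  have hEq : EqOn ((((fun x => ∫ t in a..x, (F t).re) • fun _ => (1 : ℂ)) +
      (fun x => ∫ t in a..x, (F t).im) • fun _ => Complex.I : ℝ → ℂ))
      (fun x => ∫ t in a..x, F t) (uIcc a b) := by
    intro x hx
    have hFx : IntervalIntegrable F volume a x :=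
      hF.mono_set (uIcc_subset_uIcc left_mem_uIcc hx)
    have h1 : IntervalIntegrable (fun x => ((F x).re : ℂ)) volume a x :=
      ⟨hFx.1.re.ofReal, hFx.2.re.ofReal⟩
    have h2 : IntervalIntegrable (fun x => ((F x).im : ℂ) * Complex.I) volume a x :=
      ⟨hFx.1.im.ofReal.mul_const _, hFx.2.im.ofReal.mul_const _⟩
    simp only [Pi.add_apply, Pi.smul_apply', Complex.real_smul, mul_one]
    rw [← intervalIntegral.integral_ofReal, ← intervalIntegral.integral_ofReal,
      ← intervalIntegral.integral_mul_const, ← intervalIntegral.integral_add h1 h2]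
    simp only [Complex.re_add_im]
  rw [absolutelyContinuousOnInterval_iff] at h ⊢
  intro ε hε
  obtain ⟨δ, hδ, H⟩ := h ε hε
  refine ⟨δ, hδ, fun E hE hlt => ?_⟩
  convert H E hE hlt using 3 with i hi
  · have := hE.1 i hi
    exact (hEq this.1).symm
  · have := hE.1 i hi
    exact (hEq this.2).symm

/-- Integration by parts for absolutely continuous functions: the product minus the integral of its
almost everywhere derivative is absolutely continuous with derivative zero almost everywhere, hence
constant. -/
lemma integral_mul_of_primitive {f g F G : ℝ → ℂ} {a b : ℝ}
    (hF : IntervalIntegrable F volume a b) (hG : IntervalIntegrable G volume a b)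
    (hf : ∀ x ∈ uIcc a b, f x - f a = ∫ t in a..x, F t)
    (hg : ∀ x ∈ uIcc a b, g x - g a = ∫ t in a..x, G t) :
    ∫ t in a..b, (F t * g t + f t * G t) = f b * g b - f a * g a := by
  have hconst : ∀ c : ℂ, AbsolutelyContinuousOnInterval (fun _ : ℝ => c) a b := fun c =>
    ((LipschitzWith.const c).lipschitzOnWith (s := uIcc a b)).absolutelyContinuousOnInterval
  -- The hypotheses control `f` and `g` only on the interval; these copies are defined on all of ℝ,
  -- so that two-sided derivatives make sense at the end points.
  set f' : ℝ → ℂ := fun x => f a + ∫ t in a..x, F t with hf'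
  set g' : ℝ → ℂ := fun x => g a + ∫ t in a..x, G t with hg'
  have hff : ∀ x ∈ uIcc a b, f x = f' x := fun x hx => by
    simp only [hf', ← hf x hx]; ring
  have hgg : ∀ x ∈ uIcc a b, g x = g' x := fun x hx => by
    simp only [hg', ← hg x hx]; ring
  have acf : AbsolutelyContinuousOnInterval f' a b :=
    (hconst (f a)).add (absolutelyContinuousOnInterval_integral_complex hF)
  have acg : AbsolutelyContinuousOnInterval g' a b :=
    (hconst (g a)).add (absolutelyContinuousOnInterval_integral_complex hG)
  have hint : IntervalIntegrable (fun t => F t * g' t + f' t * G t) volume a b :=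
    (hF.mul_continuousOn acg.continuousOn).add (hG.continuousOn_mul acf.continuousOn)
  have hac := (acf.smul acg).sub (absolutelyContinuousOnInterval_integral_complex hint)
  have hz : ∀ᵐ x, x ∈ uIcc a b →
      HasDerivAt (f' • g' - fun x => ∫ t in a..x, (F t * g' t + f' t * G t)) 0 x := by
    filter_upwards [hF.ae_hasDerivAt_integral, hG.ae_hasDerivAt_integral,
      hint.ae_hasDerivAt_integral] with x h1 h2 h3 hx
    have := (((h1 hx a left_mem_uIcc).const_add (f a)).mul
      ((h2 hx a left_mem_uIcc).const_add (g a))).sub (h3 hx a left_mem_uIcc)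
    convert! this using 1
    simp [hf', hg']
  obtain ⟨C, hC⟩ := hac.const_of_ae_hasDerivAt_zero hz
  have h1 := hC a left_mem_uIcc
  have h2 := hC b right_mem_uIcc
  rw [← h1] at h2
  simp only [Pi.sub_apply, Pi.mul_apply, smul_eq_mul, intervalIntegral.integral_same] at h2
  rw [hff b right_mem_uIcc, hgg b right_mem_uIcc, hff a left_mem_uIcc, hgg a left_mem_uIcc]
  have h3 : ∫ t in a..b, (F t * g t + f t * G t) = ∫ t in a..b, (F t * g' t + f' t * G t) := by
    refine intervalIntegral.integral_congr fun t ht => ?_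
    simp only [hff t ht, hgg t ht]
  rw [h3]
  linear_combination -h2

/-- On the interval `J`, the function `f` is a primitive of the locally integrable function `F`. -/
def IsPrimitiveOn (J : Set ℝ) (f F : ℝ → ℂ) : Prop :=
  LocallyIntegrableOn F J ∧ ∀ x ∈ J, ∀ y ∈ J, f y - f x = ∫ t in x..y, F t

lemma MeasureTheory.LocallyIntegrableOn.intervalIntegrable_of_mem {J : Set ℝ} (hJ : J.OrdConnected)
    {F : ℝ → ℂ} (hF : LocallyIntegrableOn F J) {x y : ℝ} (hx : x ∈ J) (hy : y ∈ J) :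
    IntervalIntegrable F volume x y :=
  ((hF.integrableOn_compact_subset (hJ.uIcc_subset hx hy) isCompact_uIcc)).intervalIntegrable

lemma IsPrimitiveOn.congr_ae {J : Set ℝ} (hJ : J.OrdConnected) (hJm : MeasurableSet J)
    {f F F' : ℝ → ℂ} (h : IsPrimitiveOn J f F) (hF : F =ᵐ[volume.restrict J] F') :
    IsPrimitiveOn J f F' := by
  have hm := (ae_restrict_iff' hJm).mp hF
  refine ⟨fun x hx => ?_, fun x hx y hy => ?_⟩
  · obtain ⟨s, hs, hsi⟩ := h.1 x hx
    refine ⟨s ∩ J, inter_mem hs self_mem_nhdsWithin, ?_⟩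
    refine (hsi.mono_set inter_subset_left).congr ?_
    exact ae_restrict_of_ae_restrict_of_subset inter_subset_right hF
  · rw [h.2 x hx y hy]
    refine intervalIntegral.integral_congr_ae ?_
    filter_upwards [hm] with t ht htx
    exact ht (hJ.uIcc_subset hx hy (uIoc_subset_uIcc htx))

lemma IsPrimitiveOn.congr {J : Set ℝ} {f g F : ℝ → ℂ} (h : IsPrimitiveOn J f F)
    (hfg : EqOn f g J) : IsPrimitiveOn J g F :=
  ⟨h.1, fun x hx y hy => by rw [← hfg hx, ← hfg hy, h.2 x hx y hy]⟩

lemma IsPrimitiveOn.mono {J K : Set ℝ} {f F : ℝ → ℂ} (h : IsPrimitiveOn J f F) (hK : K ⊆ J) :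
    IsPrimitiveOn K f F :=
  ⟨h.1.mono_set hK, fun x hx y hy => h.2 x (hK hx) y (hK hy)⟩

/-- Near a point of J, the function F can be cut off to a relative neighbourhood on which it is
integrable; the primitive of an integrable function is continuous. -/
lemma IsPrimitiveOn.continuousOn {J : Set ℝ} (hJ : J.OrdConnected) {f F : ℝ → ℂ}
    (h : IsPrimitiveOn J f F) : ContinuousOn f J := by
  intro x hx
  obtain ⟨s, hs, hsi⟩ := h.1 x hx
  obtain ⟨ε, hε, hεs⟩ := Metric.mem_nhdsWithin_iff.mp hs
  have hord : (Metric.ball x ε ∩ J).OrdConnected := by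
    rw [Real.ball_eq_Ioo]
    exact ordConnected_Ioo.inter hJ
  set t := Metric.ball x ε ∩ J with ht
  have htm : MeasurableSet t := hord.measurableSet
  have hti : Integrable (t.indicator F) := (integrable_indicator_iff htm).mpr (hsi.mono_set hεs)
  have hc : Continuous fun y => f x + ∫ r in x..y, t.indicator F r :=
    continuous_const.add (intervalIntegral.continuous_primitive
      (fun a b => hti.intervalIntegrable) x)
  have hxt : x ∈ t := ⟨Metric.mem_ball_self hε, hx⟩
  have key : ∀ y ∈ t, f y = f x + ∫ r in x..y, t.indicator F r := fun y hy => by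
    have : ∫ r in x..y, t.indicator F r = ∫ r in x..y, F r := by
      refine intervalIntegral.integral_congr fun r hr => ?_
      exact indicator_of_mem (hord.uIcc_subset hxt hy hr) F
    rw [this, ← h.2 x hx y hy.2]
    ring
  refine ContinuousWithinAt.congr_of_eventuallyEq hc.continuousWithinAt ?_ (key x hxt)
  filter_upwards [inter_mem_nhdsWithin J (Metric.ball_mem_nhds x hε)] with y hy
  exact key y ⟨hy.2, hy.1⟩

lemma IsPrimitiveOn.mul {J : Set ℝ} (hJ : J.OrdConnected) (hJc : IsLocallyClosed J)
    {f g F G : ℝ → ℂ} (hf : IsPrimitiveOn J f F) (hg : IsPrimitiveOn J g G) :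
    IsPrimitiveOn J (fun x => f x * g x) (fun x => F x * g x + f x * G x) := by
  refine ⟨?_, fun x hx y hy => ?_⟩
  · exact (hf.1.mul_continuousOn (hg.continuousOn hJ) hJc).add
      (hg.1.continuousOn_mul (hf.continuousOn hJ) hJc)
  · refine (integral_mul_of_primitive (hf.1.intervalIntegrable_of_mem hJ hx hy)
      (hg.1.intervalIntegrable_of_mem hJ hx hy) (fun z hz => ?_) (fun z hz => ?_)).symm
    · exact hf.2 x hx z (hJ.uIcc_subset hx hy hz)
    · exact hg.2 x hx z (hJ.uIcc_subset hx hy hz)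

lemma IsPrimitiveOn.add {J : Set ℝ} (hJ : J.OrdConnected)
    {f g F G : ℝ → ℂ} (hf : IsPrimitiveOn J f F) (hg : IsPrimitiveOn J g G) :
    IsPrimitiveOn J (fun x => f x + g x) (fun x => F x + G x) := by
  refine ⟨hf.1.add hg.1, fun x hx y hy => ?_⟩
  rw [intervalIntegral.integral_add (hf.1.intervalIntegrable_of_mem hJ hx hy)
    (hg.1.intervalIntegrable_of_mem hJ hx hy), ← hf.2 x hx y hy, ← hg.2 x hx y hy]
  ring

lemma IsPrimitiveOn.const_mul {J : Set ℝ} {f F : ℝ → ℂ} (hf : IsPrimitiveOn J f F) (c : ℂ) :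
    IsPrimitiveOn J (fun x => c * f x) (fun x => c * F x) := by
  refine ⟨fun x hx => ?_, fun x hx y hy => ?_⟩
  · obtain ⟨s, hs, hsi⟩ := hf.1 x hx
    exact ⟨s, hs, hsi.const_mul c⟩
  · rw [intervalIntegral.integral_const_mul, ← hf.2 x hx y hy]
    ring

lemma IsPrimitiveOn.conj {J : Set ℝ} {f F : ℝ → ℂ} (hf : IsPrimitiveOn J f F) :
    IsPrimitiveOn J (fun x => conj (f x)) (fun x => conj (F x)) := by
  refine ⟨fun x hx => ?_, fun x hx y hy => ?_⟩
  · obtain ⟨s, hs, hsi⟩ := hf.1 x hx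
    exact ⟨s, hs, (LinearIsometryEquiv.integrable_comp_iff Complex.conjLIE).mpr hsi⟩
  · rw [← map_sub, hf.2 x hx y hy, intervalIntegral, intervalIntegral, map_sub, integral_conj,
      integral_conj]

lemma isPrimitiveOn_of_hasDerivAt {J : Set ℝ} (hJ : J.OrdConnected) {f F : ℝ → ℂ}
    (hf : ContinuousOn f J) (hF : ContinuousOn F J)
    (h : ∀ x ∈ interior J, HasDerivAt f (F x) x) : IsPrimitiveOn J f F := by
  have key : ∀ x ∈ J, ∀ y ∈ J, x ≤ y → f y - f x = ∫ t in x..y, F t := fun x hx y hy hxy => by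
    have hsub := hJ.out hx hy
    refine (intervalIntegral.integral_eq_sub_of_hasDerivAt_of_le hxy (hf.mono hsub)
      (fun t ht => h t ?_) ?_).symm
    · exact interior_mono hsub (by rwa [interior_Icc])
    · exact ((hF.mono hsub).intervalIntegrable_of_Icc hxy)
  refine ⟨hF.locallyIntegrableOn hJ.measurableSet, fun x hx y hy => ?_⟩
  rcases le_total x y with hxy | hxy
  · exact key x hx y hy hxy
  · rw [intervalIntegral.integral_symm, ← key y hy x hx hxy]
    ring

lemma isPrimitiveOn_integral {J : Set ℝ} (hJ : J.OrdConnected) {F : ℝ → ℂ}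
    (hF : LocallyIntegrableOn F J) {a : ℝ} (ha : a ∈ J) :
    IsPrimitiveOn J (fun x => ∫ t in a..x, F t) F := by
  refine ⟨hF, fun x hx y hy => ?_⟩
  rw [intervalIntegral.integral_interval_sub_left (hF.intervalIntegrable_of_mem hJ ha hy)
    (hF.intervalIntegrable_of_mem hJ ha hx)]

/-- Lipschitz functions are absolutely continuous. This makes the product rule available for cutoff
functions of the distance, which need not be differentiable everywhere. -/
lemma isPrimitiveOn_of_lipschitzWith {K : NNReal} {η : ℝ → ℝ} (h : LipschitzWith K η) :
    IsPrimitiveOn univ (fun x => (η x : ℂ)) (fun x => ((deriv η x : ℝ) : ℂ)) := by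
  have hac : ∀ a b, AbsolutelyContinuousOnInterval η a b := fun a b =>
    (h.lipschitzOnWith (s := uIcc a b)).absolutelyContinuousOnInterval
  refine ⟨?_, fun x _ y _ => ?_⟩
  · refine LocallyIntegrable.locallyIntegrableOn ?_ _
    refine LocallyIntegrable.mono (locallyIntegrable_const (μ := volume) (K : ℝ)) ?_ ?_
    · exact (Complex.measurable_ofReal.comp (measurable_deriv η)).aestronglyMeasurable
    · refine Eventually.of_forall fun x => ?_
      rw [Complex.norm_real]
      simpa using norm_deriv_le_of_lipschitz h
  · rw [intervalIntegral.integral_ofReal, (hac x y).integral_deriv_eq_sub]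
    push_cast; rfl

end Primitive

/-! ### Weak derivatives on an open interval -/

section WeakDeriv

open MetricGraph (HasWeakDeriv)

lemma exists_Ioo_superset_of_isCompact {J K : Set ℝ} (hJo : IsOpen J)
    (hJne : J.Nonempty) (hK : IsCompact K) (hKJ : K ⊆ J) :
    ∃ a ∈ J, ∃ b ∈ J, a < b ∧ K ⊆ Ioo a b := by
  obtain ⟨x₀, hx₀⟩ := hJne
  -- Adjoining a point makes the set non-empty, so that its infimum and supremum belong to it.
  have hK' : IsCompact (insert x₀ K) := hK.insert x₀
  have hne : (insert x₀ K).Nonempty := insert_nonempty _ _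
  have hsub : insert x₀ K ⊆ J := insert_subset hx₀ hKJ
  have hmin := hsub (hK'.sInf_mem hne)
  have hmax := hsub (hK'.sSup_mem hne)
  obtain ⟨ε, hε, h1⟩ := Metric.isOpen_iff.mp hJo _ hmin
  obtain ⟨δ, hδ, h2⟩ := Metric.isOpen_iff.mp hJo _ hmax
  have hle : ∀ x ∈ insert x₀ K, sInf (insert x₀ K) ≤ x ∧ x ≤ sSup (insert x₀ K) := fun x hx =>
    ⟨csInf_le hK'.bddBelow hx, le_csSup hK'.bddAbove hx⟩
  refine ⟨sInf (insert x₀ K) - ε / 2, h1 ?_, sSup (insert x₀ K) + δ / 2, h2 ?_, ?_, fun x hx => ?_⟩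
  · rw [Metric.mem_ball, Real.dist_eq, sub_sub_cancel_left, abs_neg, abs_of_pos (by positivity)]
    linarith
  · rw [Metric.mem_ball, Real.dist_eq, add_sub_cancel_left, abs_of_pos (by positivity)]
    linarith
  · have := hle x₀ (mem_insert _ _)
    linarith [this.1, this.2]
  · have := hle x (mem_insert_of_mem _ hx)
    constructor <;> linarith [this.1, this.2]

lemma setIntegral_eq_intervalIntegral_of_support {J : Set ℝ} (hJ : J.OrdConnected) {a b : ℝ}
    (ha : a ∈ J) (hb : b ∈ J) (hab : a ≤ b) {f : ℝ → ℂ} (hf : ∀ x, x ∉ Ioo a b → f x = 0) :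
    ∫ x in J, f x = ∫ x in a..b, f x := by
  rw [intervalIntegral.integral_of_le hab]
  refine setIntegral_eq_of_subset_of_forall_sdiff_eq_zero hJ.measurableSet
    (Ioc_subset_Icc_self.trans (hJ.out ha hb)) fun x hx => hf x fun h => ?_
  exact hx.2 (Ioo_subset_Ioc_self h)

lemma deriv_eq_zero_of_notMem_tsupport {φ : ℝ → ℝ} {x : ℝ} (hx : x ∉ tsupport φ) :
    deriv φ x = 0 :=
  Function.notMem_support.mp fun h => hx (support_deriv_subset h)

/-- The product rule is integrated over an interval whose end points lie outside the support of the
test function, so there are no boundary terms. -/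
lemma IsPrimitiveOn.hasWeakDeriv {J : Set ℝ} (hJ : J.OrdConnected) (hJo : IsOpen J)
    {u w : ℝ → ℂ} (h : IsPrimitiveOn J u w) : HasWeakDeriv J u w := by
  refine ⟨(h.continuousOn hJ).locallyIntegrableOn hJo.measurableSet, h.1, fun φ hφ hc hs => ?_⟩
  rcases J.eq_empty_or_nonempty with rfl | hne
  · simp
  obtain ⟨a, ha, b, hb, hab, hsub⟩ := exists_Ioo_superset_of_isCompact hJo hne hc hs
  have hφ0 : ∀ x, x ∉ Ioo a b → φ x = 0 := fun x hx => image_eq_zero_of_notMem_tsupport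
    fun h => hx (hsub h)
  have hφ1 : ∀ x, x ∉ Ioo a b → deriv φ x = 0 := fun x hx => deriv_eq_zero_of_notMem_tsupport
    fun h => hx (hsub h)
  rw [setIntegral_eq_intervalIntegral_of_support hJ ha hb hab.le
      (fun x hx => by rw [hφ1 x hx, zero_smul]),
    setIntegral_eq_intervalIntegral_of_support hJ ha hb hab.le
      (fun x hx => by rw [hφ0 x hx, zero_smul])]
  have hd : ∀ x, HasDerivAt (fun x => (φ x : ℂ)) ((deriv φ x : ℝ) : ℂ) x := fun x =>
    ((hφ.differentiable (by simp)) x).hasDerivAt.ofReal_comp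
  have hcd : Continuous (deriv φ) := hφ.continuous_deriv (by simp)
  have hp : IsPrimitiveOn J (fun x => (φ x : ℂ)) (fun x => ((deriv φ x : ℝ) : ℂ)) :=
    isPrimitiveOn_of_hasDerivAt hJ (Complex.continuous_ofReal.comp hφ.continuous).continuousOn
      (Complex.continuous_ofReal.comp hcd).continuousOn fun x _ => hd x
  have hm := (hp.mul hJ hJo.isLocallyClosed h).2 a ha b hb
  have i1 : IntervalIntegrable (fun x => ((deriv φ x : ℝ) : ℂ) * u x) volume a b :=
    (hp.1.mul_continuousOn (h.continuousOn hJ) hJo.isLocallyClosed).intervalIntegrable_of_mem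
      hJ ha hb
  have i2 : IntervalIntegrable (fun x => (φ x : ℂ) * w x) volume a b :=
    (h.1.continuousOn_mul (hp.continuousOn hJ) hJo.isLocallyClosed).intervalIntegrable_of_mem
      hJ ha hb
  rw [intervalIntegral.integral_add i1 i2] at hm
  simp only [hφ0 a (by simp), hφ0 b (by simp), Complex.ofReal_zero, zero_mul] at hm
  simp only [Complex.real_smul]
  linear_combination -hm

lemma MetricGraph.HasWeakDeriv.congr_left {J : Set ℝ} {u u' w : ℝ → ℂ} (h : HasWeakDeriv J u w)
    (hu : u =ᵐ[volume.restrict J] u') : HasWeakDeriv J u' w := by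
  refine ⟨fun x hx => ?_, h.2.1, fun φ hφ hc hs => ?_⟩
  · obtain ⟨s, hs, hsi⟩ := h.1 x hx
    refine ⟨s ∩ J, inter_mem hs self_mem_nhdsWithin, ?_⟩
    exact (hsi.mono_set inter_subset_left).congr
      (ae_restrict_of_ae_restrict_of_subset inter_subset_right hu)
  · rw [← h.2.2 φ hφ hc hs]
    refine integral_congr_ae ?_
    filter_upwards [hu] with x hx
    rw [hx]

lemma MetricGraph.HasWeakDeriv.unique {J : Set ℝ} (hJo : IsOpen J) {u w w' : ℝ → ℂ}
    (h : HasWeakDeriv J u w) (h' : HasWeakDeriv J u w') : w =ᵐ[volume.restrict J] w' := by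
  have := hJo.ae_eq_zero_of_integral_contDiff_smul_eq_zero (μ := volume)
    (h.2.1.sub h'.2.1) fun g hg hc hs => ?_
  · refine (ae_restrict_iff' hJo.measurableSet).mpr ?_
    filter_upwards [this] with x hx hxJ
    exact sub_eq_zero.mp (hx hxJ)
  · have hz : ∀ x, x ∉ J → g x = 0 := fun x hx => image_eq_zero_of_notMem_tsupport
      fun h => hx (hs h)
    rw [← setIntegral_eq_integral_of_forall_compl_eq_zero (s := J)
      (fun x hx => by rw [hz x hx, zero_smul])]
    have hi : ∀ {v : ℝ → ℂ}, LocallyIntegrableOn v J →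
        Integrable (fun x => g x • v x) (volume.restrict J) := fun {v} hv => by
      have h1 : IntegrableOn (fun x => g x • v x) (tsupport g) := by
        exact ((hv.integrableOn_compact_subset hs hc).continuousOn_smul
          hg.continuous.continuousOn hc)
      exact (h1.integrable_of_forall_notMem_eq_zero fun x hx => by
        rw [image_eq_zero_of_notMem_tsupport hx, zero_smul]).integrableOn
    simp only [Pi.sub_apply, smul_sub]
    rw [integral_sub (hi h.2.1) (hi h'.2.1), ← neg_eq_iff_eq_neg.mpr (h.2.2 g hg hc hs),
      ← neg_eq_iff_eq_neg.mpr (h'.2.2 g hg hc hs), sub_self]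

lemma MetricGraph.weakDeriv_ae_eq {J : Set ℝ} (hJo : IsOpen J) {u w : ℝ → ℂ}
    (h : HasWeakDeriv J u w) : MetricGraph.weakDeriv J u =ᵐ[volume.restrict J] w := by
  have hex : ∃ w, HasWeakDeriv J u w := ⟨w, h⟩
  rw [MetricGraph.weakDeriv, dif_pos hex]
  exact hex.choose_spec.unique hJo h

/-- An antiderivative with compact support of a test function with vanishing integral. -/
lemma exists_testFunction_deriv_eq {J : Set ℝ} (hJ : J.OrdConnected) (hJo : IsOpen J)
    {ψ : ℝ → ℝ} (hψ : ContDiff ℝ ∞ ψ) (hc : HasCompactSupport ψ) (hs : tsupport ψ ⊆ J)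
    (h0 : ∫ x, ψ x = 0) :
    ∃ φ : ℝ → ℝ, ContDiff ℝ ∞ φ ∧ HasCompactSupport φ ∧ tsupport φ ⊆ J ∧ deriv φ = ψ := by
  rcases J.eq_empty_or_nonempty with rfl | hne
  · have : ψ = 0 := by
      rw [subset_empty_iff, tsupport_eq_empty_iff] at hs
      exact hs
    exact ⟨0, contDiff_const, HasCompactSupport.zero, by simp, by rw [this]; simp⟩
  obtain ⟨a, ha, b, hb, hab, hsub⟩ := exists_Ioo_superset_of_isCompact hJo hne hc hs
  have hz : ∀ x, x ∉ Ioo a b → ψ x = 0 := fun x hx => image_eq_zero_of_notMem_tsupport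
    fun h => hx (hsub h)
  have hd : ∀ x, HasDerivAt (fun x => ∫ t in a..x, ψ t) (ψ x) x := fun x =>
    intervalIntegral.integral_hasDerivAt_right (hψ.continuous.intervalIntegrable _ _)
      (hψ.continuous.stronglyMeasurableAtFilter _ _) hψ.continuous.continuousAt
  have hderiv : deriv (fun x => ∫ t in a..x, ψ t) = ψ := funext fun x => (hd x).deriv
  -- To the right of `b` the integral is the total integral of `ψ`; this is where `h0` is needed.
  have hzero : ∀ x, x ∉ Icc a b → ∫ t in a..x, ψ t = 0 := by
    intro x hx
    rcases lt_or_ge x a with h | h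
    · rw [intervalIntegral.integral_symm, intervalIntegral.integral_of_le h.le,
        setIntegral_eq_zero_of_forall_eq_zero, neg_zero]
      exact fun t ht => hz t fun ht' => absurd ht.2 (not_le.mpr ht'.1)
    · have hbx : b < x := not_le.mp fun h' => hx ⟨h, h'⟩
      rw [intervalIntegral.integral_of_le h,
        setIntegral_eq_integral_of_forall_compl_eq_zero, h0]
      exact fun t ht => hz t fun ht' => ht ⟨ht'.1, ht'.2.le.trans hbx.le⟩
  have hts : tsupport (fun x => ∫ t in a..x, ψ t) ⊆ Icc a b :=
    closure_minimal (fun x hx => by_contra fun h => hx (hzero x h)) isClosed_Icc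
  refine ⟨_, contDiff_infty_iff_deriv.mpr ⟨fun x => (hd x).differentiableAt, by rwa [hderiv]⟩,
    HasCompactSupport.intro isCompact_Icc hzero, hts.trans (hJ.out ha hb), hderiv⟩

lemma exists_testFunction_integral_eq_one {J : Set ℝ} (hJo : IsOpen J) (hne : J.Nonempty) :
    ∃ χ : ℝ → ℝ, ContDiff ℝ ∞ χ ∧ HasCompactSupport χ ∧ tsupport χ ⊆ J ∧ ∫ x, χ x = 1 := by
  obtain ⟨x₀, hx₀⟩ := hne
  obtain ⟨ε, hε, h1⟩ := Metric.isOpen_iff.mp hJo _ hx₀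
  let f : ContDiffBump x₀ := ⟨ε / 4, ε / 2, by positivity, by linarith⟩
  refine ⟨f.normed volume, f.contDiff_normed, f.hasCompactSupport_normed, ?_, f.integral_normed⟩
  rw [f.tsupport_normed_eq]
  exact (Metric.closedBall_subset_ball (by show ε / 2 < ε; linarith)).trans h1

/-- The du Bois-Reymond lemma. For a test function g, the difference g - (∫ g) χ has integral zero,
so it is the derivative of a test function. Hence ∫ g z = c ∫ g for all g, where c = ∫ χ z, and z =
c. -/
lemma eq_of_integral_deriv_smul_eq_zero {J : Set ℝ} (hJ : J.OrdConnected) (hJo : IsOpen J)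
    {z : ℝ → ℂ} (hz : ContinuousOn z J)
    (h : ∀ φ : ℝ → ℝ, ContDiff ℝ ∞ φ → HasCompactSupport φ → tsupport φ ⊆ J →
      ∫ x in J, deriv φ x • z x = 0) {x y : ℝ} (hx : x ∈ J) (hy : y ∈ J) : z x = z y := by
  obtain ⟨χ, hχ, hχc, hχs, hχ1⟩ := exists_testFunction_integral_eq_one hJo ⟨x, hx⟩
  set c : ℂ := ∫ x in J, χ x • z x with hcdef
  have hi : ∀ g : ℝ → ℝ, ContDiff ℝ ∞ g → HasCompactSupport g → tsupport g ⊆ J →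
      ∀ v : ℝ → ℂ, ContinuousOn v J →
        Integrable (fun x => g x • v x) (volume.restrict J) := fun g hg hc hs v hv => by
    have h1 : IntegrableOn (fun x => g x • v x) (tsupport g) :=
      ((hg.continuous.continuousOn).smul (hv.mono hs)).integrableOn_compact hc
    exact (h1.integrable_of_forall_notMem_eq_zero fun x hx => by
      rw [image_eq_zero_of_notMem_tsupport hx, zero_smul]).integrableOn
  have hae := hJo.ae_eq_zero_of_integral_contDiff_smul_eq_zero (μ := volume)
    (f := fun x => z x - c)
    ((hz.sub continuousOn_const).locallyIntegrableOn hJo.measurableSet) fun g hg hc hs => ?_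
  · have h2 : EqOn z (fun _ => c) J := by
      refine Measure.eqOn_open_of_ae_eq (μ := volume) ?_ hJo hz continuousOn_const
      refine (ae_restrict_iff' hJo.measurableSet).mpr ?_
      filter_upwards [hae] with x hx hxJ
      exact sub_eq_zero.mp (hx hxJ)
    rw [h2 hx, h2 hy]
  · set m := ∫ x, g x with hm
    have hψ : ContDiff ℝ ∞ fun x => g x - m * χ x := hg.sub (contDiff_const.mul hχ)
    have hψs : tsupport (fun x => g x - m * χ x) ⊆ tsupport g ∪ tsupport χ := by
      refine closure_minimal (fun x hx => ?_) ((isClosed_tsupport _).union (isClosed_tsupport _))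
      by_contra hcon
      rw [mem_union, not_or] at hcon
      apply hx
      simp [image_eq_zero_of_notMem_tsupport hcon.1, image_eq_zero_of_notMem_tsupport hcon.2]
    have hψc : HasCompactSupport fun x => g x - m * χ x :=
      (hc.isCompact.union hχc.isCompact).of_isClosed_subset (isClosed_tsupport _) hψs
    have hψ0 : ∫ x, (g x - m * χ x) = 0 := by
      rw [integral_sub (hg.continuous.integrable_of_hasCompactSupport hc)
        ((hχ.continuous.integrable_of_hasCompactSupport hχc).const_mul m),
        integral_const_mul, hχ1, mul_one, sub_self]
    obtain ⟨φ, hφ, hφc, hφs, hφd⟩ := exists_testFunction_deriv_eq hJ hJo hψ hψc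
      (hψs.trans (union_subset hs hχs)) hψ0
    have h3 := h φ hφ hφc hφs
    have hsplit : ∀ x, (g x - m * χ x) • z x = g x • z x - (m : ℂ) * (χ x • z x) := fun x => by
      simp only [Complex.real_smul]
      push_cast
      ring
    simp only [hφd, hsplit] at h3
    rw [integral_sub (hi g hg hc hs z hz) ((hi χ hχ hχc hχs z hz).const_mul _),
      integral_const_mul, ← hcdef] at h3
    have hzero : ∀ x, x ∉ J → g x = 0 := fun x hx => image_eq_zero_of_notMem_tsupport
      fun h => hx (hs h)
    rw [← setIntegral_eq_integral_of_forall_compl_eq_zero (s := J)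
      (fun x hx => by rw [hzero x hx, zero_smul])]
    simp only [smul_sub]
    rw [integral_sub (hi g hg hc hs z hz) (hi g hg hc hs _ continuousOn_const),
      integral_smul_const, setIntegral_eq_integral_of_forall_compl_eq_zero hzero, ← hm,
      Complex.real_smul]
    exact h3

/-- Both u and the indefinite integral of w have the weak derivative w, so their difference is
constant by the du Bois-Reymond lemma. Continuity of u turns the almost everywhere identity into a
pointwise one. -/
lemma MetricGraph.HasWeakDeriv.isPrimitiveOn {J : Set ℝ} (hJ : J.OrdConnected) (hJo : IsOpen J)
    {u w : ℝ → ℂ} (hu : ContinuousOn u J) (h : HasWeakDeriv J u w) : IsPrimitiveOn J u w := by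
  refine ⟨h.2.1, fun x hx y hy => ?_⟩
  have hv := isPrimitiveOn_integral hJ h.2.1 hx
  have hvw := hv.hasWeakDeriv hJ hJo
  have hvc := hv.continuousOn hJ
  have := eq_of_integral_deriv_smul_eq_zero hJ hJo (hu.sub hvc) (fun φ hφ hc hs => ?_) hx hy
  · simp only [Pi.sub_apply, intervalIntegral.integral_same] at this
    linear_combination -this
  · have hi : ∀ v : ℝ → ℂ, ContinuousOn v J →
        Integrable (fun x => deriv φ x • v x) (volume.restrict J) := fun v hv => by
      have h1 : IntegrableOn (fun x => deriv φ x • v x) (tsupport φ) :=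
        (((hφ.continuous_deriv (by simp)).continuousOn).smul (hv.mono hs)).integrableOn_compact hc
      exact (h1.integrable_of_forall_notMem_eq_zero fun x hx => by
        rw [deriv_eq_zero_of_notMem_tsupport hx, zero_smul]).integrableOn
    simp only [Pi.sub_apply, smul_sub]
    rw [integral_sub (hi u hu) (hi _ hvc), h.2.2 φ hφ hc hs, hvw.2.2 φ hφ hc hs, sub_self]

end WeakDeriv

/-! ### Approximation by test functions -/

section TestFunctions

lemma norm_toLp_two_sq {α : Type*} [MeasurableSpace α] {μ : Measure α} {f : α → ℂ}
    (hf : MemLp f 2 μ) : ‖hf.toLp f‖ ^ 2 = ∫ x, ‖f x‖ ^ 2 ∂μ := by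
  have h := inner_self_eq_norm_sq (𝕜 := ℂ) (hf.toLp f)
  rw [← h, L2.inner_def, ← integral_re (L2.integrable_inner _ _)]
  refine integral_congr_ae ?_
  filter_upwards [hf.coeFn_toLp] with x hx
  rw [hx]
  exact inner_self_eq_norm_sq (𝕜 := ℂ) _

lemma ContDiff.ofReal_comp {φ : ℝ → ℝ} {n : WithTop ℕ∞} (h : ContDiff ℝ n φ) :
    ContDiff ℝ n fun x => (φ x : ℂ) :=
  Complex.ofRealCLM.contDiff.comp h

lemma tsupport_ofReal (φ : ℝ → ℝ) : tsupport (fun x => (φ x : ℂ)) = tsupport φ := by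
  rw [tsupport, tsupport]
  congr 1
  ext x
  simp

/-- The smooth functions with compact support in `U`, as a subspace of `L²(U)`. -/
def testSubmodule (U : Set ℝ) : Submodule ℂ (Lp ℂ 2 (volume.restrict U)) where
  carrier := {f | ∃ g : ℝ → ℂ, ContDiff ℝ ∞ g ∧ HasCompactSupport g ∧ tsupport g ⊆ U ∧
    f =ᵐ[volume.restrict U] g}
  add_mem' := by
    rintro f₁ f₂ ⟨g₁, h₁, hc₁, hs₁, he₁⟩ ⟨g₂, h₂, hc₂, hs₂, he₂⟩
    refine ⟨g₁ + g₂, h₁.add h₂, hc₁.add hc₂, (tsupport_add _ _).trans (union_subset hs₁ hs₂), ?_⟩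
    filter_upwards [Lp.coeFn_add f₁ f₂, he₁, he₂] with x hx h1 h2
    rw [hx, Pi.add_apply, Pi.add_apply, h1, h2]
  zero_mem' := ⟨0, contDiff_const, HasCompactSupport.zero, by simp, Lp.coeFn_zero _ _ _⟩
  smul_mem' := by
    rintro c f ⟨g, h, hc, hs, he⟩
    refine ⟨fun x => c * g x, contDiff_const.mul h, hc.mul_left,
      (closure_mono (Function.support_mul_subset_right _ _)).trans hs, ?_⟩
    filter_upwards [Lp.coeFn_smul c f, he] with x hx h1
    simp [hx, h1]

lemma toLp_mem_testSubmodule {U : Set ℝ} {g : ℝ → ℂ} (h : ContDiff ℝ ∞ g)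
    (hc : HasCompactSupport g) (hs : tsupport g ⊆ U) (hm : MemLp g 2 (volume.restrict U)) :
    hm.toLp g ∈ testSubmodule U :=
  ⟨g, h, hc, hs, hm.coeFn_toLp⟩

lemma ae_eq_zero_of_forall_integral_mul_eq_zero {U : Set ℝ} (hU : IsOpen U) {f : ℝ → ℂ}
    (hf : MemLp f 2 (volume.restrict U))
    (h : ∀ φ : ℝ → ℝ, ContDiff ℝ ∞ φ → HasCompactSupport φ → tsupport φ ⊆ U →
      ∫ x in U, φ x * f x = 0) : f =ᵐ[volume.restrict U] 0 := by
  have hloc : LocallyIntegrableOn f U := locallyIntegrableOn_of_locallyIntegrable_restrict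
    (hf.locallyIntegrable (by norm_num))
  have := hU.ae_eq_zero_of_integral_contDiff_smul_eq_zero (μ := volume) hloc fun φ h1 h2 h3 => ?_
  · exact (ae_restrict_iff' hU.measurableSet).mpr this
  · rw [← setIntegral_eq_integral_of_forall_compl_eq_zero (s := U), ← h φ h1 h2 h3]
    · simp
    · exact fun x hx => by
        rw [image_eq_zero_of_notMem_tsupport fun hx' => hx (h3 hx'), zero_smul]

lemma dense_testSubmodule {U : Set ℝ} (hU : IsOpen U) :
    Dense (testSubmodule U : Set (Lp ℂ 2 (volume.restrict U))) := by
  rw [Submodule.dense_iff_topologicalClosure_eq_top,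
    Submodule.topologicalClosure_eq_top_iff, Submodule.eq_bot_iff]
  intro f hf
  rw [Submodule.mem_orthogonal] at hf
  refine Lp.eq_zero_iff_ae_eq_zero.mpr ?_
  refine ae_eq_zero_of_forall_integral_mul_eq_zero hU (Lp.memLp f) fun φ h1 h2 h3 => ?_
  have hm : MemLp (fun x => (φ x : ℂ)) 2 (volume.restrict U) :=
    (h1.ofReal_comp.continuous.memLp_of_hasCompactSupport
      (h2.comp_left Complex.ofReal_zero)).restrict U
  have := hf _ (toLp_mem_testSubmodule h1.ofReal_comp (h2.comp_left Complex.ofReal_zero)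
    ((tsupport_ofReal φ).trans_subset h3) hm)
  rw [L2.inner_def] at this
  rw [← this]
  refine integral_congr_ae ?_
  filter_upwards [hm.coeFn_toLp] with x hx
  rw [hx]
  simp [mul_comm]

/-- The map d ↦ d + (l x - l d) χ is continuous, preserves D, fixes x and takes values in the level
set of x. It sends points of D that are close enough to x to points with the required properties. -/
lemma Dense.exists_mem_eq_dist_lt {E : Type*} [NormedAddCommGroup E] [NormedSpace ℂ E]
    {D : Submodule ℂ E} (hD : Dense (D : Set E)) (l : E →L[ℂ] ℂ) {χ : E} (hχ : χ ∈ D)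
    (hl : l χ = 1) (x : E) {ε : ℝ} (hε : 0 < ε) : ∃ d ∈ D, l d = l x ∧ ‖x - d‖ < ε := by
  have hc : Continuous fun d => d + (l x - l d) • χ := by fun_prop
  obtain ⟨d, hdD, hd⟩ := hD.exists_mem_open ((Metric.isOpen_ball (x := x) (ε := ε)).preimage hc)
    ⟨x, by simpa using hε⟩
  refine ⟨d + (l x - l d) • χ, D.add_mem hdD (D.smul_mem _ hχ), by simp [hl], ?_⟩
  rw [← dist_eq_norm, dist_comm]
  exact hd

/-- Approximation in `L²` by test functions with the same integral. -/
lemma exists_testFunction_integral_eq {a b : ℝ} (hab : a < b) {F : ℝ → ℂ}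
    (hF : MemLp F 2 (volume.restrict (Ioo a b))) {ε : ℝ} (hε : 0 < ε) :
    ∃ g : ℝ → ℂ, ContDiff ℝ ∞ g ∧ HasCompactSupport g ∧ tsupport g ⊆ Ioo a b ∧
      ∫ x in Ioo a b, g x = ∫ x in Ioo a b, F x ∧
      ∫ x in Ioo a b, ‖F x - g x‖ ^ 2 < ε := by
  obtain ⟨χ, h1, h2, h3, h4⟩ := exists_testFunction_integral_eq_one isOpen_Ioo
    (nonempty_Ioo.mpr hab)
  have hm : MemLp (fun x => (χ x : ℂ)) 2 (volume.restrict (Ioo a b)) :=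
    (h1.ofReal_comp.continuous.memLp_of_hasCompactSupport
      (h2.comp_left Complex.ofReal_zero)).restrict _
  have h1m : MemLp (fun _ => (1 : ℂ)) 2 (volume.restrict (Ioo a b)) := memLp_const 1
  -- Integration is a bounded functional on L² of a bounded interval: the inner product with the
  -- constant 1.
  set l : Lp ℂ 2 (volume.restrict (Ioo a b)) →L[ℂ] ℂ := innerSL ℂ (h1m.toLp _) with hldef
  have hl : ∀ f : Lp ℂ 2 (volume.restrict (Ioo a b)), l f = ∫ x in Ioo a b, f x := fun f => by
    rw [hldef, innerSL_apply_apply, L2.inner_def]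
    refine integral_congr_ae ?_
    filter_upwards [h1m.coeFn_toLp] with x hx
    rw [hx]
    simp
  have hχ1 : l (hm.toLp _) = 1 := by
    rw [hl, integral_congr_ae hm.coeFn_toLp, setIntegral_eq_integral_of_forall_compl_eq_zero,
      integral_complex_ofReal, h4, Complex.ofReal_one]
    intro x hx
    rw [image_eq_zero_of_notMem_tsupport fun hx' => hx (h3 hx'), Complex.ofReal_zero]
  obtain ⟨d, ⟨g, hg, hgc, hgs, hge⟩, hd, hlt⟩ :=
    (dense_testSubmodule isOpen_Ioo).exists_mem_eq_dist_lt
    l (toLp_mem_testSubmodule h1.ofReal_comp (h2.comp_left Complex.ofReal_zero)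
    ((tsupport_ofReal χ).trans_subset h3) hm) hχ1 (hF.toLp F) (Real.sqrt_pos.mpr hε)
  refine ⟨g, hg, hgc, hgs, ?_, ?_⟩
  · rw [← integral_congr_ae hge, ← hl, hd, hl, integral_congr_ae hF.coeFn_toLp]
  · have hgm : MemLp g 2 (volume.restrict (Ioo a b)) :=
      (hg.continuous.memLp_of_hasCompactSupport hgc).restrict _
    have hdg : d = hgm.toLp g := Lp.ext (hge.trans hgm.coeFn_toLp.symm)
    rw [hdg, ← MemLp.toLp_sub] at hlt
    have h5 := norm_toLp_two_sq (hF.sub hgm)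
    simp only [Pi.sub_apply] at h5
    rw [← h5]
    exact (Real.lt_sqrt (norm_nonneg _)).mp hlt

end TestFunctions

/-! ### Representatives of square integrable functions on a metric graph -/

namespace MetricGraph

variable {𝒱 ℰ : Type*} {G : MetricGraph 𝒱 ℰ} {u v : ℰ → ℝ → ℂ} {f g : G.L2}

lemma Represents.toLp (h : G.Represents u f) (e : ℰ) :
    ∃ hm : MemLp (u e) 2 (volume.restrict (G.I e)), f e = hm.toLp (u e) :=
  have hm := (memLp_congr_ae (h e)).mp (Lp.memLp (f e))
  ⟨hm, Lp.ext ((h e).trans hm.coeFn_toLp.symm)⟩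

lemma Represents.memLp (h : G.Represents u f) (e : ℰ) :
    MemLp (u e) 2 (volume.restrict (G.I e)) :=
  (h.toLp e).1

lemma Represents.norm_sq_apply (h : G.Represents u f) (e : ℰ) :
    ‖f e‖ ^ 2 = ∫ x in G.I e, ‖u e x‖ ^ 2 := by
  obtain ⟨hm, he⟩ := h.toLp e
  rw [he, norm_toLp_two_sq]

lemma Represents.hasSum_norm_sq (h : G.Represents u f) :
    HasSum (fun e => ∫ x in G.I e, ‖u e x‖ ^ 2) (‖f‖ ^ 2) := by
  have := lp.hasSum_norm (p := 2) (by norm_num) f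
  simp only [ENNReal.toReal_ofNat, Real.rpow_ofNat] at this
  exact this.congr_fun fun e => (h.norm_sq_apply e).symm

lemma Represents.memL2 (h : G.Represents u f) : G.MemL2 u :=
  ⟨h.memLp, h.hasSum_norm_sq.summable⟩

lemma MemL2.exists_represents (h : G.MemL2 u) : ∃ f : G.L2, G.Represents u f := by
  refine ⟨⟨fun e => (h.1 e).toLp (u e), ?_⟩, fun e => (h.1 e).coeFn_toLp⟩
  refine memℓp_gen ?_
  simp only [ENNReal.toReal_ofNat, Real.rpow_ofNat, norm_toLp_two_sq]
  exact h.2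

lemma Represents.unique (h : G.Represents u f) (h' : G.Represents u g) : f = g :=
  lp.ext (funext fun e => Lp.ext ((h e).trans (h' e).symm))

lemma Represents.congr (h : G.Represents u f)
    (huv : ∀ e, u e =ᵐ[volume.restrict (G.I e)] v e) : G.Represents v f :=
  fun e => (h e).trans (huv e)

lemma Represents.ae_eq (h : G.Represents u f) (h' : G.Represents v f) (e : ℰ) :
    u e =ᵐ[volume.restrict (G.I e)] v e :=
  (h e).symm.trans (h' e)

lemma Represents.add (h : G.Represents u f) (h' : G.Represents v g) :
    G.Represents (fun e x => u e x + v e x) (f + g) := fun e => by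
  filter_upwards [Lp.coeFn_add (f e) (g e), h e, h' e] with x h1 h2 h3
  rw [lp.coeFn_add, Pi.add_apply, h1, Pi.add_apply, h2, h3]

lemma Represents.const_smul (h : G.Represents u f) (c : ℂ) :
    G.Represents (fun e x => c * u e x) (c • f) := fun e => by
  filter_upwards [Lp.coeFn_smul c (f e), h e] with x h1 h2
  rw [lp.coeFn_smul, Pi.smul_apply, h1, Pi.smul_apply, h2, smul_eq_mul]

lemma represents_zero : G.Represents (fun _ _ => 0) (0 : G.L2) := fun e => by
  rw [lp.coeFn_zero, Pi.zero_apply]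
  exact Lp.coeFn_zero _ _ _

lemma Represents.sub (h : G.Represents u f) (h' : G.Represents v g) :
    G.Represents (fun e x => u e x - v e x) (f - g) := fun e => by
  filter_upwards [Lp.coeFn_sub (f e) (g e), h e, h' e] with x h1 h2 h3
  rw [lp.coeFn_sub, Pi.sub_apply, h1, Pi.sub_apply, h2, h3]

lemma Represents.inner_apply (h : G.Represents u f) (h' : G.Represents v g) (e : ℰ) :
    ⟪g e, f e⟫_ℂ = ∫ x in G.I e, u e x * conj (v e x) := by
  rw [L2.inner_def]
  refine integral_congr_ae ?_
  filter_upwards [h e, h' e] with x h1 h2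
  rw [h1, h2]
  simp

lemma Represents.integrable_mul_conj (h : G.Represents u f) (h' : G.Represents v g) (e : ℰ) :
    Integrable (fun x => u e x * conj (v e x)) (volume.restrict (G.I e)) := by
  refine (L2.integrable_inner (𝕜 := ℂ) (g e) (f e)).congr ?_
  filter_upwards [h e, h' e] with x h1 h2
  rw [h1, h2]
  simp

lemma Represents.hasSum_inner (h : G.Represents u f) (h' : G.Represents v g) :
    HasSum (fun e => ∫ x in G.I e, u e x * conj (v e x)) ⟪g, f⟫_ℂ :=
  (lp.hasSum_inner g f).congr_fun fun e => (h.inner_apply h' e).symm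

end MetricGraph

namespace MetricGraph

variable {𝒱 ℰ : Type*} {G : MetricGraph 𝒱 ℰ}

/-! ### The edges as intervals -/

lemma mem_I {e : ℰ} {x : ℝ} :
    x ∈ G.I e ↔ 0 ≤ x ∧ (G.length e ≠ ⊤ → x ≤ (G.length e).toReal) := by
  refine and_congr_right fun _ => ?_
  by_cases h : G.length e = ⊤
  · simp [h]
  · rw [ENNReal.ofReal_le_iff_le_toReal h]
    simp [h]

lemma I_eq_Icc {e : ℰ} (h : G.length e ≠ ⊤) : G.I e = Icc 0 (G.length e).toReal := by
  ext x
  simp [mem_I, h]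

lemma I_eq_Ici {e : ℰ} (h : G.length e = ⊤) : G.I e = Ici 0 := by
  ext x
  simp [mem_I, h]

lemma openI_eq_Ioo {e : ℰ} (h : G.length e ≠ ⊤) : G.openI e = Ioo 0 (G.length e).toReal := by
  ext x
  refine and_congr_right fun hx => ?_
  rw [ENNReal.ofReal_lt_iff_lt_toReal hx.le h]

lemma openI_eq_Ioi {e : ℰ} (h : G.length e = ⊤) : G.openI e = Ioi 0 := by
  ext x
  simp [openI, h]

lemma toReal_length_pos {e : ℰ} (h : G.length e ≠ ⊤) : 0 < (G.length e).toReal :=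
  ENNReal.toReal_pos (G.length_pos e).ne' h

variable (G)

lemma isClosed_I (e : ℰ) : IsClosed (G.I e) := by
  by_cases h : G.length e = ⊤
  · rw [I_eq_Ici h]; exact isClosed_Ici
  · rw [I_eq_Icc h]; exact isClosed_Icc

lemma measurableSet_I (e : ℰ) : MeasurableSet (G.I e) := (G.isClosed_I e).measurableSet

lemma isLocallyClosed_I (e : ℰ) : IsLocallyClosed (G.I e) := (G.isClosed_I e).isLocallyClosed

lemma ordConnected_I (e : ℰ) : (G.I e).OrdConnected := by
  by_cases h : G.length e = ⊤
  · rw [I_eq_Ici h]; exact ordConnected_Ici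
  · rw [I_eq_Icc h]; exact ordConnected_Icc

lemma isOpen_openI (e : ℰ) : IsOpen (G.openI e) := by
  by_cases h : G.length e = ⊤
  · rw [openI_eq_Ioi h]; exact isOpen_Ioi
  · rw [openI_eq_Ioo h]; exact isOpen_Ioo

lemma ordConnected_openI (e : ℰ) : (G.openI e).OrdConnected := by
  by_cases h : G.length e = ⊤
  · rw [openI_eq_Ioi h]; exact ordConnected_Ioi
  · rw [openI_eq_Ioo h]; exact ordConnected_Ioo

lemma openI_subset_I (e : ℰ) : G.openI e ⊆ G.I e := fun _ hx => ⟨hx.1.le, hx.2.le⟩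

lemma interior_I (e : ℰ) : interior (G.I e) = G.openI e := by
  by_cases h : G.length e = ⊤
  · rw [I_eq_Ici h, openI_eq_Ioi h, interior_Ici]
  · rw [I_eq_Icc h, openI_eq_Ioo h, interior_Icc]

lemma closure_openI (e : ℰ) : closure (G.openI e) = G.I e := by
  by_cases h : G.length e = ⊤
  · rw [I_eq_Ici h, openI_eq_Ioi h, closure_Ioi]
  · rw [I_eq_Icc h, openI_eq_Ioo h, closure_Ioo (toReal_length_pos h).ne]

lemma restrict_openI (e : ℰ) : volume.restrict (G.openI e) = volume.restrict (G.I e) := by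
  by_cases h : G.length e = ⊤
  · rw [I_eq_Ici h, openI_eq_Ioi h]
    exact Measure.restrict_congr_set Ioi_ae_eq_Ici
  · rw [I_eq_Icc h, openI_eq_Ioo h]
    exact Measure.restrict_congr_set Ioo_ae_eq_Icc

lemma zero_mem_I (e : ℰ) : (0 : ℝ) ∈ G.I e := ⟨le_rfl, by simp⟩

lemma uniqueDiffOn_I (e : ℰ) : UniqueDiffOn ℝ (G.I e) := by
  by_cases h : G.length e = ⊤
  · rw [I_eq_Ici h]; exact uniqueDiffOn_Ici 0
  · rw [I_eq_Icc h]; exact uniqueDiffOn_Icc (toReal_length_pos h)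

variable {G}

lemma I_mem_nhds {e : ℰ} {x : ℝ} (hx : x ∈ G.openI e) : G.I e ∈ 𝓝 x :=
  mem_of_superset ((G.isOpen_openI e).mem_nhds hx) (G.openI_subset_I e)

lemma EdgeEnd.pos_mem_I (a : G.EdgeEnd) : a.pos ∈ G.I a.edge := by
  cases a with
  | source e => exact G.zero_mem_I e
  | target e h => exact mem_I.mpr ⟨ENNReal.toReal_nonneg, fun _ => le_rfl⟩

lemma pt_zero (e : ℰ) : G.pt e 0 = .vertex (G.source e) := by
  rw [pt, dif_neg (lt_irrefl _)]

lemma EdgeEnd.pt_pos (a : G.EdgeEnd) : G.pt a.edge a.pos = .vertex a.vertex := by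
  cases a with
  | source e => exact pt_zero e
  | target e h =>
    have h1 : 0 < (G.length e).toReal := toReal_length_pos h
    have h2 : ¬ ENNReal.ofReal (G.length e).toReal < G.length e := by
      rw [ENNReal.ofReal_toReal h]; exact lt_irrefl _
    simp only [EdgeEnd.edge, EdgeEnd.pos, EdgeEnd.vertex]
    rw [pt, dif_pos h1, dif_neg h2]

/-! ### The path metric -/

lemma Path.nonneg {p q : G.Point} {r : ℝ} (h : G.Path p q r) : 0 ≤ r := by
  induction h with
  | nil => exact le_rfl
  | snoc _ _ _ ih => positivity

lemma Path.trans {p q s : G.Point} {r t : ℝ} (h : G.Path p q r) (h' : G.Path q s t) :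
    G.Path p s (r + t) := by
  induction h' with
  | nil => simpa using h
  | snoc hx hy _ ih => rw [← add_assoc]; exact ih.snoc hx hy

lemma path_pt {e : ℰ} {x y : ℝ} (hx : x ∈ G.I e) (hy : y ∈ G.I e) :
    G.Path (G.pt e x) (G.pt e y) |y - x| := by
  simpa using (Path.nil (G.pt e x)).snoc hx hy

lemma Path.symm {p q : G.Point} {r : ℝ} (h : G.Path p q r) : G.Path q p r := by
  induction h with
  | nil => exact .nil _
  | snoc hx hy _ ih =>
    rw [add_comm, abs_sub_comm]
    exact (path_pt hy hx).trans ih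

lemma Path.dist_le {p q : G.Point} {r : ℝ} (h : G.Path p q r) :
    G.dist p q ≤ ENNReal.ofReal r :=
  iInf₂_le r h

lemma dist_symm (p q : G.Point) : G.dist p q = G.dist q p :=
  le_antisymm (le_iInf₂ fun _ h => h.symm.dist_le) (le_iInf₂ fun _ h => h.symm.dist_le)

lemma dist_triangle (p q s : G.Point) : G.dist p s ≤ G.dist p q + G.dist q s := by
  conv_rhs => rw [dist, dist]
  simp_rw [ENNReal.iInf_add, ENNReal.add_iInf]
  refine le_iInf₂ fun r h => le_iInf₂ fun t h' => ?_
  rw [← ENNReal.ofReal_add h.nonneg h'.nonneg]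
  exact (h.trans h').dist_le

lemma Connected.dist_ne_top (hconn : G.Connected) (p q : G.Point) : G.dist p q ≠ ⊤ := by
  obtain ⟨r, hr⟩ := hconn.2 p q
  exact ne_top_of_le_ne_top ENNReal.ofReal_ne_top hr.dist_le

/-- The segment between two points of an edge is itself a path, so the triangle inequality makes the
distance to a fixed point 1-Lipschitz along the edge. -/
lemma Connected.abs_toReal_dist_sub_le (hconn : G.Connected) (o : G.Point) {e : ℰ} {x y : ℝ}
    (hx : x ∈ G.I e) (hy : y ∈ G.I e) :
    |(G.dist o (G.pt e x)).toReal - (G.dist o (G.pt e y)).toReal| ≤ |x - y| := by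
  have key : ∀ x ∈ G.I e, ∀ y ∈ G.I e,
      (G.dist o (G.pt e x)).toReal - (G.dist o (G.pt e y)).toReal ≤ |x - y| := by
    intro x hx y hy
    have h1 : G.dist o (G.pt e x) ≤ G.dist o (G.pt e y) + ENNReal.ofReal |x - y| :=
      (dist_triangle o (G.pt e y) (G.pt e x)).trans (by gcongr; exact (path_pt hy hx).dist_le)
    have h2 := ENNReal.toReal_mono
      (ENNReal.add_ne_top.mpr ⟨hconn.dist_ne_top _ _, ENNReal.ofReal_ne_top⟩) h1
    rw [ENNReal.toReal_add (hconn.dist_ne_top _ _) ENNReal.ofReal_ne_top,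
      ENNReal.toReal_ofReal (abs_nonneg _)] at h2
    linarith
  rw [abs_le]
  constructor
  · have := key y hy x hx
    rw [abs_sub_comm] at this
    linarith
  · exact key x hx y hy

lemma Connected.isBddSet_ball (hconn : G.Connected) (o : G.Point) (R : ℝ) :
    G.IsBddSet {p | (G.dist o p).toReal ≤ R} := by
  refine ⟨R + R, fun p hp q hq => ?_⟩
  have hR : 0 ≤ R := ENNReal.toReal_nonneg.trans hp
  refine (dist_triangle p o q).trans ?_
  rw [ENNReal.ofReal_add hR hR, dist_symm p o]
  exact add_le_add ((ENNReal.le_ofReal_iff_toReal_le (hconn.dist_ne_top _ _) hR).mpr hp)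
    ((ENNReal.le_ofReal_iff_toReal_le (hconn.dist_ne_top _ _) hR).mpr hq)

/-! ### Bounded support, compact support and cutoff functions -/

open Classical in
/-- The coordinate on the edge `e`, extended by zero. -/
noncomputable def coord (e : ℰ) : G.Point → ℝ
  | .vertex _ => 0
  | .inner e' x _ => if e' = e then x else 0

lemma coord_pt_of_ne {e e' : ℰ} (h : e' ≠ e) (x : ℝ) : G.coord e (G.pt e' x) = 0 := by
  rw [pt]
  split_ifs <;> simp [coord, h]

lemma coord_pt_self {e : ℰ} (h : G.length e = ⊤) {x : ℝ} (hx : 0 ≤ x) :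
    G.coord e (G.pt e x) = x := by
  rcases hx.eq_or_lt with rfl | hx
  · rw [pt_zero, coord]
  · have h1 : ENNReal.ofReal x < G.length e := by simp [h]
    rw [pt, dif_pos hx, dif_pos h1]
    simp [coord]

/-- A half-line is attached to the graph only at 0, and the coordinate is zero on the rest of the
graph. A path therefore finds no shortcut, and each of its moves changes the coordinate by at most
its length. -/
lemma Path.abs_coord_sub_le {e : ℰ} (h : G.length e = ⊤) {p q : G.Point} {r : ℝ}
    (hp : G.Path p q r) : |G.coord e q - G.coord e p| ≤ r := by
  induction hp with
  | nil => simp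
  | @snoc e' x y r hx hy _ ih =>
    have : |G.coord e (G.pt e' y) - G.coord e (G.pt e' x)| ≤ |y - x| := by
      by_cases he : e' = e
      · subst he
        rw [coord_pt_self h hx.1, coord_pt_self h hy.1]
      · rw [coord_pt_of_ne he, coord_pt_of_ne he]
        simp
    have h2 := abs_sub_le (G.coord e (G.pt e' y)) (G.coord e (G.pt e' x)) (G.coord e p)
    linarith

lemma abs_coord_sub_le_of_dist_le {e : ℰ} (h : G.length e = ⊤) {p q : G.Point} {R : ℝ}
    (hd : G.dist p q ≤ ENNReal.ofReal R) : |G.coord e q - G.coord e p| ≤ max R 0 := by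
  have : ENNReal.ofReal |G.coord e q - G.coord e p| ≤ ENNReal.ofReal R :=
    (le_iInf₂ fun r hr => ENNReal.ofReal_le_ofReal (hr.abs_coord_sub_le h)).trans hd
  have := ENNReal.toReal_mono ENNReal.ofReal_ne_top this
  rwa [ENNReal.toReal_ofReal (abs_nonneg _), ENNReal.toReal_ofReal'] at this

/-- On the closed edges, the function `u` vanishes outside a compact part of finitely many edges. -/
def HasCompactSupp (G : MetricGraph 𝒱 ℰ) (u : ℰ → ℝ → ℂ) (F : Finset ℰ) (L : ℝ) : Prop :=
  ∀ e, ∀ x ∈ G.I e, u e x ≠ 0 → e ∈ F ∧ x ≤ L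

/-- Local finiteness leaves finitely many edges. On a half-line the coordinate is controlled by the
distance, so a bounded support does not reach arbitrarily far out. -/
lemma HasBddSupport.hasCompactSupp (hfin : G.LocallyFinite) {u : ℰ → ℝ → ℂ}
    (hu : G.HasBddSupport u) : ∃ F L, G.HasCompactSupp u F L := by
  have hF := hfin.2 _ hu
  obtain ⟨R, hR⟩ := hu
  have hL : ∀ e, ∃ L : ℝ, ∀ x ∈ G.I e, u e x ≠ 0 → x ≤ L := by
    intro e
    by_cases h : G.length e = ⊤
    · by_cases hex : ∃ x ∈ G.I e, u e x ≠ 0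
      · obtain ⟨x, hx, hxu⟩ := hex
        refine ⟨x + max R 0, fun y hy hyu => ?_⟩
        have := abs_coord_sub_le_of_dist_le h
          (hR (G.pt e x) ⟨e, x, hx, rfl, hxu⟩ (G.pt e y) ⟨e, y, hy, rfl, hyu⟩)
        rw [coord_pt_self h hx.1, coord_pt_self h hy.1] at this
        linarith [le_abs_self (y - x)]
      · push Not at hex
        exact ⟨0, fun x hx hxu => absurd (hex x hx) hxu⟩
    · exact ⟨_, fun x hx _ => (mem_I.mp hx).2 h⟩
  choose L hL using hL
  refine ⟨hF.toFinset, ∑ e ∈ hF.toFinset, |L e|, fun e x hx hxu => ?_⟩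
  have he : e ∈ hF.toFinset := by
    rw [Finite.mem_toFinset]
    exact ⟨G.pt e x, ⟨x, hx, rfl⟩, e, x, hx, rfl, hxu⟩
  refine ⟨he, (hL e x hx hxu).trans ((le_abs_self _).trans ?_)⟩
  exact Finset.single_le_sum (f := fun e => |L e|) (fun _ _ => abs_nonneg _) he

/-- Any two points of the support are joined through the ends 0 of their edges. Connectedness
provides paths between these ends, and only finitely many pairs of edges occur. -/
lemma HasCompactSupp.hasBddSupport (hconn : G.Connected) {u : ℰ → ℝ → ℂ} {F : Finset ℰ} {L : ℝ}
    (hu : G.HasCompactSupp u F L) : G.HasBddSupport u := by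
  choose r hr using fun e e' : ℰ => hconn.2 (G.pt e 0) (G.pt e' 0)
  refine ⟨L + (∑ e ∈ F, ∑ e' ∈ F, r e e') + L, ?_⟩
  rintro _ ⟨e, x, hx, rfl, hxu⟩ _ ⟨e', x', hx', rfl, hxu'⟩
  obtain ⟨he, hxL⟩ := hu e x hx hxu
  obtain ⟨he', hxL'⟩ := hu e' x' hx' hxu'
  have hp := ((path_pt hx (G.zero_mem_I e)).trans (hr e e')).trans
    (path_pt (G.zero_mem_I e') hx')
  refine hp.dist_le.trans (ENNReal.ofReal_le_ofReal ?_)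
  have h1 : |0 - x| ≤ L := by rw [zero_sub, abs_neg, abs_of_nonneg hx.1]; exact hxL
  have h2 : |x' - 0| ≤ L := by rw [sub_zero, abs_of_nonneg hx'.1]; exact hxL'
  have h3 : r e e' ≤ ∑ e ∈ F, ∑ e' ∈ F, r e e' :=
    (Finset.single_le_sum (f := fun e' => r e e') (fun e' _ => (hr e e').nonneg) he').trans
      (Finset.single_le_sum (f := fun e => ∑ e' ∈ F, r e e')
        (fun e _ => Finset.sum_nonneg fun e' _ => (hr e e').nonneg) he)
  linarith

/-- With ρ the distance to a fixed vertex, the functions max(0, min(1, 2 - ρ/(n+1))) equal 1 where ρ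
≤ n+1, vanish where ρ ≥ 2(n+1), and have Lipschitz constant 1/(n+1), which tends to zero. Being
functions of the point of the graph, they agree at all edge ends of a vertex. -/
lemma Connected.exists_cutoff (hconn : G.Connected) (hfin : G.LocallyFinite) :
    ∃ η : ℕ → ℰ → ℝ → ℝ,
      (∀ (n : ℕ) (e : ℰ), LipschitzWith (1 / (n + 1 : NNReal)) (η n e)) ∧
      (∀ n e, ∀ x ∈ G.I e, 0 ≤ η n e x ∧ η n e x ≤ 1) ∧
      (∀ n, ∀ a b : G.EdgeEnd, a.vertex = b.vertex → η n a.edge a.pos = η n b.edge b.pos) ∧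
      (∀ n, ∃ F L, G.HasCompactSupp (fun e x => η n e x) F L) ∧
      ∀ e, ∀ x ∈ G.I e, ∀ᶠ n in atTop, η n e x = 1 := by
  obtain ⟨v₀⟩ := hconn.1
  set ρ : G.Point → ℝ := fun p => (G.dist (.vertex v₀) p).toReal with hρ
  set h : ℕ → G.Point → ℝ := fun n p => max 0 (min 1 (2 - ρ p / (n + 1))) with hh
  have hlip : ∀ (n : ℕ) (e : ℰ),
      LipschitzOnWith (1 / (n + 1 : NNReal)) (fun x => h n (G.pt e x)) (G.I e) := by
    intro n e
    refine LipschitzOnWith.of_dist_le_mul fun x hx y hy => ?_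
    have h1 := hconn.abs_toReal_dist_sub_le (.vertex v₀) hx hy
    have h2 : |h n (G.pt e x) - h n (G.pt e y)| ≤
        |(2 - ρ (G.pt e x) / (n + 1)) - (2 - ρ (G.pt e y) / (n + 1))| := by
      refine (abs_max_sub_max_le_max _ _ _ _).trans ?_
      rw [sub_self, abs_zero, max_eq_right (abs_nonneg _)]
      refine (abs_min_sub_min_le_max _ _ _ _).trans ?_
      rw [sub_self, abs_zero, max_eq_right (abs_nonneg _)]
    rw [Real.dist_eq, Real.dist_eq]
    refine h2.trans ?_
    have h3 : (2 - ρ (G.pt e x) / (n + 1)) - (2 - ρ (G.pt e y) / (n + 1)) =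
        (1 / (n + 1)) * (ρ (G.pt e y) - ρ (G.pt e x)) := by ring
    rw [h3, abs_mul, abs_of_nonneg (by positivity), abs_sub_comm]
    push_cast
    gcongr
  -- The Lipschitz bound is only known on the closed edge; extending to ℝ with the same constant
  -- makes the global derivative available.
  choose η hη hηeq using fun n e => (hlip n e).extend_real
  refine ⟨η, hη, fun n e x hx => ?_, fun n a b hab => ?_, fun n => ?_, fun e x hx => ?_⟩
  · rw [← hηeq n e hx]
    exact ⟨le_max_left _ _, max_le zero_le_one (min_le_left _ _)⟩
  · rw [← hηeq n _ a.pos_mem_I, ← hηeq n _ b.pos_mem_I]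
    simp only [EdgeEnd.pt_pos, hab]
  · have hb : G.HasBddSupport fun e x => (η n e x : ℂ) := by
      obtain ⟨R, hR⟩ := hconn.isBddSet_ball (.vertex v₀) (2 * (n + 1))
      have hsub : ∀ p ∈ {p | ∃ e, ∃ x ∈ G.I e, G.pt e x = p ∧ (η n e x : ℂ) ≠ 0},
          p ∈ {p | (G.dist (.vertex v₀) p).toReal ≤ 2 * (n + 1)} := by
        rintro _ ⟨e, x, hx, rfl, hne⟩
        by_contra hcon
        apply hne
        rw [mem_ofPred_eq, not_le] at hcon
        rw [← hηeq n e hx, Complex.ofReal_eq_zero]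
        refine max_eq_left ((min_le_right _ _).trans ?_)
        rw [sub_nonpos, le_div_iff₀ (by positivity)]
        exact hcon.le
      exact ⟨R, fun p hp q hq => hR p (hsub p hp) q (hsub q hq)⟩
    exact hb.hasCompactSupp hfin
  · obtain ⟨N, hN⟩ := exists_nat_ge (ρ (G.pt e x))
    filter_upwards [eventually_ge_atTop N] with n hn
    rw [← hηeq n e hx]
    have : ρ (G.pt e x) / (n + 1) ≤ 1 := by
      rw [div_le_one (by positivity)]
      have : (N : ℝ) ≤ n := by exact_mod_cast hn
      linarith
    show max 0 (min 1 (2 - ρ (G.pt e x) / (n + 1))) = 1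
    rw [min_eq_left (by linarith), max_eq_right zero_le_one]

/-- Only finitely many edge ends belong to a finite set of edges. -/
lemma EdgeEnd.finite_of_edge (F : Finset ℰ) : {a : G.EdgeEnd | a.edge ∈ F}.Finite := by
  classical
  have : {a : G.EdgeEnd | a.edge ∈ F} ⊆ (fun e => EdgeEnd.source e) '' (F : Set ℰ) ∪
      (fun e => if h : G.length e ≠ ⊤ then EdgeEnd.target e h else EdgeEnd.source e) ''
        (F : Set ℰ) := by
    intro a ha
    cases a with
    | source e => exact Or.inl ⟨e, ha, rfl⟩
    | target e h => exact Or.inr ⟨e, ha, dif_pos h⟩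
  exact ((F.finite_toSet.image _).union (F.finite_toSet.image _)).subset this

end MetricGraph

/-! ### From open edges to closed edges -/

lemma IsPrimitiveOn.of_subset_closure {J K : Set ℝ} (hK : K.OrdConnected)
    (hJK : J ⊆ K) (hKJ : K ⊆ closure J) {f F : ℝ → ℂ} (hf : ContinuousOn f K)
    (hF : LocallyIntegrableOn F K) (h : IsPrimitiveOn J f F) : IsPrimitiveOn K f F := by
  rcases J.eq_empty_or_nonempty with rfl | ⟨x₀, hx₀⟩
  · rw [closure_empty, subset_empty_iff] at hKJ
    subst hKJ
    exact h
  have hp := isPrimitiveOn_integral hK hF (hJK hx₀)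
  -- Both sides are continuous on `K` and agree on the dense subset `J`.
  have hEq : EqOn (fun x => f x₀ + ∫ t in x₀..x, F t) f K := by
    refine EqOn.of_subset_closure (s := J) (fun x hx => ?_)
      (continuousOn_const.add (hp.continuousOn hK)) hf hJK hKJ
    simp only [← h.2 x₀ hx₀ x hx]
    ring
  refine IsPrimitiveOn.congr ⟨hF, fun x hx y hy => ?_⟩ hEq
  rw [← hp.2 x hx y hy]
  ring

lemma MeasureTheory.MemLp.locallyIntegrableOn_of_restrict {s : Set ℝ} {f : ℝ → ℂ}
    (hf : MemLp f 2 (volume.restrict s)) : LocallyIntegrableOn f s :=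
  locallyIntegrableOn_of_locallyIntegrable_restrict (hf.locallyIntegrable (by norm_num))

lemma ContinuousOn.ofReal {a : ℝ → ℝ} {s : Set ℝ} (h : ContinuousOn a s) :
    ContinuousOn (fun x => (a x : ℂ)) s :=
  Complex.continuous_ofReal.comp_continuousOn h

namespace MetricGraph

variable {𝒱 ℰ : Type*} {G : MetricGraph 𝒱 ℰ}

/-! ### The magnetic derivative of absolutely continuous functions -/

/-- On each edge, `u` is absolutely continuous and `p = D_A u`. -/
def MagPrimitive (G : MetricGraph 𝒱 ℰ) (A : ℰ → ℝ → ℝ) (u p : ℰ → ℝ → ℂ) : Prop :=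
  ∀ e, IsPrimitiveOn (G.I e) (u e) fun x => Complex.I * (p e x + A e x * u e x)

variable {A V : ℰ → ℝ → ℝ} {u v p q : ℰ → ℝ → ℂ}

lemma MagPrimitive.continuousOn (h : G.MagPrimitive A u p) (e : ℰ) : ContinuousOn (u e) (G.I e) :=
  (h e).continuousOn (G.ordConnected_I e)

lemma MagPrimitive.add (h : G.MagPrimitive A u p) (h' : G.MagPrimitive A v q) :
    G.MagPrimitive A (fun e x => u e x + v e x) (fun e x => p e x + q e x) := fun e => by
  have := (h e).add (G.ordConnected_I e) (h' e)
  convert this using 2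
  ring

lemma MagPrimitive.const_mul (h : G.MagPrimitive A u p) (c : ℂ) :
    G.MagPrimitive A (fun e x => c * u e x) (fun e x => c * p e x) := fun e => by
  have := (h e).const_mul c
  convert this using 2
  ring

lemma magPrimitive_zero : G.MagPrimitive A (fun _ _ => 0) (fun _ _ => 0) := fun e => by
  refine ⟨?_, fun x _ y _ => by simp⟩
  simp only [mul_zero, add_zero]
  exact (continuousOn_const).locallyIntegrableOn (G.measurableSet_I e)

lemma MagPrimitive.sub (h : G.MagPrimitive A u p) (h' : G.MagPrimitive A v q) :
    G.MagPrimitive A (fun e x => u e x - v e x) (fun e x => p e x - q e x) := by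
  convert! h.add (h'.const_mul (-1)) using 3 <;> ring

lemma MagPrimitive.congr_left (h : G.MagPrimitive A u p) (huv : ∀ e, EqOn (u e) (v e) (G.I e)) :
    G.MagPrimitive A v p := fun e => by
  refine IsPrimitiveOn.congr ((h e).congr_ae (G.ordConnected_I e) (G.measurableSet_I e) ?_) (huv e)
  filter_upwards [ae_restrict_mem (G.measurableSet_I e)] with x hx
  rw [huv e hx]

lemma MagPrimitive.hasWeakDeriv (h : G.MagPrimitive A u p) (e : ℰ) :
    HasWeakDeriv (G.openI e) (u e) fun x => Complex.I * (p e x + A e x * u e x) :=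
  ((h e).mono (G.openI_subset_I e)).hasWeakDeriv (G.ordConnected_openI e) (G.isOpen_openI e)

lemma magD_ae_eq_of_hasWeakDeriv {e : ℰ} {w : ℝ → ℂ} (h : HasWeakDeriv (G.openI e) (u e) w) :
    G.magD A u e =ᵐ[volume.restrict (G.I e)]
      fun x => 1 / Complex.I * w x - A e x * u e x := by
  have := weakDeriv_ae_eq (G.isOpen_openI e) h
  rw [restrict_openI] at this
  filter_upwards [this] with x hx
  rw [magD, hx]

lemma MagPrimitive.magD_ae_eq (h : G.MagPrimitive A u p) (e : ℰ) :
    G.magD A u e =ᵐ[volume.restrict (G.I e)] p e := by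
  filter_upwards [magD_ae_eq_of_hasWeakDeriv (A := A) (h.hasWeakDeriv e)] with x hx
  rw [hx]
  field_simp
  ring

lemma MagPrimitive.ae_eq (h : G.MagPrimitive A u p) (h' : G.MagPrimitive A u q) (e : ℰ) :
    p e =ᵐ[volume.restrict (G.I e)] q e :=
  (h.magD_ae_eq e).symm.trans (h'.magD_ae_eq e)

/-- The weak derivative only sees the open edge. Continuity of u up to the ends and local
integrability of D_A u on the closed edge extend the integral identity to the ends. -/
lemma magPrimitive_magD (hA : ∀ e, ContinuousOn (A e) (G.I e))
    (hu : ∀ e, ContinuousOn (u e) (G.I e)) (hw : ∀ e, ∃ w, HasWeakDeriv (G.openI e) (u e) w)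
    (hp : ∀ e, LocallyIntegrableOn (G.magD A u e) (G.I e)) :
    G.MagPrimitive A u (G.magD A u) := fun e => by
  obtain ⟨w, hw⟩ := hw e
  have h1 := hw.isPrimitiveOn (G.ordConnected_openI e) (G.isOpen_openI e)
    ((hu e).mono (G.openI_subset_I e))
  have hae := magD_ae_eq_of_hasWeakDeriv (A := A) hw
  have hloc : LocallyIntegrableOn
      (fun x => Complex.I * (G.magD A u e x + A e x * u e x)) (G.I e) :=
    ((hp e).add (((hA e).ofReal.mul (hu e)).locallyIntegrableOn
      (G.measurableSet_I e))).continuousOn_mul continuousOn_const (G.isLocallyClosed_I e)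
  refine IsPrimitiveOn.of_subset_closure (G.ordConnected_I e) (G.openI_subset_I e)
    (G.closure_openI e).ge (hu e) hloc ?_
  refine h1.congr_ae (G.ordConnected_openI e) (G.isOpen_openI e).measurableSet ?_
  rw [restrict_openI]
  filter_upwards [hae] with x hx
  rw [hx]
  field_simp
  ring

lemma MemH1A.magPrimitive (hA : ∀ e, ContinuousOn (A e) (G.I e)) (hu : G.MemH1A A V u) :
    G.MagPrimitive A u (G.magD A u) :=
  magPrimitive_magD hA hu.1.1 hu.2.1 fun e => (hu.2.2.1.1 e).locallyIntegrableOn_of_restrict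

/-- Weighted integrability becomes plain L² membership. It is applied with the weights V - 1 and 1,
and `MemH1A.memL2_sqrt_mul` applies it with V. -/
lemma memL2_sqrt_mul_iff {W : ℰ → ℝ → ℝ} (hW : ∀ e, ContinuousOn (W e) (G.I e))
    (hW0 : ∀ e, ∀ x ∈ G.I e, 0 ≤ W e x) (hu : ∀ e, ContinuousOn (u e) (G.I e)) :
    G.MemL2 (fun e x => (√(W e x) : ℂ) * u e x) ↔
      (∀ e, IntegrableOn (fun x => W e x * ‖u e x‖ ^ 2) (G.I e)) ∧
        Summable fun e => ∫ x in G.I e, W e x * ‖u e x‖ ^ 2 := by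
  have hEq : ∀ e, EqOn (fun x => ‖(√(W e x) : ℂ) * u e x‖ ^ 2) (fun x => W e x * ‖u e x‖ ^ 2)
      (G.I e) := fun e x hx => by
    simp only [norm_mul, mul_pow, Complex.norm_real, Real.norm_eq_abs, sq_abs,
      Real.sq_sqrt (hW0 e x hx)]
  have hm : ∀ e, AEStronglyMeasurable (fun x => (√(W e x) : ℂ) * u e x)
      (volume.restrict (G.I e)) := fun e =>
    (((hW e).sqrt).ofReal.mul (hu e)).aestronglyMeasurable (G.measurableSet_I e)
  refine and_congr (forall_congr' fun e => ?_) ?_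
  · rw [memLp_two_iff_integrable_sq_norm (hm e)]
    exact integrableOn_congr_fun (hEq e) (G.measurableSet_I e)
  · exact summable_congr fun e => setIntegral_congr_fun (G.measurableSet_I e) (hEq e)

lemma MemL2.of_norm_le (hv : G.MemL2 v) (hm : ∀ e, AEStronglyMeasurable (u e)
    (volume.restrict (G.I e))) (h : ∀ e, ∀ x ∈ G.I e, ‖u e x‖ ≤ ‖v e x‖) : G.MemL2 u := by
  have h' : ∀ e, ∀ᵐ x ∂(volume.restrict (G.I e)), ‖u e x‖ ≤ ‖v e x‖ := fun e => by
    filter_upwards [ae_restrict_mem (G.measurableSet_I e)] with x hx using h e x hx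
  have hmem : ∀ e, MemLp (u e) 2 (volume.restrict (G.I e)) := fun e =>
    (hv.1 e).mono (hm e) (h' e)
  refine ⟨hmem, hv.2.of_nonneg_of_le (fun e => by positivity) fun e => ?_⟩
  refine integral_mono_ae ((memLp_two_iff_integrable_sq_norm (hm e)).mp (hmem e))
    ((memLp_two_iff_integrable_sq_norm (hv.1 e).1).mp (hv.1 e)) ?_
  filter_upwards [h' e] with x hx
  gcongr

lemma MemH1A.memL2_sqrt_mul {W : ℰ → ℝ → ℝ} (hV : ∀ e, ContinuousOn (V e) (G.I e))
    (hW : ∀ e, ContinuousOn (W e) (G.I e)) (hW0 : ∀ e, ∀ x ∈ G.I e, 0 ≤ W e x)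
    (hWV : ∀ e, ∀ x ∈ G.I e, W e x ≤ V e x) (hu : G.MemH1A A V u) :
    G.MemL2 (fun e x => (√(W e x) : ℂ) * u e x) := by
  have h := (memL2_sqrt_mul_iff hV (fun e x hx => (hW0 e x hx).trans (hWV e x hx)) hu.1.1).mpr
    hu.2.2.2
  refine h.of_norm_le (fun e => (((hW e).sqrt).ofReal.mul (hu.1.1 e)).aestronglyMeasurable
    (G.measurableSet_I e)) fun e x hx => ?_
  rw [norm_mul, norm_mul, Complex.norm_real, Complex.norm_real, Real.norm_eq_abs,
    Real.norm_eq_abs, abs_of_nonneg (Real.sqrt_nonneg _), abs_of_nonneg (Real.sqrt_nonneg _)]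
  gcongr
  exact hWV e x hx

/-! ### The energy space -/

/-- The Hilbert space `H¹_A` with the inner product `Q`, realized as the space of all triples
`(D_A u, √(V - 1) u, u)`. -/
def energySpace (G : MetricGraph 𝒱 ℰ) (A V : ℰ → ℝ → ℝ) :
    Submodule ℂ (PiLp 2 fun _ : Fin 3 => G.L2) where
  carrier := {y | ∃ u p, G.IsCont u ∧ G.MagPrimitive A u p ∧ G.Represents p (y 0) ∧
    G.Represents (fun e x => (√(V e x - 1) : ℂ) * u e x) (y 1) ∧ G.Represents u (y 2)}
  add_mem' := by
    rintro y z ⟨u, p, h1, h2, h3, h4, h5⟩ ⟨v, q, h1', h2', h3', h4', h5'⟩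
    refine ⟨fun e x => u e x + v e x, fun e x => p e x + q e x,
      ⟨fun e => (h1.1 e).add (h1'.1 e), fun a b hab => ?_⟩, h2.add h2', h3.add h3', ?_,
      h5.add h5'⟩
    · simp only [h1.2 a b hab, h1'.2 a b hab]
    · simp only [mul_add]
      exact h4.add h4'
  zero_mem' := by
    refine ⟨fun _ _ => 0, fun _ _ => 0, ⟨fun e => continuousOn_const, fun a b hab => rfl⟩,
      magPrimitive_zero, represents_zero, ?_, represents_zero⟩
    simp only [mul_zero]
    exact represents_zero
  smul_mem' := by
    rintro c y ⟨u, p, h1, h2, h3, h4, h5⟩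
    refine ⟨fun e x => c * u e x, fun e x => c * p e x,
      ⟨fun e => continuousOn_const.mul (h1.1 e), fun a b hab => ?_⟩, h2.const_mul c,
      h3.const_smul c, ?_, h5.const_smul c⟩
    · simp only [h1.2 a b hab]
    · simp only [mul_left_comm _ c]
      exact h4.const_smul c

lemma MemH1A.exists_mem_energySpace (hA : ∀ e, ContinuousOn (A e) (G.I e))
    (hV : ∀ e, ContinuousOn (V e) (G.I e)) (hV1 : ∀ e, ∀ x ∈ G.I e, 1 ≤ V e x)
    (hu : G.MemH1A A V u) : ∃ y ∈ G.energySpace A V, G.Represents (G.magD A u) (y 0) ∧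
      G.Represents (fun e x => (√(V e x - 1) : ℂ) * u e x) (y 1) ∧ G.Represents u (y 2) := by
  obtain ⟨f, hf⟩ := hu.2.2.1.exists_represents
  obtain ⟨g, hg⟩ := (hu.memL2_sqrt_mul (W := fun e x => V e x - 1) hV
    (fun e => (hV e).sub continuousOn_const) (fun e x hx => sub_nonneg.mpr (hV1 e x hx))
    (fun e x _ => by linarith)).exists_represents
  have h1 := hu.memL2_sqrt_mul (W := fun e x => 1) hV (fun e => continuousOn_const)
    (fun e x hx => zero_le_one) (fun e x hx => hV1 e x hx)
  simp only [Real.sqrt_one, Complex.ofReal_one, one_mul] at h1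
  obtain ⟨h, hh⟩ := h1.exists_represents
  exact ⟨WithLp.toLp 2 ![f, g, h], ⟨u, _, hu.1, hu.magPrimitive hA, hf, hg, hh⟩, hf, hg, hh⟩

lemma exists_memH1A_of_mem_energySpace (hV : ∀ e, ContinuousOn (V e) (G.I e))
    (hV1 : ∀ e, ∀ x ∈ G.I e, 1 ≤ V e x) {y : PiLp 2 fun _ : Fin 3 => G.L2}
    (hy : y ∈ G.energySpace A V) : ∃ u, G.MemH1A A V u ∧ G.Represents (G.magD A u) (y 0) ∧
      G.Represents (fun e x => (√(V e x - 1) : ℂ) * u e x) (y 1) ∧ G.Represents u (y 2) := by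
  obtain ⟨u, p, h1, h2, h3, h4, h5⟩ := hy
  have hD : G.Represents (G.magD A u) (y 0) := h3.congr fun e => (h2.magD_ae_eq e).symm
  have e1 := (memL2_sqrt_mul_iff (W := fun e x => V e x - 1)
    (fun e => (hV e).sub continuousOn_const) (fun e x hx => sub_nonneg.mpr (hV1 e x hx))
    h1.1).mp h4.memL2
  have e2 := (memL2_sqrt_mul_iff (G := G) (u := u) (W := fun e x => 1)
    (fun e => continuousOn_const) (fun e x hx => zero_le_one) h1.1).mp
    (by simpa using h5.memL2)
  have hsum : ∀ e x, (V e x - 1) * ‖u e x‖ ^ 2 + 1 * ‖u e x‖ ^ 2 = V e x * ‖u e x‖ ^ 2 :=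
    fun e x => by ring
  refine ⟨u, ⟨h1, fun e => ⟨_, h2.hasWeakDeriv e⟩, hD.memL2, fun e => ?_, ?_⟩, hD, h4, h5⟩
  · have := (e1.1 e).add (e2.1 e)
    refine this.congr_fun (fun x _ => hsum e x) (G.measurableSet_I e)
  · refine (e1.2.add e2.2).congr fun e => ?_
    rw [← integral_add (e1.1 e) (e2.1 e)]
    simp only [hsum]

/-- The weights of the last two components add up to (V - 1) + 1 = V. -/
lemma inner_energySpace (hV1 : ∀ e, ∀ x ∈ G.I e, 1 ≤ V e x)
    {y z : PiLp 2 fun _ : Fin 3 => G.L2}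
    (hu0 : G.Represents (G.magD A u) (y 0))
    (hu1 : G.Represents (fun e x => (√(V e x - 1) : ℂ) * u e x) (y 1))
    (hu2 : G.Represents u (y 2))
    (hv0 : G.Represents (G.magD A v) (z 0))
    (hv1 : G.Represents (fun e x => (√(V e x - 1) : ℂ) * v e x) (z 1))
    (hv2 : G.Represents v (z 2)) : ⟪z, y⟫_ℂ = G.formQ A V u v := by
  have hs := ((hu0.hasSum_inner hv0).add (hu1.hasSum_inner hv1)).add (hu2.hasSum_inner hv2)
  rw [PiLp.inner_apply, Fin.sum_univ_three, formQ, ← hs.tsum_eq]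
  refine tsum_congr fun e => ?_
  have i0 := hu0.integrable_mul_conj hv0 e
  have i1 := hu1.integrable_mul_conj hv1 e
  have i2 := hu2.integrable_mul_conj hv2 e
  have h3 := integral_add (i0.add i1) i2
  simp only [Pi.add_apply] at h3
  rw [← integral_add i0 i1, ← h3]
  refine setIntegral_congr_fun (G.measurableSet_I e) fun x hx => ?_
  have h1 : (√(V e x - 1) : ℂ) * (√(V e x - 1) : ℂ) = V e x - 1 := by
    rw [← Complex.ofReal_mul, Real.mul_self_sqrt (sub_nonneg.mpr (hV1 e x hx))]
    push_cast; rfl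
  simp only [map_mul, Complex.conj_ofReal]
  linear_combination (u e x * conj (v e x)) * h1

end MetricGraph

namespace MetricGraph

variable {𝒱 ℰ : Type*} {G : MetricGraph 𝒱 ℰ}

/-! ### The energy space is a Hilbert space embedded in `L²` -/

variable {A V : ℰ → ℝ → ℝ} {u v p q : ℰ → ℝ → ℂ}

/-- Continuous functions that are equal almost everywhere agree on the open edge, and by density on
its closure. -/
lemma Represents.eqOn {f : G.L2} (h : G.Represents u f) (h' : G.Represents v f)
    (hu : ∀ e, ContinuousOn (u e) (G.I e)) (hv : ∀ e, ContinuousOn (v e) (G.I e)) (e : ℰ) :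
    EqOn (u e) (v e) (G.I e) := by
  have hae := h.ae_eq h' e
  rw [← restrict_openI] at hae
  have := Measure.eqOn_open_of_ae_eq hae (G.isOpen_openI e)
    ((hu e).mono (G.openI_subset_I e)) ((hv e).mono (G.openI_subset_I e))
  exact this.of_subset_closure (hu e) (hv e) (G.openI_subset_I e) (G.closure_openI e).ge

/-- The third component determines the continuous representative u, and u determines D_A u and √(V -
1) u almost everywhere. This is the injectivity that makes the form closable. -/
lemma energySpace_ext {y z : PiLp 2 fun _ : Fin 3 => G.L2} (hy : y ∈ G.energySpace A V)
    (hz : z ∈ G.energySpace A V) (h : y 2 = z 2) : y = z := by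
  obtain ⟨u, p, h1, h2, h3, h4, h5⟩ := hy
  obtain ⟨v, q, h1', h2', h3', h4', h5'⟩ := hz
  rw [← h] at h5'
  have huv := fun e => (h5'.eqOn h5 h1'.1 h1.1 e)
  ext i : 1
  fin_cases i
  · exact h3.unique (h3'.congr fun e => (h2'.congr_left huv).ae_eq h2 e)
  · refine h4.unique (h4'.congr fun e => ?_)
    filter_upwards [ae_restrict_mem (G.measurableSet_I e)] with x hx
    rw [huv e hx]
  · exact h

/-- The Cauchy–Schwarz inequality against the constant function 1. -/
lemma setIntegral_norm_le_sqrt {K : Set ℝ} (hK : volume K ≠ ⊤) {f : ℝ → ℂ}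
    (hm : MemLp f 2 (volume.restrict K)) :
    ∫ x in K, ‖f x‖ ≤ √(volume.real K) * √(∫ x in K, ‖f x‖ ^ 2) := by
  have hfin : IsFiniteMeasure (volume.restrict K) := ⟨by simpa using hK.lt_top⟩
  have h1m : MemLp (fun _ : ℝ => (1 : ℂ)) 2 (volume.restrict K) := memLp_const 1
  have hn : MemLp (fun x => (‖f x‖ : ℂ)) 2 (volume.restrict K) := hm.norm.ofReal
  have key := norm_inner_le_norm (𝕜 := ℂ) (h1m.toLp _) (hn.toLp _)
  have e1 : ⟪h1m.toLp _, hn.toLp _⟫_ℂ = ((∫ x in K, ‖f x‖ : ℝ) : ℂ) := by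
    rw [L2.inner_def, ← integral_complex_ofReal]
    refine integral_congr_ae ?_
    filter_upwards [h1m.coeFn_toLp, hn.coeFn_toLp] with x hx hx'
    rw [hx, hx']
    simp
  have e2 : ‖h1m.toLp _‖ = √(volume.real K) := by
    rw [← Real.sqrt_sq (norm_nonneg _), norm_toLp_two_sq]
    simp
  have e3 : ‖hn.toLp _‖ = √(∫ x in K, ‖f x‖ ^ 2) := by
    rw [← Real.sqrt_sq (norm_nonneg _), norm_toLp_two_sq]
    simp only [Complex.norm_real, norm_norm]
  rw [e1, Complex.norm_real, Real.norm_eq_abs, e2, e3] at key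
  exact (le_abs_self _).trans key

lemma Represents.setIntegral_norm_le {f : G.L2} (h : G.Represents u f) (e : ℰ) {K : Set ℝ}
    (hK : IsCompact K) (hKI : K ⊆ G.I e) :
    ∫ x in K, ‖u e x‖ ≤ √(volume.real K) * ‖f‖ := by
  have hm : MemLp (u e) 2 (volume.restrict K) := (h.memLp e).mono_measure
    (Measure.restrict_mono_set volume hKI)
  refine (setIntegral_norm_le_sqrt hK.measure_lt_top.ne hm).trans ?_
  gcongr
  refine Real.sqrt_le_iff.mpr ⟨norm_nonneg _, ?_⟩
  refine le_trans ?_ (pow_le_pow_left₀ (norm_nonneg _)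
    (lp.norm_apply_le_norm (by norm_num) f e) 2)
  rw [h.norm_sq_apply]
  exact setIntegral_mono_set ((memLp_two_iff_integrable_sq_norm (h.memLp e).1).mp (h.memLp e))
    (Eventually.of_forall fun x => by positivity) hKI.eventuallyLE

/-- On a compact part of an edge A is bounded, so u' = i(D_A u + A u) is bounded in L¹ by the L²
norms of D_A u and u, uniformly in u. -/
lemma exists_setIntegral_norm_le (hA : ∀ e, ContinuousOn (A e) (G.I e)) (e : ℰ) {K : Set ℝ}
    (hK : IsCompact K) (hKI : K ⊆ G.I e) : ∃ C : ℝ, 0 ≤ C ∧ ∀ (u p : ℰ → ℝ → ℂ) (f g : G.L2),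
      G.Represents p f → G.Represents u g →
      ∫ x in K, ‖Complex.I * (p e x + A e x * u e x)‖ ≤ C * (‖f‖ + ‖g‖) := by
  obtain ⟨M, hM⟩ := hK.exists_bound_of_continuousOn ((hA e).mono hKI)
  refine ⟨√(volume.real K) * (1 + |M|), by positivity, fun u p f g hp hu => ?_⟩
  have hfin : IsFiniteMeasure (volume.restrict K) := ⟨by simpa using hK.measure_lt_top⟩
  have hint : ∀ {w : ℰ → ℝ → ℂ} {k : G.L2}, G.Represents w k → IntegrableOn (w e) K :=
    fun {w k} hw => ((hw.memLp e).mono_measure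
      (Measure.restrict_mono_set volume hKI)).integrable (by norm_num)
  have hip := (hint hp).norm
  have hiu := (hint hu).norm.const_mul |M|
  calc ∫ x in K, ‖Complex.I * (p e x + A e x * u e x)‖
      ≤ ∫ x in K, (‖p e x‖ + |M| * ‖u e x‖) := by
        refine integral_mono_of_nonneg (Eventually.of_forall fun x => norm_nonneg _)
          (hip.add hiu) ?_
        filter_upwards [ae_restrict_mem hK.measurableSet] with x hx
        rw [norm_mul, Complex.norm_I, one_mul]
        refine (norm_add_le _ _).trans ?_
        rw [norm_mul, Complex.norm_real]
        gcongr
        exact (hM x hx).trans (le_abs_self M)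
    _ = (∫ x in K, ‖p e x‖) + |M| * ∫ x in K, ‖u e x‖ := by
        rw [integral_add hip hiu, integral_const_mul]
    _ ≤ √(volume.real K) * ‖f‖ + |M| * (√(volume.real K) * ‖g‖) := by
        gcongr
        · exact hp.setIntegral_norm_le e hK hKI
        · exact hu.setIntegral_norm_le e hK hKI
    _ ≤ √(volume.real K) * (1 + |M|) * (‖f‖ + ‖g‖) := by
        have h1 : 0 ≤ √(volume.real K) * ‖g‖ := by positivity
        have h2 : 0 ≤ |M| * (√(volume.real K) * ‖f‖) := by positivity
        linarith

lemma norm_intervalIntegral_le_setIntegral_uIcc {F : ℝ → ℂ} {a b x t : ℝ} (hx : x ∈ uIcc a b)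
    (ht : t ∈ uIcc a b) (hF : IntegrableOn F (uIcc a b)) :
    ‖∫ s in x..t, F s‖ ≤ ∫ s in uIcc a b, ‖F s‖ := by
  refine intervalIntegral.norm_integral_le_integral_norm_uIoc.trans ?_
  exact setIntegral_mono_set hF.norm (Eventually.of_forall fun _ => norm_nonneg _)
    (uIoc_subset_uIcc.trans (uIcc_subset_uIcc hx ht)).eventuallyLE

/-- Evaluation at a point is bounded with respect to the graph norm of `D_A`. -/
lemma exists_norm_apply_le (hA : ∀ e, ContinuousOn (A e) (G.I e)) {e : ℰ} {x : ℝ}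
    (hx : x ∈ G.I e) : ∃ C : ℝ, 0 ≤ C ∧ ∀ (u p : ℰ → ℝ → ℂ) (f g : G.L2),
      G.MagPrimitive A u p → G.Represents p f → G.Represents u g →
      ‖u e x‖ ≤ C * (‖f‖ + ‖g‖) := by
  -- A second point of the edge gives a segment of positive length over which to average.
  obtain ⟨z, hz, hzx⟩ : ∃ z ∈ G.I e, z ≠ x := by
    by_contra! hcon
    have h0 := hcon 0 (G.zero_mem_I e)
    by_cases h : G.length e = ⊤
    · have := hcon 1 (by rw [I_eq_Ici h]; exact mem_Ici.mpr zero_le_one)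
      linarith
    · have := hcon (G.length e).toReal
        (by rw [I_eq_Icc h]; exact right_mem_Icc.mpr ENNReal.toReal_nonneg)
      linarith [toReal_length_pos h]
  have hKI := (G.ordConnected_I e).uIcc_subset hx hz
  obtain ⟨C, hC, hCb⟩ := exists_setIntegral_norm_le hA e isCompact_uIcc hKI
  set m := volume.real (uIcc x z) with hm
  have hmpos : 0 < m := by
    rw [hm, Measure.real, Real.volume_interval, ENNReal.toReal_ofReal (abs_nonneg _)]
    exact abs_pos.mpr (sub_ne_zero.mpr hzx)
  refine ⟨√m / m + C, by positivity, fun u p f g h hp hu => ?_⟩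
  have hint : IntegrableOn (fun s => Complex.I * (p e s + A e s * u e s)) (uIcc x z) :=
    (h e).1.integrableOn_compact_subset hKI isCompact_uIcc
  -- The value at `x` is compared with the value at every `t` of the segment; averaging over `t`
  -- replaces |u(t)| by an L² norm.
  have hpt : ∀ t ∈ uIcc x z, ‖u e x‖ ≤ ‖u e t‖ + C * (‖f‖ + ‖g‖) := fun t ht => by
    have h1 := (h e).2 x hx t (hKI ht)
    have h2 := (norm_intervalIntegral_le_setIntegral_uIcc left_mem_uIcc ht hint).trans
      (hCb u p f g hp hu)
    rw [← h1] at h2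
    have h3 := norm_sub_norm_le (u e x) (u e t)
    rw [norm_sub_rev] at h3
    linarith
  have hui : IntegrableOn (fun t => ‖u e t‖) (uIcc x z) :=
    (((h.continuousOn e).mono hKI).integrableOn_compact isCompact_uIcc).norm
  have hfin : volume (uIcc x z) ≠ ⊤ := isCompact_uIcc.measure_lt_top.ne
  have h4 : ∫ _ in uIcc x z, ‖u e x‖ ≤ ∫ t in uIcc x z, (‖u e t‖ + C * (‖f‖ + ‖g‖)) :=
    setIntegral_mono_on (integrableOn_const hfin) (hui.add (integrableOn_const hfin))
      measurableSet_uIcc hpt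
  rw [integral_add hui (integrableOn_const hfin), setIntegral_const, setIntegral_const,
    smul_eq_mul, smul_eq_mul, ← hm] at h4
  have h5 := hu.setIntegral_norm_le e isCompact_uIcc hKI
  rw [← hm] at h5
  have h6 : m * ‖u e x‖ ≤ m * ((√m / m + C) * (‖f‖ + ‖g‖)) := by
    have h7 : m * ((√m / m + C) * (‖f‖ + ‖g‖)) =
        √m * (‖f‖ + ‖g‖) + m * (C * (‖f‖ + ‖g‖)) := by
      field_simp
    rw [h7]
    have h8 : 0 ≤ √m * ‖f‖ := by positivity
    linarith
  exact le_of_mul_le_mul_left h6 hmpos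

/-- Convergence in L² gives a subsequence converging almost everywhere, and its limit must be the
pointwise one. -/
lemma ae_eq_of_tendsto {w : ℕ → ℰ → ℝ → ℂ} {k : ℕ → G.L2} {f : G.L2} {e : ℰ} {W : ℝ → ℂ}
    (hk : Tendsto k atTop (𝓝 f)) (hw : ∀ n, G.Represents (w n) (k n))
    (hW : ∀ x ∈ G.I e, Tendsto (fun n => w n e x) atTop (𝓝 (W x))) :
    f e =ᵐ[volume.restrict (G.I e)] W := by
  have h1 : Tendsto (fun n => k n e) atTop (𝓝 (f e)) := by
    rw [tendsto_iff_norm_sub_tendsto_zero] at hk ⊢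
    refine squeeze_zero (fun _ => norm_nonneg _) (fun n => ?_) hk
    exact lp.norm_apply_le_norm (by norm_num) (k n - f) e
  obtain ⟨ns, hns, hlim⟩ := (tendstoInMeasure_of_tendsto_Lp h1).exists_seq_tendsto_ae
  filter_upwards [hlim, ae_all_iff.mpr fun n => hw n e, ae_restrict_mem (G.measurableSet_I e)]
    with x hx hxw hxI
  refine tendsto_nhds_unique hx (((hW x hxI).comp hns.tendsto_atTop).congr fun n => ?_)
  exact (hxw (ns n)).symm

/-- Since point evaluations are bounded, the continuous representatives converge at every point. The
integral identities and the equalities at the vertices pass to the limit, and the former give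
continuity of the limit. -/
lemma isClosed_energySpace (hA : ∀ e, ContinuousOn (A e) (G.I e)) :
    IsClosed (G.energySpace A V : Set (PiLp 2 fun _ : Fin 3 => G.L2)) := by
  refine IsSeqClosed.isClosed fun y z hy hz => ?_
  choose u p h1 h2 h3 h4 h5 using hy
  have hlim : ∀ i, Tendsto (fun n => y n i) atTop (𝓝 (z i)) := fun i =>
    ((PiLp.continuous_apply 2 _ i).tendsto z).comp hz
  have hcauchy : ∀ e, ∀ x ∈ G.I e, ∃ c, Tendsto (fun n => u n e x) atTop (𝓝 c) := by
    intro e x hx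
    obtain ⟨C, hC, hCb⟩ := exists_norm_apply_le hA hx
    refine cauchySeq_tendsto_of_complete (Metric.cauchySeq_iff.mpr fun ε hε => ?_)
    obtain ⟨N, hN⟩ := Metric.cauchySeq_iff.mp hz.cauchySeq (ε / (2 * C + 1)) (by positivity)
    refine ⟨N, fun m hm n hn => ?_⟩
    have h6 := hN m hm n hn
    rw [dist_eq_norm, lt_div_iff₀ (by positivity)] at h6
    rw [dist_eq_norm]
    have h7 := hCb _ _ _ _ ((h2 m).sub (h2 n)) ((h3 m).sub (h3 n)) ((h5 m).sub (h5 n))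
    have h8 : ∀ i, ‖y m i - y n i‖ ≤ ‖y m - y n‖ := fun i => PiLp.norm_apply_le (y m - y n) i
    calc _ ≤ _ := h7
      _ ≤ C * (‖y m - y n‖ + ‖y m - y n‖) := by gcongr <;> apply h8
      _ ≤ ‖y m - y n‖ * (2 * C + 1) := by linarith [norm_nonneg (y m - y n)]
      _ < ε := h6
  choose! U hU using hcauchy
  have hUrep : G.Represents U (z 2) := fun e => ae_eq_of_tendsto (hlim 2) h5 (hU e)
  have hprep : G.Represents (fun e x => z 0 e x) (z 0) := fun e => EventuallyEq.rfl
  have hfrep : G.Represents (fun e x => z 2 e x) (z 2) := fun e => EventuallyEq.rfl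
  -- The L² limit `z 2` stands under the integral, because the L¹ bound applies to it directly; it
  -- is exchanged for `U` almost everywhere afterwards.
  have hprim' : ∀ e, IsPrimitiveOn (G.I e) (U e)
      fun x => Complex.I * (z 0 e x + A e x * z 2 e x) := by
    intro e
    have hloc : LocallyIntegrableOn
        (fun x => Complex.I * (z 0 e x + A e x * z 2 e x)) (G.I e) :=
      ((hprep.memLp e).locallyIntegrableOn_of_restrict.add
        ((hfrep.memLp e).locallyIntegrableOn_of_restrict.continuousOn_mul (hA e).ofReal
          (G.isLocallyClosed_I e))).continuousOn_mul continuousOn_const (G.isLocallyClosed_I e)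
    refine ⟨hloc, fun x hx t ht => ?_⟩
    have hKI := (G.ordConnected_I e).uIcc_subset hx ht
    obtain ⟨C, hC, hCb⟩ := exists_setIntegral_norm_le hA e isCompact_uIcc hKI
    refine tendsto_nhds_unique ((hU e t ht).sub (hU e x hx)) ?_
    rw [tendsto_iff_norm_sub_tendsto_zero]
    have h0 : Tendsto (fun n => C * (‖y n 0 - z 0‖ + ‖y n 2 - z 2‖)) atTop (𝓝 0) := by
      have := ((tendsto_iff_norm_sub_tendsto_zero.mp (hlim 0)).add
        (tendsto_iff_norm_sub_tendsto_zero.mp (hlim 2))).const_mul C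
      simpa using this
    refine squeeze_zero (fun _ => norm_nonneg _) (fun n => ?_) h0
    have h6 := hCb _ _ _ _ ((h3 n).sub hprep) ((h5 n).sub hfrep)
    rw [(h2 n e).2 x hx t ht, ← intervalIntegral.integral_sub
      ((h2 n e).1.intervalIntegrable_of_mem (G.ordConnected_I e) hx ht)
      (hloc.intervalIntegrable_of_mem (G.ordConnected_I e) hx ht)]
    have hEq : ∀ s, Complex.I * (p n e s + A e s * u n e s) -
        Complex.I * (z 0 e s + A e s * z 2 e s) =
        Complex.I * ((p n e s - z 0 e s) + A e s * (u n e s - z 2 e s)) := fun s => by ring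
    refine le_trans (norm_intervalIntegral_le_setIntegral_uIcc left_mem_uIcc right_mem_uIcc
      ?_) (le_trans (le_of_eq ?_) h6)
    · exact ((h2 n e).1.sub hloc).integrableOn_compact_subset hKI isCompact_uIcc
    · simp only [hEq]
  have hprim : G.MagPrimitive A U fun e x => z 0 e x := fun e => by
    refine (hprim' e).congr_ae (G.ordConnected_I e) (G.measurableSet_I e) ?_
    filter_upwards [hUrep e] with x hx
    rw [hx]
  refine ⟨U, fun e x => z 0 e x, ⟨hprim.continuousOn, fun a b hab => ?_⟩, hprim, hprep,
    fun e => ae_eq_of_tendsto (hlim 1) h4 fun x hx => (hU e x hx).const_mul _, hUrep⟩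
  refine tendsto_nhds_unique (hU _ _ a.pos_mem_I) ?_
  simp only [fun n => (h1 n).2 a b hab]
  exact hU _ _ b.pos_mem_I

/-- The embedding of the energy space into `L²`. -/
noncomputable def energyEmbedding (G : MetricGraph 𝒱 ℰ) (A V : ℰ → ℝ → ℝ) :
    G.energySpace A V →L[ℂ] G.L2 :=
  (PiLp.proj 2 (fun _ : Fin 3 => G.L2) 2 : (PiLp 2 fun _ : Fin 3 => G.L2) →L[ℂ] G.L2) ∘L
    (G.energySpace A V).subtypeL

lemma energyEmbedding_apply (y : G.energySpace A V) :
    G.energyEmbedding A V y = (y : PiLp 2 fun _ : Fin 3 => G.L2) 2 :=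
  rfl

lemma energyEmbedding_injective : Function.Injective (G.energyEmbedding A V) :=
  fun y z h => Subtype.ext (energySpace_ext y.2 z.2 h)

end MetricGraph

namespace MetricGraph

variable {𝒱 ℰ : Type*} {G : MetricGraph 𝒱 ℰ}

/-! ### Functions with compact support -/

variable {A V : ℰ → ℝ → ℝ} {u v p q P R : ℰ → ℝ → ℂ} {F : Finset ℰ} {L : ℝ}

lemma HasCompactSupp.memL2 (h : G.HasCompactSupp u F L)
    (hu : ∀ e, ContinuousOn (u e) (G.I e)) : G.MemL2 u := by
  refine ⟨fun e => ?_, summable_of_ne_finset_zero (s := F) fun e he => ?_⟩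
  · rw [memLp_two_iff_integrable_sq_norm ((hu e).aestronglyMeasurable (G.measurableSet_I e))]
    have hK : IsCompact (G.I e ∩ Icc 0 L) := isCompact_Icc.inter_left (G.isClosed_I e)
    have h1 : IntegrableOn (fun x => ‖u e x‖ ^ 2) (G.I e ∩ Icc 0 L) :=
      (((hu e).mono inter_subset_left).norm.pow 2).integrableOn_compact hK
    refine h1.of_forall_sdiff_eq_zero (G.measurableSet_I e) fun x hx => ?_
    by_contra hcon
    have hne : u e x ≠ 0 := fun h0 => hcon (by simp [h0])
    exact hx.2 ⟨hx.1, hx.1.1, (h e x hx.1 hne).2⟩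
  · refine setIntegral_eq_zero_of_forall_eq_zero fun x hx => ?_
    have : u e x = 0 := by
      by_contra hne
      exact he (h e x hx hne).1
    simp [this]

lemma HasCompactSupp.mono {F' : Finset ℰ} {L' : ℝ} (h : G.HasCompactSupp u F L) (hF : F ⊆ F')
    (hL : L ≤ L') : G.HasCompactSupp u F' L' := fun e x hx hne =>
  ⟨hF (h e x hx hne).1, (h e x hx hne).2.trans hL⟩

lemma HasCompactSupp.of_eq_zero (h : G.HasCompactSupp u F L)
    (hv : ∀ e, ∀ x ∈ G.I e, u e x = 0 → v e x = 0) : G.HasCompactSupp v F L :=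
  fun e x hx hne => h e x hx fun h0 => hne (hv e x hx h0)

lemma HasCompactSupp.add (h : G.HasCompactSupp u F L) (h' : G.HasCompactSupp v F L) :
    G.HasCompactSupp (fun e x => u e x + v e x) F L := fun e x hx hne => by
  by_cases hu : u e x = 0
  · exact h' e x hx fun hv => hne (by simp [hu, hv])
  · exact h e x hx hu

/-- At a point of a closed edge outside F, or beyond L, the function vanishes on a whole relative
neighbourhood in the edge. -/
lemma HasCompactSupp.derivWithin (h : G.HasCompactSupp u F L) :
    G.HasCompactSupp (fun e => derivWithin (u e) (G.I e)) F L := by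
  intro e x hx hne
  by_contra hcon
  apply hne
  have hev : u e =ᶠ[𝓝[G.I e] x] fun _ => 0 := by
    by_cases he : e ∈ F
    · have hxL : L < x := not_le.mp fun hxL => hcon ⟨he, hxL⟩
      filter_upwards [self_mem_nhdsWithin, mem_nhdsWithin_of_mem_nhds (Ioi_mem_nhds hxL)]
        with y hy hyL
      by_contra hy0
      exact absurd (h e y hy hy0).2 (not_le.mpr hyL)
    · filter_upwards [self_mem_nhdsWithin] with y hy
      by_contra hy0
      exact he (h e y hy hy0).1
  show _root_.derivWithin (u e) (G.I e) x = 0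
  rw [hev.derivWithin_eq (hev.self_of_nhdsWithin hx)]
  simp

lemma isPrimitiveOn_derivWithin {f : ℝ → ℂ} {e : ℰ} (hf : ContDiffOn ℝ 1 f (G.I e)) :
    IsPrimitiveOn (G.I e) f (derivWithin f (G.I e)) := by
  refine isPrimitiveOn_of_hasDerivAt (G.ordConnected_I e) hf.continuousOn
    (hf.continuousOn_derivWithin (G.uniqueDiffOn_I e) le_rfl) fun x hx => ?_
  rw [interior_I] at hx
  exact ((hf.differentiableOn (by norm_num)) x
    (G.openI_subset_I e hx)).hasDerivWithinAt.hasDerivAt (I_mem_nhds hx)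

/-! ### Green's formula -/

/-- In the derivative of P v̄ the terms with A cancel, since A is real, and i(R v̄ - P q̄) remains;
this explains the factor -i. On a half-line the contribution at infinity is zero by `hP`. -/
lemma integral_green_edge {e : ℰ} (hu : G.MagPrimitive A P R) (hv : G.MagPrimitive A v q)
    (hint : IntegrableOn (fun x => R e x * conj (v e x) - P e x * conj (q e x)) (G.I e))
    (hP : G.length e = ⊤ → ∀ᶠ x in atTop, P e x = 0) :
    ∫ x in G.I e, (R e x * conj (v e x) - P e x * conj (q e x)) =
      -Complex.I * ((open Classical in if G.length e = ⊤ then 0 else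
        P e (G.length e).toReal * conj (v e (G.length e).toReal)) - P e 0 * conj (v e 0)) := by
  have hprim := (hu e).mul (G.ordConnected_I e) (G.isLocallyClosed_I e) (hv e).conj
  have key : ∀ M ∈ G.I e, ∫ x in (0 : ℝ)..M, (R e x * conj (v e x) - P e x * conj (q e x)) =
      -Complex.I * (P e M * conj (v e M) - P e 0 * conj (v e 0)) := by
    intro M hM
    have h1 := hprim.2 0 (G.zero_mem_I e) M hM
    simp only at h1
    rw [h1, ← intervalIntegral.integral_const_mul]
    congr 1
    ext x
    simp only [map_mul, map_add, Complex.conj_I, Complex.conj_ofReal]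
    linear_combination (R e x * conj (v e x) - P e x * conj (q e x)) * Complex.I_mul_I
  by_cases h : G.length e = ⊤
  · rw [if_pos h]
    rw [I_eq_Ici h] at hint ⊢
    rw [integral_Ici_eq_integral_Ioi]
    refine tendsto_nhds_unique (intervalIntegral_tendsto_integral_Ioi 0
      (hint.mono_set Ioi_subset_Ici_self) tendsto_id) (tendsto_const_nhds.congr' ?_)
    filter_upwards [hP h, eventually_ge_atTop 0] with M hM hM0
    rw [id, key M (by rw [I_eq_Ici h]; exact hM0), hM, zero_mul]
  · rw [if_neg h, ← key _ (by
      rw [I_eq_Icc h]; exact right_mem_Icc.mpr ENNReal.toReal_nonneg), I_eq_Icc h,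
      integral_Icc_eq_integral_Ioc, intervalIntegral.integral_of_le ENNReal.toReal_nonneg]

lemma sum_edgeEnd_of_edge (F : Finset ℰ) (t : G.EdgeEnd → ℂ) :
    ∑ a ∈ (EdgeEnd.finite_of_edge (G := G) F).toFinset, t a =
      ∑ e ∈ F, (t (.source e) + (open Classical in
        if h : G.length e = ⊤ then 0 else t (.target e h))) := by
  classical
  rw [← Finset.sum_fiberwise_of_maps_to (t := F) (g := EdgeEnd.edge)
    (fun a ha => by simpa using ha)]
  refine Finset.sum_congr rfl fun e he => ?_
  have hmem : ∀ a, a ∈ (EdgeEnd.finite_of_edge (G := G) F).toFinset.filter (fun a => a.edge = e) ↔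
      a.edge = e := fun a => by
    rw [Finset.mem_filter, Finite.mem_toFinset]
    exact ⟨fun h => h.2, fun h => ⟨by rw [mem_ofPred_eq, h]; exact he, h⟩⟩
  by_cases h : G.length e = ⊤
  · have : (EdgeEnd.finite_of_edge (G := G) F).toFinset.filter (fun a => a.edge = e) =
        {.source e} := by
      ext a
      rw [hmem, Finset.mem_singleton]
      cases a with
      | source e' => simp [EdgeEnd.edge]
      | target e' h' =>
        simp only [EdgeEnd.edge, reduceCtorEq, iff_false]
        rintro rfl
        exact h' h
    rw [this, Finset.sum_singleton, dif_pos h, add_zero]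
  · have : (EdgeEnd.finite_of_edge (G := G) F).toFinset.filter (fun a => a.edge = e) =
        {.source e, .target e h} := by
      ext a
      rw [hmem, Finset.mem_insert, Finset.mem_singleton]
      cases a <;> simp [EdgeEnd.edge]
    rw [this, Finset.sum_pair (by simp), dif_neg h]

/-- Within the ends at one vertex c is constant and factors out. What remains is the full vertex sum
of t, as Z contains every end at which t is non-zero. -/
lemma sum_edgeEnd_mul_eq_zero {Z : Finset G.EdgeEnd} {t c : G.EdgeEnd → ℂ}
    (ht : ∀ a, t a ≠ 0 → a ∈ Z)
    (hK : ∀ w : 𝒱, ∑ᶠ a : {a : G.EdgeEnd // a.vertex = w}, t a = 0)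
    (hc : ∀ a b : G.EdgeEnd, a.vertex = b.vertex → c a = c b) : ∑ a ∈ Z, t a * c a = 0 := by
  classical
  rw [← Finset.sum_fiberwise_of_maps_to (t := Z.image EdgeEnd.vertex) (g := EdgeEnd.vertex)
    (fun a ha => Finset.mem_image_of_mem _ ha)]
  refine Finset.sum_eq_zero fun w hw => ?_
  obtain ⟨b, hb, rfl⟩ := Finset.mem_image.mp hw
  have h1 : ∑ a ∈ Z with a.vertex = b.vertex, t a * c a =
      (∑ a ∈ Z with a.vertex = b.vertex, t a) * c b := by
    rw [Finset.sum_mul]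
    refine Finset.sum_congr rfl fun a ha => ?_
    rw [hc a b (Finset.mem_filter.mp ha).2]
  rw [h1, ← Finset.sum_subtype_eq_sum_filter, ← finsum_eq_sum_of_support_subset, hK, zero_mul]
  intro a ha
  simpa using ht a ha

/-- Green's formula for a function with compact support that satisfies the Kirchhoff conditions. -/
lemma inner_eq_inner_of_kirchhoff {f g h k : G.L2} (hP : G.MagPrimitive A P R)
    (hv : G.MagPrimitive A v q) (hPc : G.HasCompactSupp P F L) (hvc : G.IsCont v)
    (hK : ∀ w : 𝒱, ∑ᶠ a : {a : G.EdgeEnd // a.vertex = w},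
      (a.1.sign : ℂ) * P a.1.edge a.1.pos = 0)
    (hPf : G.Represents P f) (hRg : G.Represents R g) (hvh : G.Represents v h)
    (hqk : G.Represents q k) : ⟪k, f⟫_ℂ = ⟪h, g⟫_ℂ := by
  classical
  have hs := (hRg.hasSum_inner hvh).sub (hPf.hasSum_inner hqk)
  have hterm : ∀ e, (∫ x in G.I e, R e x * conj (v e x)) - ∫ x in G.I e, P e x * conj (q e x) =
      -Complex.I * ((open Classical in if G.length e = ⊤ then 0 else
        P e (G.length e).toReal * conj (v e (G.length e).toReal)) - P e 0 * conj (v e 0)) := by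
    intro e
    have i1 := hRg.integrable_mul_conj hvh e
    have i2 := hPf.integrable_mul_conj hqk e
    rw [← integral_sub i1 i2]
    refine integral_green_edge hP hv (i1.sub i2) fun htop => ?_
    filter_upwards [eventually_gt_atTop L, eventually_ge_atTop 0] with x hx hx0
    by_contra hne
    exact absurd (hPc e x (by rw [I_eq_Ici htop]; exact hx0) hne).2 (not_le.mpr hx)
  simp only [hterm] at hs
  have hzero : ∀ e ∉ F, ∀ x ∈ G.I e, P e x = 0 := fun e he x hx => by
    by_contra hne
    exact he (hPc e x hx hne).1
  have hmem : ∀ e, G.length e ≠ ⊤ → (G.length e).toReal ∈ G.I e := fun e h => by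
    rw [I_eq_Icc h]; exact right_mem_Icc.mpr ENNReal.toReal_nonneg
  have hs' := hasSum_sum_of_ne_finset_zero (L := SummationFilter.unconditional ℰ)
    (f := fun e => -Complex.I * ((if G.length e = ⊤ then 0 else
        P e (G.length e).toReal * conj (v e (G.length e).toReal)) - P e 0 * conj (v e 0)))
    (s := F) (fun e he => by
      rw [hzero e he 0 (G.zero_mem_I e)]
      split_ifs with h
      · simp
      · rw [hzero e he _ (hmem e h)]
        simp)
  -- The boundary terms of the edges, with the inward signs, are the terms `sign * P * conj v` of
  -- the edge ends; summed by vertices they vanish.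
  have hsum : ∑ e ∈ F, -Complex.I * ((if G.length e = ⊤ then 0 else
        P e (G.length e).toReal * conj (v e (G.length e).toReal)) - P e 0 * conj (v e 0)) = 0 := by
    have h1 := sum_edgeEnd_mul_eq_zero (G := G)
      (Z := (EdgeEnd.finite_of_edge (G := G) F).toFinset)
      (t := fun a => (a.sign : ℂ) * P a.edge a.pos) (c := fun a => conj (v a.edge a.pos))
      (fun a ha => by
        rw [Finite.mem_toFinset]
        exact (hPc a.edge a.pos a.pos_mem_I (right_ne_zero_of_mul ha)).1) hK
      (fun a b hab => by rw [hvc.2 a b hab])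
    rw [sum_edgeEnd_of_edge] at h1
    rw [← Finset.mul_sum, mul_eq_zero]
    right
    rw [← neg_eq_zero, ← Finset.sum_neg_distrib]
    refine Eq.trans (Finset.sum_congr rfl fun e _ => ?_) h1
    simp only [EdgeEnd.sign, EdgeEnd.edge, EdgeEnd.pos]
    split_ifs <;> push_cast <;> ring
  rw [hsum] at hs'
  exact (sub_eq_zero.mp (hs.unique hs')).symm

/-! ### The domain of the magnetic Schrödinger operator -/

/-- The magnetic derivative of a function that is continuously differentiable on every edge. -/
noncomputable def classicalMagD (G : MetricGraph 𝒱 ℰ) (A : ℰ → ℝ → ℝ) (u : ℰ → ℝ → ℂ) :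
    ℰ → ℝ → ℂ :=
  fun e x => 1 / Complex.I * derivWithin (u e) (G.I e) x - A e x * u e x

lemma continuousOn_classicalMagD (hA : ∀ e, ContinuousOn (A e) (G.I e))
    (hu : ∀ e, ContDiffOn ℝ 1 (u e) (G.I e)) (e : ℰ) :
    ContinuousOn (G.classicalMagD A u e) (G.I e) :=
  (continuousOn_const.mul ((hu e).continuousOn_derivWithin (G.uniqueDiffOn_I e) le_rfl)).sub
    ((hA e).ofReal.mul (hu e).continuousOn)

lemma magPrimitive_classicalMagD (hu : ∀ e, ContDiffOn ℝ 1 (u e) (G.I e)) :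
    G.MagPrimitive A u (G.classicalMagD A u) := fun e => by
  convert isPrimitiveOn_derivWithin (hu e) using 2 with x
  rw [classicalMagD]
  field_simp
  ring

lemma HasCompactSupp.classicalMagD (h : G.HasCompactSupp u F L) :
    G.HasCompactSupp (G.classicalMagD A u) F L := by
  have := ((h.derivWithin).of_eq_zero (v := fun e x => 1 / Complex.I *
    _root_.derivWithin (u e) (G.I e) x) (fun e x _ h0 => by rw [h0, mul_zero])).add
    (h.of_eq_zero (v := fun e x => -(A e x * u e x)) (fun e x _ h0 => by simp [h0]))
  simp only [← sub_eq_add_neg] at this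
  exact this

/-- Differentiating D_A u = (1/i)u' - A u once more gives D_A² u = -u'' + i(A'u + A u') - A D_A u.
Here u'' is in L² by assumption, and the other terms are continuous with compact support. -/
lemma MemH2c.exists_magPrimitive (hA : ∀ e, ContDiffOn ℝ 1 (A e) (G.I e))
    (hfin : G.LocallyFinite) (hu : G.MemH2c A u) :
    ∃ R, G.MagPrimitive A (G.classicalMagD A u) R ∧ G.MemL2 R := by
  obtain ⟨hcont, hsupp, hdiff, ⟨w, hw, hwL2⟩, -⟩ := hu
  obtain ⟨F, L, hFL⟩ := hsupp.hasCompactSupp hfin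
  have hAc : ∀ e, ContDiffOn ℝ 1 (fun x => (A e x : ℂ)) (G.I e) := fun e =>
    Complex.ofRealCLM.contDiff.comp_contDiffOn (hA e)
  have hd : ∀ e, ContinuousOn (derivWithin (u e) (G.I e)) (G.I e) := fun e =>
    (hdiff e).continuousOn_derivWithin (G.uniqueDiffOn_I e) le_rfl
  have hAd : ∀ e, ContinuousOn (derivWithin (fun x => (A e x : ℂ)) (G.I e)) (G.I e) := fun e =>
    (hAc e).continuousOn_derivWithin (G.uniqueDiffOn_I e) le_rfl
  have hP := continuousOn_classicalMagD (fun e => (hA e).continuousOn) hdiff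
  have hw' : ∀ e, IsPrimitiveOn (G.I e) (derivWithin (u e) (G.I e)) (w e) := fun e =>
    IsPrimitiveOn.of_subset_closure (G.ordConnected_I e) (G.openI_subset_I e)
      (G.closure_openI e).ge (hd e) (hwL2.1 e).locallyIntegrableOn_of_restrict
      ((hw e).isPrimitiveOn (G.ordConnected_openI e) (G.isOpen_openI e)
        ((hd e).mono (G.openI_subset_I e)))
  set k : ℰ → ℝ → ℂ := fun e x => Complex.I * (derivWithin (fun x => (A e x : ℂ)) (G.I e) x * u e x
    + A e x * derivWithin (u e) (G.I e) x) - A e x * G.classicalMagD A u e x with hk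
  have hkL2 : G.MemL2 k := by
    have hkc : G.HasCompactSupp k F L := by
      have h1 := hFL.of_eq_zero (v := fun e x => Complex.I *
        (derivWithin (fun x => (A e x : ℂ)) (G.I e) x * u e x)) (fun e x _ h0 => by simp [h0])
      have h2 := hFL.derivWithin.of_eq_zero (v := fun e x => Complex.I *
        (A e x * derivWithin (u e) (G.I e) x)) (fun e x _ h0 => by simp only [h0, mul_zero])
      have h3 := (hFL.classicalMagD (A := A)).of_eq_zero (v := fun e x =>
        -(A e x * G.classicalMagD A u e x)) (fun e x _ h0 => by simp [h0])
      have := (h1.add h2).add h3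
      convert this using 3
      rw [hk]
      ring
    refine hkc.memL2 fun e => ?_
    exact (continuousOn_const.mul (((hAd e).mul (hcont.1 e)).add
      ((hAc e).continuousOn.mul (hd e)))).sub ((hAc e).continuousOn.mul (hP e))
  obtain ⟨w₀, hw₀⟩ := hwL2.exists_represents
  obtain ⟨k₀, hk₀⟩ := hkL2.exists_represents
  refine ⟨fun e x => -1 * w e x + k e x, fun e => ?_, ((hw₀.const_smul (-1)).add hk₀).memL2⟩
  have h1 := ((hw' e).const_mul (1 / Complex.I)).add (G.ordConnected_I e)
    (((isPrimitiveOn_derivWithin (hAc e)).mul (G.ordConnected_I e) (G.isLocallyClosed_I e)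
      (isPrimitiveOn_derivWithin (hdiff e))).const_mul (-1))
  convert h1 using 2 with x x
  · rw [classicalMagD]; ring
  · rw [hk]
    simp only [one_div, Complex.inv_I]
    linear_combination (derivWithin (fun x => (A e x : ℂ)) (G.I e) x * u e x
      + A e x * derivWithin (u e) (G.I e) x) * Complex.I_mul_I

/-- The inner magnetic derivative is known only almost everywhere, which does not affect the outer
weak derivative. -/
lemma magD_magD_ae_eq (hP : G.MagPrimitive A u P) (hR : G.MagPrimitive A P R) (e : ℰ) :
    G.magD A (G.magD A u) e =ᵐ[volume.restrict (G.I e)] R e := by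
  have h1 := hP.magD_ae_eq e
  have h2 : HasWeakDeriv (G.openI e) (G.magD A u e)
      fun x => Complex.I * (R e x + A e x * P e x) := by
    refine (hR.hasWeakDeriv e).congr_left ?_
    rw [restrict_openI]
    exact h1.symm
  filter_upwards [magD_ae_eq_of_hasWeakDeriv (A := A) h2, h1] with x hx hx1
  rw [hx, hx1]
  field_simp
  ring

lemma kirchhoff_iff : G.Kirchhoff A u ↔ ∀ w : 𝒱, ∑ᶠ a : {a : G.EdgeEnd // a.vertex = w},
    (a.1.sign : ℂ) * G.classicalMagD A u a.1.edge a.1.pos = 0 := by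
  refine forall_congr' fun w => ?_
  rw [finsum_congr fun a => ?_]
  rw [classicalMagD]
  push_cast
  ring

/-- A function of `H̃²_c` defines an element of the energy space, on which the form is given by
the differential expression. -/
lemma MemH2c.exists_mem_energySpace (hA : ∀ e, ContDiffOn ℝ 1 (A e) (G.I e))
    (hV : ∀ e, ContinuousOn (V e) (G.I e)) (hV1 : ∀ e, ∀ x ∈ G.I e, 1 ≤ V e x)
    (hfin : G.LocallyFinite) (hu : G.MemH2c A u) :
    ∃ y ∈ G.energySpace A V, ∃ g : G.L2, G.Represents u (y 2) ∧
      G.Represents (fun e x => G.magD A (G.magD A u) e x + V e x * u e x) g ∧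
      ∀ z ∈ G.energySpace A V, ⟪z, y⟫_ℂ = ⟪z 2, g⟫_ℂ := by
  obtain ⟨R, hR, hRL2⟩ := hu.exists_magPrimitive hA hfin
  obtain ⟨hcont, hsupp, hdiff, -, hK⟩ := hu
  obtain ⟨F, L, hFL⟩ := hsupp.hasCompactSupp hfin
  have hAc : ∀ e, ContinuousOn (A e) (G.I e) := fun e => (hA e).continuousOn
  have hP := magPrimitive_classicalMagD (A := A) hdiff
  obtain ⟨y0, hy0⟩ := (hFL.classicalMagD (A := A)).memL2
    (continuousOn_classicalMagD hAc hdiff) |>.exists_represents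
  have hW : ∀ e, ContinuousOn (fun x => (√(V e x - 1) : ℂ)) (G.I e) := fun e =>
    (((hV e).sub continuousOn_const).sqrt).ofReal
  obtain ⟨y1, hy1⟩ := ((hFL.of_eq_zero (v := fun e x => (√(V e x - 1) : ℂ) * u e x)
    (fun e x _ h0 => by rw [h0, mul_zero])).memL2
    (fun e => (hW e).mul (hcont.1 e))).exists_represents
  obtain ⟨y2, hy2⟩ := (hFL.memL2 hcont.1).exists_represents
  obtain ⟨g1, hg1⟩ := hRL2.exists_represents
  obtain ⟨g2, hg2⟩ := ((hFL.of_eq_zero (v := fun e x => (V e x : ℂ) * u e x)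
    (fun e x _ h0 => by rw [h0, mul_zero])).memL2
    (fun e => (hV e).ofReal.mul (hcont.1 e))).exists_represents
  refine ⟨WithLp.toLp 2 ![y0, y1, y2], ⟨u, _, hcont, hP, hy0, hy1, hy2⟩, g1 + g2, hy2, ?_, ?_⟩
  · refine (hg1.add hg2).congr fun e => ?_
    filter_upwards [magD_magD_ae_eq hP hR e] with x hx
    rw [hx]
  · rintro z ⟨v, q, hv, hq, hz0, hz1, hz2⟩
    -- Green's formula treats the component D_A u; the other two components together give the
    -- potential term.
    have h1 := inner_eq_inner_of_kirchhoff hR hq hFL.classicalMagD hv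
      (kirchhoff_iff.mp hK) hy0 hg1 hz2 hz0
    have h2 : ⟪z 1, y1⟫_ℂ + ⟪z 2, y2⟫_ℂ = ⟪z 2, g2⟫_ℂ := by
      refine ((hy1.hasSum_inner hz1).add (hy2.hasSum_inner hz2)).unique ?_
      refine (hg2.hasSum_inner hz2).congr_fun fun e => ?_
      rw [← integral_add (hy1.integrable_mul_conj hz1 e) (hy2.integrable_mul_conj hz2 e)]
      refine setIntegral_congr_fun (G.measurableSet_I e) fun x hx => ?_
      have h1 : (√(V e x - 1) : ℂ) * (√(V e x - 1) : ℂ) = V e x - 1 := by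
        rw [← Complex.ofReal_mul, Real.mul_self_sqrt (sub_nonneg.mpr (hV1 e x hx))]
        push_cast; rfl
      simp only [map_mul, Complex.conj_ofReal]
      linear_combination (u e x * conj (v e x)) * h1
    rw [PiLp.inner_apply, Fin.sum_univ_three, inner_add_right, ← h1, ← h2, add_assoc]
    rfl

end MetricGraph

namespace MetricGraph

variable {𝒱 ℰ : Type*} {G : MetricGraph 𝒱 ℰ}

/-! ### Approximation by functions in `H̃²_c` -/

variable {A V : ℰ → ℝ → ℝ} {F : Finset ℰ} {L : ℝ}

lemma EdgeEnd.pos_notMem_openI (a : G.EdgeEnd) : a.pos ∉ G.openI a.edge := by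
  cases a with
  | source e => exact fun h => lt_irrefl _ h.1
  | target e h =>
    intro hx
    have := hx.2
    rw [EdgeEnd.pos, ENNReal.ofReal_toReal h] at this
    exact lt_irrefl _ this

/-- When D_A u vanishes at each edge end separately, the Kirchhoff sums vanish trivially. The second
derivatives are continuous with compact support, hence in L². -/
lemma memH2c_of_contDiffOn (hconn : G.Connected) {u : ℰ → ℝ → ℂ} (hu : G.IsCont u)
    (hc : G.HasCompactSupp u F L) (hd : ∀ e, ContDiffOn ℝ 2 (u e) (G.I e))
    (hK : ∀ a : G.EdgeEnd, G.classicalMagD A u a.edge a.pos = 0) : G.MemH2c A u := by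
  have hd1 : ∀ e, ContDiffOn ℝ 1 (derivWithin (u e) (G.I e)) (G.I e) := fun e =>
    (hd e).derivWithin (G.uniqueDiffOn_I e) (by norm_num)
  refine ⟨hu, hc.hasBddSupport hconn, fun e => (hd e).of_le (by norm_num),
    ⟨fun e => derivWithin (derivWithin (u e) (G.I e)) (G.I e), fun e => ?_, ?_⟩, fun w => ?_⟩
  · exact ((isPrimitiveOn_derivWithin (hd1 e)).mono (G.openI_subset_I e)).hasWeakDeriv
      (G.ordConnected_openI e) (G.isOpen_openI e)
  · exact hc.derivWithin.derivWithin.memL2 fun e =>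
      (hd1 e).continuousOn_derivWithin (G.uniqueDiffOn_I e) le_rfl
  · refine finsum_eq_zero_of_forall_eq_zero fun a => ?_
    have := hK a.1
    rw [classicalMagD] at this
    push_cast
    linear_combination (a.1.sign : ℂ) * this

/-- A gauge function, which removes the magnetic potential on one edge. -/
lemma exists_gauge {e : ℰ} {a : ℝ → ℝ} (ha : ContDiffOn ℝ 1 a (G.I e)) :
    ∃ (θ : ℝ → ℝ) (a' : ℝ → ℝ), θ 0 = 0 ∧ Continuous a' ∧ EqOn a' a (G.I e) ∧
      (∀ x, HasDerivAt θ (a' x) x) ∧ ContDiffOn ℝ 2 θ (G.I e) := by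
  -- A continuous extension of the potential to ℝ makes its primitive differentiable everywhere,
  -- including at the ends of the edge.
  obtain ⟨g, hg⟩ := ContinuousMap.exists_restrict_eq (G.isClosed_I e)
    ⟨(G.I e).domRestrict a, ha.continuousOn.domRestrict⟩
  have hga : EqOn g a (G.I e) := fun x hx => DFunLike.congr_fun hg ⟨x, hx⟩
  have hd : ∀ x, HasDerivAt (fun x => ∫ t in (0 : ℝ)..x, g t) (g x) x := fun x =>
    intervalIntegral.integral_hasDerivAt_right (g.continuous.intervalIntegrable _ _)
      (g.continuous.stronglyMeasurableAtFilter _ _) g.continuous.continuousAt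
  refine ⟨_, g, intervalIntegral.integral_same, g.continuous, hga, hd, ?_⟩
  rw [show (2 : WithTop ℕ∞) = 1 + 1 by norm_num, contDiffOn_succ_iff_derivWithin
    (G.uniqueDiffOn_I e)]
  refine ⟨fun x _ => (hd x).differentiableAt.differentiableWithinAt, by simp, ?_⟩
  refine ha.congr fun x hx => ?_
  rw [(hd x).hasDerivWithinAt.derivWithin (G.uniqueDiffOn_I e x hx), hga hx]

/-- With E = exp(iθ), θ' = a, the function Ē u has the derivative D = iĒ p. Replace D by a test
function g on (0, b) with the same integral, integrate from u(0) to get k, and put v = E k. Equal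
integrals give v(b) = u(b), while D_A v = (1/i) E g vanishes at 0 and b. As |E| = 1, the error of
D_A v is that of g, and the error of v is at most √b ‖D - g‖. The point b is the far end of the edge
or, on a half-line, lies beyond the support. -/
lemma exists_edge_approx_of_pos {e : ℰ} {a : ℝ → ℝ} (ha : ContDiffOn ℝ 1 a (G.I e))
    {u p : ℝ → ℂ} (h : IsPrimitiveOn (G.I e) u fun x => Complex.I * (p x + a x * u x))
    (hp : MemLp p 2 (volume.restrict (G.I e))) {b : ℝ} (hb : 0 < b) (hbI : b ∈ G.I e)
    (hend : ∀ x ∈ G.I e, x ∉ G.openI e → x = 0 ∨ x = b)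
    (hu : ∀ x ∈ G.I e, b < x → u x = 0) (hub : b ∈ G.openI e → u b = 0)
    (hp0 : ∀ x ∈ G.I e, b < x → p x = 0) {ε : ℝ} (hε : 0 < ε) :
    ∃ v : ℝ → ℂ, ContDiffOn ℝ 2 v (G.I e) ∧
      (∀ x ∈ G.I e, x ∉ G.openI e → v x = u x ∧
        1 / Complex.I * derivWithin v (G.I e) x - a x * v x = 0) ∧
      (∀ x ∈ G.I e, b < x → v x = 0) ∧ (∀ x ∈ G.I e, ‖u x - v x‖ ≤ ε) ∧
      ∫ x in G.I e, ‖p x - (1 / Complex.I * derivWithin v (G.I e) x - a x * v x)‖ ^ 2 ≤ ε := by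
  obtain ⟨θ, a', hθ0, ha'c, ha', hθ, hθd⟩ := exists_gauge ha
  set E : ℝ → ℂ := fun x => Complex.exp (Complex.I * θ x) with hE
  have hEd : ∀ x, HasDerivAt E (Complex.I * a' x * E x) x := fun x => by
    have := (((hθ x).ofReal_comp).const_mul Complex.I).cexp
    convert! this using 1
    ring
  have hEn : ∀ x, ‖E x‖ = 1 := fun x => by
    rw [hE]
    simp only
    rw [mul_comm, Complex.norm_exp_ofReal_mul_I]
  have hEconj : ∀ x, E x * conj (E x) = 1 := fun x => by
    rw [Complex.mul_conj, Complex.normSq_eq_norm_sq, hEn]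
    simp
  have hE0 : E 0 = 1 := by simp [hE, hθ0]
  have hEc : Continuous E := continuous_iff_continuousAt.mpr fun x => (hEd x).continuousAt
  have hE2 : ContDiffOn ℝ 2 E (G.I e) := by
    have : ContDiffOn ℝ 2 (fun x => (θ x : ℂ)) (G.I e) :=
      Complex.ofRealCLM.contDiff.comp_contDiffOn hθd
    exact (contDiffOn_const.mul this).cexp
  have hEp : IsPrimitiveOn (G.I e) (fun x => conj (E x))
      (fun x => conj (Complex.I * a' x * E x)) := by
    refine IsPrimitiveOn.conj (isPrimitiveOn_of_hasDerivAt (G.ordConnected_I e)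
      hEc.continuousOn ?_ fun x _ => hEd x)
    exact ((continuous_const.mul (Complex.continuous_ofReal.comp ha'c)).mul hEc).continuousOn
  set D : ℝ → ℂ := fun x => Complex.I * (conj (E x) * p x) with hD
  have hf : IsPrimitiveOn (G.I e) (fun x => conj (E x) * u x) D := by
    refine (hEp.mul (G.ordConnected_I e) (G.isLocallyClosed_I e) h).congr_ae
      (G.ordConnected_I e) (G.measurableSet_I e) ?_
    filter_upwards [ae_restrict_mem (G.measurableSet_I e)] with x hx
    rw [hD, ha' hx]
    simp only [map_mul, Complex.conj_I, Complex.conj_ofReal]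
    ring
  have hsub : Ioo 0 b ⊆ G.I e := Ioo_subset_Icc_self.trans
    ((G.ordConnected_I e).out (G.zero_mem_I e) hbI)
  have hDm : MemLp D 2 (volume.restrict (Ioo 0 b)) := by
    have hpm := hp.mono_measure (Measure.restrict_mono_set volume hsub)
    refine hpm.of_le (((continuous_const.aestronglyMeasurable).mul
      ((Complex.continuous_conj.comp hEc).aestronglyMeasurable.mul hpm.1))) ?_
    refine Eventually.of_forall fun x => ?_
    simp [hD, hEn]
  -- The bound `ε` serves the L² estimate of the derivatives, and `ε ^ 2 / b` the uniform estimate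
  -- after Cauchy–Schwarz on an interval of length `b`.
  set δ : ℝ := min ε (ε ^ 2 / b) with hδ
  have hδpos : 0 < δ := lt_min hε (by positivity)
  obtain ⟨g, hg, hgc, hgs, hgi, hgn⟩ := exists_testFunction_integral_eq hb hDm hδpos
  have hg0 : ∀ x, x ∉ Ioo 0 b → g x = 0 := fun x hx => image_eq_zero_of_notMem_tsupport
    fun h => hx (hgs h)
  have hgint : ∀ x y, IntervalIntegrable g volume x y := fun x y =>
    hg.continuous.intervalIntegrable _ _
  have hDint : ∀ x ∈ G.I e, IntervalIntegrable D volume 0 x := fun x hx =>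
    hf.1.intervalIntegrable_of_mem (G.ordConnected_I e) (G.zero_mem_I e) hx
  set k : ℝ → ℂ := fun x => u 0 + ∫ t in (0 : ℝ)..x, g t with hk
  have hkd : ∀ x, HasDerivAt k (g x) x := fun x =>
    (intervalIntegral.integral_hasDerivAt_right (hgint _ _)
      (hg.continuous.stronglyMeasurableAtFilter _ _) hg.continuous.continuousAt).const_add _
  have hk2 : ContDiff ℝ 2 k := by
    refine contDiff_infty.mp ?_ 2
    refine contDiff_infty_iff_deriv.mpr ⟨fun x => (hkd x).differentiableAt, ?_⟩
    rwa [show deriv k = g from funext fun x => (hkd x).deriv]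
  have hfk : ∀ x ∈ G.I e, conj (E x) * u x - k x = ∫ t in (0 : ℝ)..x, (D t - g t) := by
    intro x hx
    rw [intervalIntegral.integral_sub (hDint x hx) (hgint _ _),
      ← hf.2 0 (G.zero_mem_I e) x hx]
    simp only [hk, hE0, map_one, one_mul]
    ring
  -- This is where `g` and `D` having the same integral is used.
  have hkb : k b = conj (E b) * u b := by
    have h1 := hfk b hbI
    rw [intervalIntegral.integral_sub (hDint b hbI) (hgint _ _),
      intervalIntegral.integral_of_le hb.le, intervalIntegral.integral_of_le hb.le,
      integral_Ioc_eq_integral_Ioo, integral_Ioc_eq_integral_Ioo, hgi, sub_self] at h1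
    exact (sub_eq_zero.mp h1).symm
  -- If the edge continues past `b`, then `u b = 0` by `hub`, and `k` stays constant since `g`
  -- vanishes there.
  have hkx : ∀ x ∈ G.I e, b < x → k x = 0 := by
    intro x hx hbx
    have hopen : b ∈ G.openI e := ⟨hb, lt_of_lt_of_le
      ((ENNReal.ofReal_lt_ofReal_iff (hb.trans hbx)).mpr hbx) hx.2⟩
    have h1 : k x = k b := by
      have h2 : ∫ t in b..x, g t = 0 := by
        rw [intervalIntegral.integral_of_le hbx.le]
        exact setIntegral_eq_zero_of_forall_eq_zero fun t ht =>
          hg0 t fun h' => absurd h'.2 (not_lt.mpr ht.1.le)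
      rw [hk]
      simp only
      rw [← intervalIntegral.integral_add_adjacent_intervals (hgint 0 b) (hgint b x), h2, add_zero]
    rw [h1, hkb, hub hopen, mul_zero]
  have hvd : ∀ x, HasDerivAt (fun x => E x * k x)
      (Complex.I * a' x * E x * k x + E x * g x) x := fun x => (hEd x).mul (hkd x)
  have hmag : ∀ x ∈ G.I e, 1 / Complex.I * derivWithin (fun x => E x * k x) (G.I e) x -
      a x * (E x * k x) = 1 / Complex.I * (E x * g x) := fun x hx => by
    rw [(hvd x).hasDerivWithinAt.derivWithin (G.uniqueDiffOn_I e x hx), ha' hx]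
    field_simp
    ring
  have hdiff : ∀ x, E x * (conj (E x) * u x - k x) = u x - E x * k x := fun x => by
    linear_combination (u x) * hEconj x
  have hnorm : ∀ x, ‖p x - 1 / Complex.I * (E x * g x)‖ = ‖D x - g x‖ := fun x => by
    have : p x - 1 / Complex.I * (E x * g x) = -Complex.I * E x * (D x - g x) := by
      rw [hD]
      simp only [one_div, Complex.inv_I]
      linear_combination (E x * conj (E x) * p x) * Complex.I_mul_I - p x * hEconj x
    rw [this, norm_mul, norm_mul, norm_neg, Complex.norm_I, hEn, one_mul, one_mul]
  refine ⟨fun x => E x * k x, hE2.mul hk2.contDiffOn, fun x hx hxo => ⟨?_, ?_⟩,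
    fun x hx hbx => ?_, fun x hx => ?_, ?_⟩
  · rcases hend x hx hxo with rfl | rfl
    · simp [hk, hE0]
    · simp only
      rw [hkb, ← mul_assoc, hEconj, one_mul]
  · rw [hmag x hx, hg0 x, mul_zero, mul_zero]
    rcases hend x hx hxo with rfl | rfl <;> simp
  · simp only
    rw [hkx x hx hbx, mul_zero]
  · rcases le_or_gt x b with hxb | hbx
    · rw [← hdiff, norm_mul, hEn, one_mul, hfk x hx,
        intervalIntegral.integral_of_le hx.1, integral_Ioc_eq_integral_Ioo]
      have hgm : MemLp g 2 (volume.restrict (Ioo 0 b)) :=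
        (hg.continuous.memLp_of_hasCompactSupport hgc).restrict _
      have hDg := hDm.sub hgm
      calc ‖∫ t in Ioo 0 x, (D t - g t)‖ ≤ ∫ t in Ioo 0 x, ‖D t - g t‖ :=
            norm_integral_le_integral_norm _
        _ ≤ ∫ t in Ioo 0 b, ‖D t - g t‖ :=
            setIntegral_mono_set (hDg.integrable (by norm_num)).norm
              (Eventually.of_forall fun _ => norm_nonneg _)
              (Ioo_subset_Ioo_right hxb).eventuallyLE
        _ ≤ √(volume.real (Ioo 0 b)) * √(∫ t in Ioo 0 b, ‖D t - g t‖ ^ 2) :=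
            setIntegral_norm_le_sqrt (by simp) hDg
        _ ≤ √b * √(ε ^ 2 / b) := by
            gcongr
            · simp [hb.le]
            · exact hgn.le.trans (min_le_right _ _)
        _ = ε := by
            rw [← Real.sqrt_mul hb.le, mul_div_cancel₀ _ hb.ne', Real.sqrt_sq hε.le]
    · simp only [hu x hx hbx, hkx x hx hbx, mul_zero, sub_zero, norm_zero]
      exact hε.le
  · rw [setIntegral_congr_fun (g := fun x => ‖D x - g x‖ ^ 2) (G.measurableSet_I e)
      fun x hx => by simp only [hmag x hx, hnorm],
      setIntegral_eq_of_subset_of_forall_sdiff_eq_zero (G.measurableSet_I e)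
        ((G.ordConnected_I e).out (G.zero_mem_I e) hbI) fun x hx => ?_,
      integral_Icc_eq_integral_Ioo]
    · exact hgn.le.trans (min_le_left _ _)
    · have hbx : b < x := not_le.mp fun hxb => hx.2 ⟨hx.1.1, hxb⟩
      simp only [hD, hp0 x hx.1 hbx, hg0 x fun h' => absurd h'.2 (not_lt.mpr hbx.le)]
      simp

lemma exists_edge_approx {e : ℰ} {a : ℝ → ℝ} (ha : ContDiffOn ℝ 1 a (G.I e))
    {u p : ℝ → ℂ} (h : IsPrimitiveOn (G.I e) u fun x => Complex.I * (p x + a x * u x))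
    (hp : MemLp p 2 (volume.restrict (G.I e)))
    (hu : ∀ x ∈ G.I e, u x ≠ 0 → x ≤ L) (hp0 : ∀ x ∈ G.I e, p x ≠ 0 → x ≤ L) :
    ∃ (b : ℝ) (v : ℕ → ℝ → ℂ), ∀ n, ContDiffOn ℝ 2 (v n) (G.I e) ∧
      (∀ x ∈ G.I e, x ∉ G.openI e → v n x = u x ∧
        1 / Complex.I * derivWithin (v n) (G.I e) x - a x * v n x = 0) ∧
      (∀ x ∈ G.I e, b < x → v n x = 0 ∧ u x = 0) ∧
      (∀ x ∈ G.I e, ‖u x - v n x‖ ≤ 1 / ((n : ℝ) + 1)) ∧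
      ∫ x in G.I e, ‖p x - (1 / Complex.I * derivWithin (v n) (G.I e) x - a x * v n x)‖ ^ 2
        ≤ 1 / ((n : ℝ) + 1) := by
  -- `b` is the length of a finite edge; on a half-line, `max L 0 + 1` is positive and strictly
  -- beyond the support.
  obtain ⟨b, hb, hbI, hend, hLb, hub⟩ : ∃ b > 0, b ∈ G.I e ∧
      (∀ x ∈ G.I e, x ∉ G.openI e → x = 0 ∨ x = b) ∧ (∀ x ∈ G.I e, b < x → L < x) ∧
      (b ∈ G.openI e → L < b) := by
    by_cases h : G.length e = ⊤
    · rw [I_eq_Ici h, openI_eq_Ioi h]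
      refine ⟨max L 0 + 1, by positivity, mem_Ici.mpr (by positivity), fun x hx hx0 => ?_,
        fun x _ hx => ?_, fun _ => ?_⟩
      · exact Or.inl (le_antisymm (not_lt.mp hx0) hx)
      · linarith [le_max_left L 0]
      · linarith [le_max_left L 0]
    · rw [I_eq_Icc h, openI_eq_Ioo h]
      refine ⟨_, toReal_length_pos h, right_mem_Icc.mpr ENNReal.toReal_nonneg, fun x hx hx0 => ?_,
        fun x hx hx' => absurd hx.2 (not_le.mpr hx'), fun h' => absurd h'.2 (lt_irrefl _)⟩
      rcases hx.1.eq_or_lt with h0 | h0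
      · exact Or.inl h0.symm
      · exact Or.inr (le_antisymm hx.2 (not_lt.mp fun hlt => hx0 ⟨h0, hlt⟩))
  have hu0 : ∀ x ∈ G.I e, L < x → u x = 0 := fun x hx hLx => by
    by_contra hne
    exact absurd (hu x hx hne) (not_le.mpr hLx)
  have hp0' : ∀ x ∈ G.I e, L < x → p x = 0 := fun x hx hLx => by
    by_contra hne
    exact absurd (hp0 x hx hne) (not_le.mpr hLx)
  choose v h1 h2 h3 h4 h5 using fun n : ℕ => exists_edge_approx_of_pos ha h hp hb hbI hend
    (fun x hx hbx => hu0 x hx (hLb x hx hbx)) (fun hbo => hu0 b hbI (hub hbo))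
    (fun x hx hbx => hp0' x hx (hLb x hx hbx)) (ε := 1 / ((n : ℝ) + 1)) (by positivity)
  exact ⟨b, v, fun n => ⟨h1 n, h2 n, fun x hx hbx => ⟨h3 n x hx hbx, hu0 x hx (hLb x hx hbx)⟩,
    h4 n, h5 n⟩⟩

lemma tendsto_zero_of_represents {w : ℕ → ℰ → ℝ → ℂ} {f : ℕ → G.L2}
    (hf : ∀ n, G.Represents (w n) (f n)) (hF : ∀ n, ∀ e ∉ F, ∀ x ∈ G.I e, w n e x = 0)
    (hlim : ∀ e ∈ F, Tendsto (fun n => ∫ x in G.I e, ‖w n e x‖ ^ 2) atTop (𝓝 0)) :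
    Tendsto f atTop (𝓝 0) := by
  rw [tendsto_zero_iff_norm_tendsto_zero]
  have hsq : Tendsto (fun n => ‖f n‖ ^ 2) atTop (𝓝 0) := by
    have hEq : ∀ n, ‖f n‖ ^ 2 = ∑ e ∈ F, ∫ x in G.I e, ‖w n e x‖ ^ 2 := fun n => by
      rw [← (hf n).hasSum_norm_sq.tsum_eq]
      refine tsum_eq_sum fun e he => setIntegral_eq_zero_of_forall_eq_zero fun x hx => ?_
      simp [hF n e he x hx]
    simp only [hEq]
    simpa using tendsto_finsetSum F hlim
  have := hsq.sqrt
  simpa using this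

/-- The differences vanish beyond b and tend to zero uniformly, while the continuous weight is
integrable on [0, b]. No bound on the weight near infinity is needed. -/
lemma tendsto_setIntegral_mul_sub_zero {e : ℰ} {W : ℝ → ℝ} (hW : ContinuousOn W (G.I e))
    (hW0 : ∀ x ∈ G.I e, 0 ≤ W x)
    {u : ℝ → ℂ} {v : ℕ → ℝ → ℂ} {b : ℝ} (hb : ∀ n, ∀ x ∈ G.I e, b < x → v n x = 0 ∧ u x = 0)
    (hv : ∀ n, ∀ x ∈ G.I e, ‖u x - v n x‖ ≤ 1 / ((n : ℝ) + 1)) :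
    Tendsto (fun n => ∫ x in G.I e, ‖(√(W x) : ℂ) * (u x - v n x)‖ ^ 2) atTop (𝓝 0) := by
  have hK : IsCompact (G.I e ∩ Icc 0 b) := isCompact_Icc.inter_left (G.isClosed_I e)
  have hWi : IntegrableOn W (G.I e ∩ Icc 0 b) := (hW.mono inter_subset_left).integrableOn_compact hK
  have hbd : ∀ n, ∫ x in G.I e, ‖(√(W x) : ℂ) * (u x - v n x)‖ ^ 2 ≤
      (1 / ((n : ℝ) + 1)) ^ 2 * ∫ x in G.I e ∩ Icc 0 b, W x := by
    intro n
    rw [setIntegral_eq_of_subset_of_forall_sdiff_eq_zero (G.measurableSet_I e)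
      (inter_subset_left : G.I e ∩ Icc 0 b ⊆ G.I e) fun x hx => ?_, ← integral_const_mul]
    · refine integral_mono_of_nonneg (Eventually.of_forall fun x => by positivity)
        (hWi.const_mul _) ?_
      filter_upwards [ae_restrict_mem hK.measurableSet] with x hx
      rw [norm_mul, mul_pow, Complex.norm_real, Real.norm_eq_abs, sq_abs,
        Real.sq_sqrt (hW0 x hx.1), mul_comm]
      gcongr
      · exact hW0 x hx.1
      · exact hv n x hx.1
    · have hbx : b < x := not_le.mp fun hxb => hx.2 ⟨hx.1, hx.1.1, hxb⟩
      rw [(hb n x hx.1 hbx).1, (hb n x hx.1 hbx).2]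
      simp
  refine squeeze_zero (fun n => by positivity) hbd ?_
  have := (tendsto_one_div_add_atTop_nhds_zero_nat (𝕜 := ℝ)).pow 2 |>.mul_const
    (∫ x in G.I e ∩ Icc 0 b, W x)
  simpa using this

/-- Elements of the energy space with compact support are limits of functions in `H̃²_c`. -/
lemma exists_memH2c_tendsto (hconn : G.Connected) (hA : ∀ e, ContDiffOn ℝ 1 (A e) (G.I e))
    (hV : ∀ e, ContinuousOn (V e) (G.I e)) (hV1 : ∀ e, ∀ x ∈ G.I e, 1 ≤ V e x)
    {y : PiLp 2 fun _ : Fin 3 => G.L2} {u p : ℰ → ℝ → ℂ} (hcont : G.IsCont u)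
    (hp : G.MagPrimitive A u p) (hy0 : G.Represents p (y 0))
    (hy1 : G.Represents (fun e x => (√(V e x - 1) : ℂ) * u e x) (y 1)) (hy2 : G.Represents u (y 2))
    (hu : G.HasCompactSupp u F L) (hpc : G.HasCompactSupp p F L) :
    ∃ z : ℕ → PiLp 2 fun _ : Fin 3 => G.L2, Tendsto z atTop (𝓝 y) ∧
      ∀ n, z n ∈ G.energySpace A V ∧ ∃ v, G.MemH2c A v ∧ G.Represents v (z n 2) := by
  classical
  choose b v hv using fun e => exists_edge_approx (hA e) (hp e) (hy0.memLp e)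
    (fun x hx hne => (hu e x hx hne).2) (fun x hx hne => (hpc e x hx hne).2)
  have hout : ∀ e ∉ F, ∀ x ∈ G.I e, u e x = 0 ∧ p e x = 0 := fun e he x hx =>
    ⟨by_contra fun hne => he (hu e x hx hne).1, by_contra fun hne => he (hpc e x hx hne).1⟩
  set w : ℕ → ℰ → ℝ → ℂ := fun n e => if e ∈ F then v e n else 0 with hw
  have hwF : ∀ n, ∀ e ∈ F, w n e = v e n := fun n e he => if_pos he
  have hwF' : ∀ n, ∀ e ∉ F, w n e = 0 := fun n e he => if_neg he
  have hd : ∀ n e, ContDiffOn ℝ 2 (w n e) (G.I e) := fun n e => by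
    by_cases he : e ∈ F
    · rw [hwF n e he]; exact (hv e n).1
    · rw [hwF' n e he]; exact contDiffOn_const
  -- The edgewise approximations keep the values of `u` at all edge ends, so they glue to a
  -- continuous function on the graph.
  have hwu : ∀ n, ∀ a : G.EdgeEnd, w n a.edge a.pos = u a.edge a.pos := fun n a => by
    by_cases he : a.edge ∈ F
    · rw [hwF n _ he]; exact ((hv _ n).2.1 _ a.pos_mem_I a.pos_notMem_openI).1
    · rw [hwF' n _ he, (hout _ he _ a.pos_mem_I).1]; rfl
  have hwc : ∀ n, G.IsCont (w n) := fun n =>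
    ⟨fun e => (hd n e).continuousOn, fun a a' h => by rw [hwu, hwu, hcont.2 a a' h]⟩
  have hws : ∀ n, G.HasCompactSupp (w n) F (∑ e ∈ F, |b e|) := fun n e x hx hne => by
    by_cases he : e ∈ F
    · refine ⟨he, le_trans ?_ (Finset.single_le_sum (f := fun e => |b e|)
        (fun _ _ => abs_nonneg _) he)⟩
      by_contra hcon
      rw [hwF n e he] at hne
      exact hne ((hv e n).2.2.1 x hx ((le_abs_self _).trans_lt (not_le.mp hcon))).1
    · rw [hwF' n e he] at hne
      exact absurd rfl hne
  have hwK : ∀ n, ∀ a : G.EdgeEnd, G.classicalMagD A (w n) a.edge a.pos = 0 := fun n a => by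
    by_cases he : a.edge ∈ F
    · rw [classicalMagD, hwF n _ he]
      exact ((hv _ n).2.1 _ a.pos_mem_I a.pos_notMem_openI).2
    · rw [classicalMagD, hwF' n _ he]
      simp
  have hd1 : ∀ n e, ContDiffOn ℝ 1 (w n e) (G.I e) := fun n e => (hd n e).of_le (by norm_num)
  have hAc : ∀ e, ContinuousOn (A e) (G.I e) := fun e => (hA e).continuousOn
  have hWc : ∀ e, ContinuousOn (fun x => V e x - 1) (G.I e) := fun e =>
    (hV e).sub continuousOn_const
  choose z0 hz0 using fun n => ((hws n).classicalMagD (A := A)).memL2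
    (continuousOn_classicalMagD hAc (hd1 n)) |>.exists_represents
  choose z1 hz1 using fun n => (((hws n).of_eq_zero
    (v := fun e x => (√(V e x - 1) : ℂ) * w n e x)
    (fun e x _ h0 => by rw [h0, mul_zero])).memL2
    (fun e => ((hWc e).sqrt.ofReal).mul ((hwc n).1 e))).exists_represents
  choose z2 hz2 using fun n => ((hws n).memL2 (hwc n).1).exists_represents
  have hl0 : Tendsto (fun n => y 0 - z0 n) atTop (𝓝 0) := by
    refine tendsto_zero_of_represents (F := F) (fun n => hy0.sub (hz0 n)) (fun n e he x hx => ?_)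
      fun e he => ?_
    · rw [(hout e he x hx).2, classicalMagD, hwF' n e he]
      simp
    · refine squeeze_zero (fun n => by positivity) (fun n => ?_)
        (tendsto_one_div_add_atTop_nhds_zero_nat (𝕜 := ℝ))
      have := (hv e n).2.2.2.2
      rw [← hwF n e he] at this
      exact this
  have hl1 : Tendsto (fun n => y 1 - z1 n) atTop (𝓝 0) := by
    refine tendsto_zero_of_represents (F := F) (fun n => hy1.sub (hz1 n)) (fun n e he x hx => ?_)
      fun e he => ?_
    · rw [(hout e he x hx).1, hwF' n e he]
      simp
    · simp only [← mul_sub, hwF _ e he]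
      exact tendsto_setIntegral_mul_sub_zero (hWc e)
        (fun x hx => sub_nonneg.mpr (hV1 e x hx)) (fun n => (hv e n).2.2.1)
        (fun n => (hv e n).2.2.2.1)
  have hl2 : Tendsto (fun n => y 2 - z2 n) atTop (𝓝 0) := by
    refine tendsto_zero_of_represents (F := F) (fun n => hy2.sub (hz2 n)) (fun n e he x hx => ?_)
      fun e he => ?_
    · rw [(hout e he x hx).1, hwF' n e he]
      simp
    · have := tendsto_setIntegral_mul_sub_zero (G := G) (e := e) (W := fun _ => 1)
        continuousOn_const (fun x hx => zero_le_one) (fun n => (hv e n).2.2.1)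
        (fun n => (hv e n).2.2.2.1)
      simpa [hwF _ e he] using this
  refine ⟨fun n => WithLp.toLp 2 ![z0 n, z1 n, z2 n], ?_, fun n => ⟨⟨w n, _, hwc n,
    magPrimitive_classicalMagD (hd1 n), hz0 n, hz1 n, hz2 n⟩, w n,
    memH2c_of_contDiffOn hconn (hwc n) (hws n) (hd n) (hwK n), hz2 n⟩⟩
  have hlim : ∀ {f : ℕ → G.L2} {g : G.L2}, Tendsto (fun n => g - f n) atTop (𝓝 0) →
      Tendsto f atTop (𝓝 g) := fun {f g} h => by
    have := h.const_sub g
    simpa using this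
  refine ((PiLp.continuous_toLp 2 _).tendsto _).comp (tendsto_pi_nhds.mpr fun i => ?_)
  fin_cases i
  · exact hlim hl0
  · exact hlim hl1
  · exact hlim hl2

end MetricGraph

namespace MetricGraph

variable {𝒱 ℰ : Type*} {G : MetricGraph 𝒱 ℰ}

/-! ### Cutoff -/

variable {A V : ℰ → ℝ → ℝ} {u v p : ℰ → ℝ → ℂ} {F : Finset ℰ} {L : ℝ}

lemma Represents.norm_le_mul {f g : G.L2} (hu : G.Represents u f) (hv : G.Represents v g) {c : ℝ}
    (hc : 0 ≤ c) (h : ∀ e, ∀ x ∈ G.I e, ‖u e x‖ ≤ c * ‖v e x‖) : ‖f‖ ≤ c * ‖g‖ := by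
  refine (sq_le_sq₀ (norm_nonneg _) (by positivity)).mp ?_
  rw [mul_pow]
  refine hasSum_le (fun e => ?_) hu.hasSum_norm_sq (hv.hasSum_norm_sq.mul_left (c ^ 2))
  rw [← integral_const_mul]
  refine integral_mono_ae ((memLp_two_iff_integrable_sq_norm (hu.memLp e).1).mp (hu.memLp e))
    (((memLp_two_iff_integrable_sq_norm (hv.memLp e).1).mp (hv.memLp e)).const_mul _) ?_
  filter_upwards [ae_restrict_mem (G.measurableSet_I e)] with x hx
  rw [← mul_pow]
  exact pow_le_pow_left₀ (norm_nonneg _) (h e x hx) 2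

/-- Dominated convergence is used twice: for the integral on each edge and for the sum over the
edges. -/
lemma Represents.tendsto_zero_of_cutoff {f : G.L2} (hv : G.Represents v f)
    {ζ : ℕ → ℰ → ℝ → ℂ} {k : ℕ → G.L2} (hk : ∀ n, G.Represents (fun e x => ζ n e x * v e x) (k n))
    (h1 : ∀ n e, ∀ x ∈ G.I e, ‖ζ n e x‖ ≤ 1)
    (h0 : ∀ e, ∀ x ∈ G.I e, ∀ᶠ n in atTop, ζ n e x = 0) : Tendsto k atTop (𝓝 0) := by
  rw [tendsto_zero_iff_norm_tendsto_zero]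
  have hle : ∀ n e, ∀ x ∈ G.I e, ‖ζ n e x * v e x‖ ^ 2 ≤ ‖v e x‖ ^ 2 := fun n e x hx => by
    rw [norm_mul]
    refine pow_le_pow_left₀ (by positivity) ?_ 2
    exact mul_le_of_le_one_left (norm_nonneg _) (h1 n e x hx)
  have hint : ∀ e, Integrable (fun x => ‖v e x‖ ^ 2) (volume.restrict (G.I e)) := fun e =>
    (memLp_two_iff_integrable_sq_norm (hv.memLp e).1).mp (hv.memLp e)
  have hint' : ∀ n e, Integrable (fun x => ‖ζ n e x * v e x‖ ^ 2) (volume.restrict (G.I e)) :=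
    fun n e => (memLp_two_iff_integrable_sq_norm ((hk n).memLp e).1).mp ((hk n).memLp e)
  have hsq : Tendsto (fun n => ∑' e, ∫ x in G.I e, ‖ζ n e x * v e x‖ ^ 2) atTop
      (𝓝 (∑' _ : ℰ, (0 : ℝ))) := by
    refine tendsto_tsum_of_dominated_convergence hv.hasSum_norm_sq.summable (fun e => ?_)
      (Eventually.of_forall fun n e => ?_)
    · have := tendsto_integral_of_dominated_convergence (μ := volume.restrict (G.I e))
        (F := fun n x => ‖ζ n e x * v e x‖ ^ 2) (f := fun _ => (0 : ℝ)) (fun x => ‖v e x‖ ^ 2)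
        (fun n => (hint' n e).1) (hint e) (fun n => ?_) ?_
      · simpa using this
      · filter_upwards [ae_restrict_mem (G.measurableSet_I e)] with x hx
        rw [Real.norm_eq_abs, abs_of_nonneg (by positivity)]
        exact hle n e x hx
      · filter_upwards [ae_restrict_mem (G.measurableSet_I e)] with x hx
        refine tendsto_const_nhds.congr' ?_
        filter_upwards [h0 e x hx] with n hn
        simp [hn]
    · rw [Real.norm_eq_abs, abs_of_nonneg (by positivity)]
      refine integral_mono_ae (hint' n e) (hint e) ?_
      filter_upwards [ae_restrict_mem (G.measurableSet_I e)] with x hx using hle n e x hx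
  rw [tsum_zero] at hsq
  simp only [(hk _).hasSum_norm_sq.tsum_eq] at hsq
  simpa using hsq.sqrt

/-- Lipschitz functions are differentiable almost everywhere. The global derivative comes with
measurability and a norm bound, the derivative within the edge with the support statement
`HasCompactSupp.derivWithin`. -/
lemma derivWithin_ofReal_ae_eq {η : ℝ → ℝ} {K : NNReal} (hη : LipschitzWith K η) (e : ℰ) :
    (fun x => ((deriv η x : ℝ) : ℂ)) =ᵐ[volume.restrict (G.I e)]
      derivWithin (fun x => (η x : ℂ)) (G.I e) := by
  filter_upwards [ae_restrict_of_ae hη.ae_differentiableAt, ae_restrict_mem (G.measurableSet_I e)]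
    with x hx hxI
  exact (hx.hasDerivAt.ofReal_comp.hasDerivWithinAt.derivWithin (G.uniqueDiffOn_I e x hxI)).symm

lemma MagPrimitive.lipschitz_mul {η : ℰ → ℝ → ℝ} {K : NNReal} (hη : ∀ e, LipschitzWith K (η e))
    (h : G.MagPrimitive A u p) : G.MagPrimitive A (fun e x => η e x * u e x)
      (fun e x => η e x * p e x -
        Complex.I * (derivWithin (fun x => (η e x : ℂ)) (G.I e) x * u e x)) := fun e => by
  refine (((isPrimitiveOn_of_lipschitzWith (hη e)).mono (subset_univ (G.I e))).mul
    (G.ordConnected_I e) (G.isLocallyClosed_I e) (h e)).congr_ae (G.ordConnected_I e)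
    (G.measurableSet_I e) ?_
  filter_upwards [derivWithin_ofReal_ae_eq (G := G) (hη e) e] with x hx
  rw [hx]
  linear_combination (derivWithin (fun x => (η e x : ℂ)) (G.I e) x * u e x) * Complex.I_mul_I

/-- The elements of compact support are dense in the energy space. -/
lemma exists_compactSupp_tendsto (hconn : G.Connected) (hfin : G.LocallyFinite)
    {y : PiLp 2 fun _ : Fin 3 => G.L2} (hy : y ∈ G.energySpace A V) :
    ∃ z : ℕ → PiLp 2 fun _ : Fin 3 => G.L2, Tendsto z atTop (𝓝 y) ∧ ∀ n, ∃ u p F L,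
      G.IsCont u ∧ G.MagPrimitive A u p ∧ G.Represents p (z n 0) ∧
      G.Represents (fun e x => (√(V e x - 1) : ℂ) * u e x) (z n 1) ∧ G.Represents u (z n 2) ∧
      G.HasCompactSupp u F L ∧ G.HasCompactSupp p F L := by
  obtain ⟨u, p, hu, hp, hy0, hy1, hy2⟩ := hy
  obtain ⟨η, hlip, hη01, hηv, hηs, hη1⟩ := hconn.exists_cutoff hfin
  have hηc : ∀ n e, Continuous fun x => (η n e x : ℂ) := fun n e =>
    Complex.continuous_ofReal.comp (hlip n e).continuous
  have hηn : ∀ n e, ∀ x ∈ G.I e, ‖(η n e x : ℂ)‖ ≤ 1 := fun n e x hx => by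
    rw [Complex.norm_real, Real.norm_eq_abs, abs_of_nonneg (hη01 n e x hx).1]
    exact (hη01 n e x hx).2
  have hcut : ∀ {w : ℰ → ℝ → ℂ} {f : G.L2}, G.Represents w f → ∀ n,
      ∃ g, G.Represents (fun e x => (η n e x : ℂ) * w e x) g := fun {w f} hw n => by
    refine (hw.memL2.of_norm_le (fun e => (hηc n e).aestronglyMeasurable.mul (hw.memLp e).1)
      fun e x hx => ?_).exists_represents
    rw [Pi.mul_apply, norm_mul]
    exact mul_le_of_le_one_left (norm_nonneg _) (hηn n e x hx)
  have hcutlim : ∀ {w : ℰ → ℝ → ℂ} {f : G.L2} {g : ℕ → G.L2}, G.Represents w f →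
      (∀ n, G.Represents (fun e x => (η n e x : ℂ) * w e x) (g n)) →
      Tendsto g atTop (𝓝 f) := fun {w f g} hw hg => by
    have h0 : Tendsto (fun n => f - g n) atTop (𝓝 0) := by
      refine hw.tendsto_zero_of_cutoff (ζ := fun n e x => 1 - (η n e x : ℂ)) (fun n => ?_)
        (fun n e x hx => ?_) fun e x hx => ?_
      · simpa only [sub_mul, one_mul] using hw.sub (hg n)
      · rw [← Complex.ofReal_one, ← Complex.ofReal_sub, Complex.norm_real, Real.norm_eq_abs,
          abs_of_nonneg (sub_nonneg.mpr (hη01 n e x hx).2)]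
        linarith [(hη01 n e x hx).1]
      · filter_upwards [hη1 e x hx] with n hn
        rw [hn]
        simp
    simpa using h0.const_sub f
  choose z0 hz0 using hcut hy0
  choose z1 hz1 using hcut hy1
  choose z2 hz2 using hcut hy2
  have hdle : ∀ (n : ℕ) e x, ‖((deriv (η n e) x : ℝ) : ℂ)‖ ≤ 1 / ((n : ℝ) + 1) := fun n e x => by
    rw [Complex.norm_real]
    simpa using norm_deriv_le_of_lipschitz (hlip n e) (x₀ := x)
  have hd : ∀ n, ∃ g, G.Represents (fun e x => ((deriv (η n e) x : ℝ) : ℂ) * u e x) g := fun n => by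
    refine (hy2.memL2.of_norm_le (fun e => (Complex.measurable_ofReal.comp
      (measurable_deriv (η n e))).aestronglyMeasurable.mul (hy2.memLp e).1)
      fun e x hx => ?_).exists_represents
    rw [Pi.mul_apply, norm_mul]
    refine mul_le_of_le_one_left (norm_nonneg _) ((hdle n e x).trans ?_)
    rw [div_le_one (by positivity)]
    linarith [n.cast_nonneg (α := ℝ)]
  choose d hd using hd
  -- The commutator term η'u in D_A(ηu) is at most |u|/(n+1), so it disappears in the limit.
  have hdlim : Tendsto d atTop (𝓝 0) := by
    rw [tendsto_zero_iff_norm_tendsto_zero]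
    refine squeeze_zero (fun _ => norm_nonneg _) (fun n => (hd n).norm_le_mul hy2
      (c := 1 / ((n : ℝ) + 1)) (by positivity) fun e x _ => ?_) ?_
    · rw [norm_mul]
      gcongr
      exact hdle n e x
    · simpa using (tendsto_one_div_add_atTop_nhds_zero_nat (𝕜 := ℝ)).mul_const ‖y 2‖
  refine ⟨fun n => WithLp.toLp 2 ![z0 n - Complex.I • d n, z1 n, z2 n], ?_, fun n => ?_⟩
  · refine ((PiLp.continuous_toLp 2 _).tendsto _).comp (tendsto_pi_nhds.mpr fun i => ?_)
    fin_cases i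
    · have := (hcutlim hy0 hz0).sub (hdlim.const_smul Complex.I)
      simpa using this
    · exact hcutlim hy1 hz1
    · exact hcutlim hy2 hz2
  · obtain ⟨F, L, hFL⟩ := hηs n
    refine ⟨fun e x => η n e x * u e x, _, F, L, ⟨fun e => (hηc n e).continuousOn.mul (hu.1 e),
      fun a b hab => ?_⟩, hp.lipschitz_mul (hlip n), ?_, ?_, hz2 n, ?_, ?_⟩
    · simp only [hηv n a b hab, hu.2 a b hab]
    · refine ((hz0 n).sub ((hd n).const_smul Complex.I)).congr fun e => ?_
      filter_upwards [derivWithin_ofReal_ae_eq (G := G) (hlip n e) e] with x hx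
      rw [hx]
    · simp only [mul_left_comm _ ((η n _ _ : ℝ) : ℂ)]
      exact hz1 n
    · exact hFL.of_eq_zero fun e x _ h0 => by simp only [h0, zero_mul]
    · have h1 := hFL.of_eq_zero (v := fun e x => (η n e x : ℂ) * p e x)
        fun e x _ h0 => by simp only [h0, zero_mul]
      have h2 := hFL.derivWithin.of_eq_zero (v := fun e x =>
        -(Complex.I * (derivWithin (fun x => (η n e x : ℂ)) (G.I e) x * u e x)))
        fun e x _ h0 => by simp only [h0, zero_mul, mul_zero, neg_zero]
      simpa only [← sub_eq_add_neg] using h1.add h2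

/-! ### Density of the domain -/

/-- A test function on the interior of one edge, extended by zero, vanishes with its derivative at
all edge ends, so it lies in H̃²_c. An f orthogonal to all of these is zero on every edge. -/
lemma denseRange_energyEmbedding (hconn : G.Connected) (hfin : G.LocallyFinite)
    (hA : ∀ e, ContDiffOn ℝ 1 (A e) (G.I e)) (hV : ∀ e, ContinuousOn (V e) (G.I e))
    (hV1 : ∀ e, ∀ x ∈ G.I e, 1 ≤ V e x) [CompleteSpace (G.energySpace A V)] :
    DenseRange (G.energyEmbedding A V) := by
  classical
  have : Dense ((G.energyEmbedding A V).range : Set G.L2) := by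
    rw [Submodule.dense_iff_topologicalClosure_eq_top,
      Submodule.topologicalClosure_eq_top_iff, Submodule.eq_bot_iff]
    intro f hf
    rw [Submodule.mem_orthogonal] at hf
    refine lp.ext (funext fun e₀ => ?_)
    rw [lp.coeFn_zero, Pi.zero_apply, Lp.eq_zero_iff_ae_eq_zero]
    have hm : MemLp (f e₀) 2 (volume.restrict (G.openI e₀)) := by
      rw [restrict_openI]
      exact Lp.memLp _
    suffices h : (f e₀ : ℝ → ℂ) =ᵐ[volume.restrict (G.openI e₀)] 0 by rwa [restrict_openI] at h
    refine ae_eq_zero_of_forall_integral_mul_eq_zero (G.isOpen_openI e₀) hm fun φ h1 h2 h3 => ?_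
    set u : ℰ → ℝ → ℂ := fun e x => if e = e₀ then (φ x : ℂ) else 0 with hu
    have hu0 : u e₀ = fun x => (φ x : ℂ) := by simp [hu]
    have hu1 : ∀ e, e ≠ e₀ → u e = fun _ => 0 := fun e he => by simp [hu, he]
    have hφ : ∀ x, x ∉ G.openI e₀ → φ x = 0 ∧ deriv φ x = 0 := fun x hx =>
      ⟨image_eq_zero_of_notMem_tsupport fun h => hx (h3 h),
        deriv_eq_zero_of_notMem_tsupport fun h => hx (h3 h)⟩
    have hupos : ∀ a : G.EdgeEnd, u a.edge a.pos = 0 := fun a => by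
      by_cases he : a.edge = e₀
      · rw [he, hu0]
        simp only
        rw [(hφ _ (he ▸ a.pos_notMem_openI)).1, Complex.ofReal_zero]
      · rw [hu1 _ he]
    have hd : ∀ e, ContDiff ℝ ∞ (u e) := fun e => by
      by_cases he : e = e₀
      · rw [he, hu0]; exact h1.ofReal_comp
      · rw [hu1 e he]; exact contDiff_const
    obtain ⟨L, hL⟩ := h2.isCompact.bddAbove
    have hc : G.HasCompactSupp u {e₀} L := fun e x hx hne => by
      by_cases he : e = e₀
      · subst he
        rw [hu0] at hne
        exact ⟨Finset.mem_singleton_self _, hL (subset_tsupport _ fun h => hne (by simp [h]))⟩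
      · rw [hu1 e he] at hne
        exact absurd rfl hne
    have hH2c : G.MemH2c A u := by
      refine memH2c_of_contDiffOn hconn ⟨fun e => (hd e).continuous.continuousOn,
        fun a b _ => by rw [hupos, hupos]⟩ hc
        (fun e => (contDiff_infty.mp (hd e) 2).contDiffOn) fun a => ?_
      rw [classicalMagD, hupos, mul_zero, sub_zero]
      by_cases he : a.edge = e₀
      · have hdφ : HasDerivAt (fun x => (φ x : ℂ)) ((deriv φ a.pos : ℝ) : ℂ) a.pos :=
          ((h1.differentiable (by simp)) a.pos).hasDerivAt.ofReal_comp
        rw [he, hu0, hdφ.hasDerivWithinAt.derivWithin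
          (G.uniqueDiffOn_I e₀ _ (he ▸ a.pos_mem_I)), (hφ _ (he ▸ a.pos_notMem_openI)).2]
        simp
      · rw [hu1 _ he]
        simp
    obtain ⟨y, hy, g, hyu, -, -⟩ := hH2c.exists_mem_energySpace hA hV hV1 hfin
    have h4 := hf (y 2) ⟨⟨y, hy⟩, rfl⟩
    have hfr : G.Represents (fun e x => f e x) f := fun e => EventuallyEq.rfl
    rw [← (hfr.hasSum_inner hyu).tsum_eq, tsum_eq_single e₀ fun e he => by simp [hu1 e he]] at h4
    rw [restrict_openI, ← h4]
    refine integral_congr_ae (Eventually.of_forall fun x => ?_)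
    simp [hu0, mul_comm]
  exact this

/-! ### Linearity of the domain -/

/-- Both supports lie in compact parts of a common finite set of edges, and connectedness makes such
a union bounded again. -/
lemma MemH2c.linear (hconn : G.Connected) (hfin : G.LocallyFinite) (hu : G.MemH2c A u)
    (hv : G.MemH2c A v) (c d : ℂ) : G.MemH2c A fun e x => c * u e x + d * v e x := by
  classical
  obtain ⟨hcu, hsu, hdu, ⟨w, hw, hwL⟩, hKu⟩ := hu
  obtain ⟨hcv, hsv, hdv, ⟨w', hw', hwL'⟩, hKv⟩ := hv
  obtain ⟨F, L, hFL⟩ := hsu.hasCompactSupp hfin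
  obtain ⟨F', L', hFL'⟩ := hsv.hasCompactSupp hfin
  replace hFL := hFL.mono (F.subset_union_left (s₂ := F')) (le_max_left L L')
  replace hFL' := hFL'.mono (F.subset_union_right (s₂ := F')) (le_max_right L L')
  have hder : ∀ e, ∀ x ∈ G.I e, derivWithin (fun x => c * u e x + d * v e x) (G.I e) x =
      c * derivWithin (u e) (G.I e) x + d * derivWithin (v e) (G.I e) x := fun e x hx =>
    (((((hdu e).differentiableOn (by norm_num) x hx).hasDerivWithinAt).const_mul c).add
      ((((hdv e).differentiableOn (by norm_num) x hx).hasDerivWithinAt).const_mul d)).derivWithin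
      (G.uniqueDiffOn_I e x hx)
  have hdc : ∀ {u : ℰ → ℝ → ℂ}, (∀ e, ContDiffOn ℝ 1 (u e) (G.I e)) → ∀ e,
      ContinuousOn (derivWithin (u e) (G.I e)) (G.openI e) := fun h e =>
    ((h e).continuousOn_derivWithin (G.uniqueDiffOn_I e) le_rfl).mono (G.openI_subset_I e)
  refine ⟨⟨fun e => (continuousOn_const.mul (hcu.1 e)).add (continuousOn_const.mul (hcv.1 e)),
    fun a b hab => ?_⟩, ?_, fun e => (contDiffOn_const.mul (hdu e)).add
      (contDiffOn_const.mul (hdv e)), ⟨fun e x => c * w e x + d * w' e x, fun e => ?_, ?_⟩, ?_⟩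
  · simp only [hcu.2 a b hab, hcv.2 a b hab]
  · exact ((hFL.of_eq_zero (v := fun e x => c * u e x) fun e x _ h0 => by simp [h0]).add
      (hFL'.of_eq_zero (v := fun e x => d * v e x) fun e x _ h0 => by simp [h0])).hasBddSupport
      hconn
  · have h1 := ((hw e).isPrimitiveOn (G.ordConnected_openI e) (G.isOpen_openI e)
      (hdc hdu e)).const_mul c
    have h2 := ((hw' e).isPrimitiveOn (G.ordConnected_openI e) (G.isOpen_openI e)
      (hdc hdv e)).const_mul d
    exact ((h1.add (G.ordConnected_openI e) h2).congr fun x hx =>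
      (hder e x (G.openI_subset_I e hx)).symm).hasWeakDeriv (G.ordConnected_openI e)
      (G.isOpen_openI e)
  · obtain ⟨f, hf⟩ := hwL.exists_represents
    obtain ⟨g, hg⟩ := hwL'.exists_represents
    exact ((hf.const_smul c).add (hg.const_smul d)).memL2
  · rw [kirchhoff_iff] at hKu hKv ⊢
    intro z
    -- Additivity of `finsum` requires finite supports; they are supplied by the compact supports.
    have hfinite : ∀ {P : ℰ → ℝ → ℂ}, G.HasCompactSupp P (F ∪ F') (max L L') →
        (Function.support fun a : {a : G.EdgeEnd // a.vertex = z} =>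
          (a.1.sign : ℂ) * P a.1.edge a.1.pos).Finite := fun {P} hP => by
      refine ((EdgeEnd.finite_of_edge (G := G) (F ∪ F')).preimage
        Subtype.val_injective.injOn).subset fun a ha => ?_
      exact (hP a.1.edge a.1.pos a.1.pos_mem_I (right_ne_zero_of_mul ha)).1
    have hf1 := hfinite (hFL.classicalMagD (A := A))
    have hf2 := hfinite (hFL'.classicalMagD (A := A))
    have hEq : ∀ a : {a : G.EdgeEnd // a.vertex = z}, (a.1.sign : ℂ) *
        G.classicalMagD A (fun e x => c * u e x + d * v e x) a.1.edge a.1.pos =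
        c * ((a.1.sign : ℂ) * G.classicalMagD A u a.1.edge a.1.pos) +
        d * ((a.1.sign : ℂ) * G.classicalMagD A v a.1.edge a.1.pos) := fun a => by
      simp only [classicalMagD, hder _ _ a.1.pos_mem_I]
      ring
    rw [finsum_congr hEq, finsum_add_distrib, ← mul_finsum, ← mul_finsum, hKu,
      hKv, mul_zero, mul_zero, add_zero]
    · exact hf1.subset fun a ha => right_ne_zero_of_mul ha
    · exact hf2.subset fun a ha => right_ne_zero_of_mul ha

/-- The elements of `L²` that are represented by functions in `H̃²_c`. -/
def domainH2c (A : ℰ → ℝ → ℝ) (hconn : G.Connected) (hfin : G.LocallyFinite) :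
    Submodule ℂ G.L2 where
  carrier := {f | ∃ u, G.MemH2c A u ∧ G.Represents u f}
  add_mem' := by
    rintro f g ⟨u, hu, hf⟩ ⟨v, hv, hg⟩
    refine ⟨_, hu.linear hconn hfin hv 1 1, ?_⟩
    simpa only [one_mul] using hf.add hg
  zero_mem' := by
    refine ⟨fun _ _ => 0, memH2c_of_contDiffOn (F := ∅) (L := 0) hconn
      ⟨fun e => continuousOn_const, fun _ _ _ => rfl⟩ (fun e x _ h => absurd rfl h)
      (fun e => contDiffOn_const) (fun a => ?_), represents_zero⟩
    simp [classicalMagD]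
  smul_mem' := by
    rintro c f ⟨u, hu, hf⟩
    refine ⟨_, hu.linear hconn hfin hu c 0, ?_⟩
    simpa only [zero_mul, add_zero] using hf.const_smul c

end MetricGraph

namespace MetricGraph

variable {𝒱 ℰ : Type*} {G : MetricGraph 𝒱 ℰ} {A V : ℰ → ℝ → ℝ} {u : ℰ → ℝ → ℂ}

/-! ### The operator associated with the form -/

/-- The elements of the energy space that come from `H̃²_c` are dense in it. -/
lemma dense_setOf_mem_domainH2c (hconn : G.Connected) (hfin : G.LocallyFinite)
    (hA : ∀ e, ContDiffOn ℝ 1 (A e) (G.I e)) (hV : ∀ e, ContinuousOn (V e) (G.I e))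
    (hV1 : ∀ e, ∀ x ∈ G.I e, 1 ≤ V e x) :
    Dense {y : G.energySpace A V | G.energyEmbedding A V y ∈ domainH2c A hconn hfin} := by
  intro y
  obtain ⟨z, hz, hzn⟩ := exists_compactSupp_tendsto hconn hfin y.2
  choose u p F L h1 h2 h3 h4 h5 h6 h7 using hzn
  refine isClosed_closure.mem_of_tendsto
    (f := fun n => (⟨z n, u n, p n, h1 n, h2 n, h3 n, h4 n, h5 n⟩ : G.energySpace A V))
    (tendsto_subtype_rng.mpr hz) (Eventually.of_forall fun n => ?_)
  -- Each cut-off function is itself a limit of functions in H̃²_c, so a double closure is taken.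
  obtain ⟨w, hw, hwn⟩ :=
    exists_memH2c_tendsto hconn hA hV hV1 (h1 n) (h2 n) (h3 n) (h4 n) (h5 n) (h6 n) (h7 n)
  exact mem_closure_of_tendsto
    (f := fun m => (⟨w m, (hwn m).1⟩ : G.energySpace A V))
    (tendsto_subtype_rng.mpr hw) (Eventually.of_forall fun m => (hwn m).2)

variable [CompleteSpace (G.energySpace A V)]

/-- The hypothesis says that y is the Riesz representative of the functional that the adjoint
assigns to g. -/
lemma adjoint_energyEmbedding_eq {y : PiLp 2 fun _ : Fin 3 => G.L2} (hy : y ∈ G.energySpace A V)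
    {g : G.L2} (h : ∀ z ∈ G.energySpace A V, ⟪z, y⟫_ℂ = ⟪z 2, g⟫_ℂ) :
    ContinuousLinearMap.adjoint (G.energyEmbedding A V) g = ⟨y, hy⟩ := by
  refine ext_inner_left ℂ fun z => ?_
  rw [ContinuousLinearMap.adjoint_inner_right, energyEmbedding_apply, Submodule.coe_inner]
  exact (h z z.2).symm

/-- Green's formula identifies J†(D_A² u + V u) with u as an element of the energy space; applying J
puts u into the range of J J†. -/
lemma MemH2c.exists_formOperator_eq (hJ : DenseRange (G.energyEmbedding A V))
    (hA : ∀ e, ContDiffOn ℝ 1 (A e) (G.I e)) (hV : ∀ e, ContinuousOn (V e) (G.I e))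
    (hV1 : ∀ e, ∀ x ∈ G.I e, 1 ≤ V e x) (hfin : G.LocallyFinite) (hu : G.MemH2c A u)
    {f : G.L2} (hf : G.Represents u f) : ∃ h : f ∈ (formOperator (G.energyEmbedding A V)).domain,
      G.Represents (fun e x => G.magD A (G.magD A u) e x + V e x * u e x)
        (formOperator (G.energyEmbedding A V) ⟨f, h⟩) := by
  obtain ⟨y, hy, g, hyu, hg, hyg⟩ := hu.exists_mem_energySpace hA hV hV1 hfin
  obtain ⟨h, hfg⟩ := _root_.exists_formOperator_eq hJ (f := f) (g := g) <| by
    rw [adjoint_energyEmbedding_eq hy hyg, energyEmbedding_apply]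
    exact hyu.unique hf
  exact ⟨h, hfg ▸ hg⟩

lemma isFormOperator_formOperator (hJ : DenseRange (G.energyEmbedding A V))
    (hA : ∀ e, ContinuousOn (A e) (G.I e)) (hV : ∀ e, ContinuousOn (V e) (G.I e))
    (hV1 : ∀ e, ∀ x ∈ G.I e, 1 ≤ V e x) :
    G.IsFormOperator A V (formOperator (G.energyEmbedding A V)) := by
  refine ⟨isSelfAdjoint_formOperator hJ, fun f => ?_⟩
  have hf := apply_adjoint_formOperator hJ f
  obtain ⟨u, hu, hu0, hu1, hu2⟩ := exists_memH1A_of_mem_energySpace hV hV1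
    (ContinuousLinearMap.adjoint (G.energyEmbedding A V)
      (formOperator (G.energyEmbedding A V) f)).2
  refine ⟨u, hu, ?_, fun g v hv hg => ?_⟩
  · rw [energyEmbedding_apply] at hf
    rwa [hf] at hu2
  · obtain ⟨z, hz, hz0, hz1, hz2⟩ := hv.exists_mem_energySpace hA hV hV1
    rw [← inner_energySpace hV1 hu0 hu1 hu2 hz0 hz1 hz2, hg.unique hz2]
    exact ContinuousLinearMap.adjoint_inner_right (G.energyEmbedding A V) ⟨z, hz⟩ _

/-- The identity Q(u, v) = (T u, v) forces J†(T f) to be the energy element of u, so f = J J†(T f).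
This gives one inclusion, and self-adjointness of both operators gives equality. -/
lemma IsFormOperator.eq_formOperator (hJ : DenseRange (G.energyEmbedding A V))
    (hA : ∀ e, ContinuousOn (A e) (G.I e)) (hV : ∀ e, ContinuousOn (V e) (G.I e))
    (hV1 : ∀ e, ∀ x ∈ G.I e, 1 ≤ V e x) {T : G.L2 →ₗ.[ℂ] G.L2} (hT : G.IsFormOperator A V T) :
    T = formOperator (G.energyEmbedding A V) := by
  refine LinearPMap.eq_of_le_of_isSelfAdjoint hT.1 (isSelfAdjoint_formOperator hJ)
    (LinearPMap.le_of_eqLocus_ge fun f hf => ?_)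
  obtain ⟨u, hu, huf, hQ⟩ := hT.2 ⟨f, hf⟩
  obtain ⟨y, hy, hy0, hy1, hy2⟩ := hu.exists_mem_energySpace hA hV hV1
  obtain ⟨h, hTf⟩ := _root_.exists_formOperator_eq hJ (f := f) (g := T ⟨f, hf⟩) <| by
    rw [adjoint_energyEmbedding_eq hy fun z hz => ?_, energyEmbedding_apply]
    · exact hy2.unique huf
    · obtain ⟨v, hv, hv0, hv1, hv2⟩ := exists_memH1A_of_mem_energySpace hV hV1 hz
      rw [inner_energySpace hV1 hy0 hy1 hy2 hv0 hv1 hv2, hQ _ v hv hv2]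
  exact ⟨hf, h, hTf.symm⟩

end MetricGraph

/-! ### The theorem -/

theorem lemma2p5 {𝒱 ℰ : Type*} (G : MetricGraph 𝒱 ℰ) (hconn : G.Connected)
    (hfin : G.LocallyFinite) (A V : ℰ → ℝ → ℝ)
    (hA : ∀ e, ContDiffOn ℝ 1 (A e) (G.I e))
    (hV : ∀ e, ContinuousOn (V e) (G.I e))
    (hV1 : ∀ e, ∀ x ∈ G.I e, 1 ≤ V e x) :
    G.H2cSubsetL2 A ∧
    ∃ S T : G.L2 →ₗ.[ℂ] G.L2,
      G.IsMagneticSchrodinger A V S ∧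
      G.IsFormOperator A V T ∧
      (∀ T' : G.L2 →ₗ.[ℂ] G.L2, G.IsFormOperator A V T' → T' = T) ∧
      IsFriedrichsExtension S T := by
  have hAc : ∀ e, ContinuousOn (A e) (G.I e) := fun e => (hA e).continuousOn
  have : CompleteSpace (G.energySpace A V) :=
    (MetricGraph.isClosed_energySpace hAc).completeSpace_coe
  have hJ := MetricGraph.denseRange_energyEmbedding hconn hfin hA hV hV1
  set T := formOperator (G.energyEmbedding A V)
  set D := MetricGraph.domainH2c A hconn hfin
  -- `S` is taken to be the restriction of `T` to H̃²_c; that it acts as D_A² + V is Green's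
  -- formula.
  have hD : D ≤ T.domain := fun f ⟨u, hu, huf⟩ =>
    (hu.exists_formOperator_eq hJ hA hV hV1 hfin huf).1
  have hST : T.domRestrict D ≤ T := LinearPMap.domRestrict_le
  have hdom : (T.domRestrict D).domain = D := by
    rw [LinearPMap.domRestrict_domain]
    exact inf_eq_left.mpr hD
  refine ⟨fun u hu => ?_, T.domRestrict D, T, ⟨fun f => ?_, fun f u hu huf => ?_⟩,
    MetricGraph.isFormOperator_formOperator hJ hAc hV hV1,
    fun T' hT' => hT'.eq_formOperator hJ hAc hV hV1,
    isFriedrichsExtension_formOperator hJ MetricGraph.energyEmbedding_injective hST ?_⟩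
  · obtain ⟨y, -, -, hy, -⟩ := hu.exists_mem_energySpace hA hV hV1 hfin
    exact ⟨_, hy⟩
  · rw [hdom]
    rfl
  · obtain ⟨h, hTf⟩ := hu.exists_formOperator_eq hJ hA hV hV1 hfin huf
    rwa [hST.2 (x := f) (y := ⟨f, h⟩) rfl]
  · rw [hdom]
    exact MetricGraph.dense_setOf_mem_domainH2c hconn hfin hA hV hV1
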